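/- All graphs are finite and simple. The size of a graph $H$ is $|V(H)|+|E(H)|$. A graph $G$ is an $\alpha$-expander if for every partition $(A,B)$ of $V(G)$ into two non-empty sets, at least $\alpha\min\{|A|,|B|\}$ edges of $G$ go between $A$ and $B$. A model of $H$ in $G$ consists of pairwise disjoint sets $X_u\subseteq V(G)$, $u\in V(H)$, each inducing a (non-empty) connected subgraph of $G$, and of a path $P_e$ in $G$ for every edge $e=uw$ of $H$, with one endpoint in $X_u$ and the other in $X_w$, such that the paths $P_e$ are internally disjoint from each other (a common vertex of two paths is an endpoint of both) and from $\bigcup_u X_u$ (a vertex of $P_e$ in this union is an endpoint of $P_e$). $H$ is a minor of $G$ if there is a model of $H$ in $G$. Theorem. There is a constant $\tilde c^*>0$ such that the following holds. (1) For every constant $k\in\mathbb N$ there are a randomized algorithm (a program for an additive unit-cost random access machine that can toss independent fair coins) and a real polynomial $T$ in two variables with the following property. Let $n\ge 2$ and $d$ be integers, let $0<\alpha<1$ be real, let $G$ be an $n$-vertex $\alpha$-expander with maximum vertex degree at most $d$, and let $H$ be a graph of size at most $$\frac{n}{\tilde c^*\log_2^2 n}\cdot\frac{\alpha^3}{d^5}.$$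 Then, given the adjacency matrices of $G$ and $H$, the algorithm always halts within $T(n,d/\alpha)$ steps, and with probability at least $1-n^{-k}$ its output is a model of $H$ in $G$. (2) In particular, every such graph $H$ is a minor of every such graph $G$. -/

import Mathlib

open MeasureTheory

/-! ## Graphs: size, expansion, minors -/

/-- The size of a finite graph: the number of its vertices plus the number of its edges. -/
noncomputable def graphSize {U : Type*} (H : SimpleGraph U) : ℕ :=
  Nat.card U + H.edgeSet.ncard

open Classical in
/-- `G` is an `α`-expander: for every partition `(A, B)` of its vertices into two non-empty sets,
at least `α * min |A| |B|` edges go between `A` and `B`.  (`G.interedges A B` is the set of pairs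
`(a, b)` of adjacent vertices with `a ∈ A`, `b ∈ B`: one pair for each edge of the cut.) -/
def IsExpander {V : Type*} (G : SimpleGraph V) (α : ℝ) : Prop :=
  ∀ A B : Finset V, A.Nonempty → B.Nonempty → Disjoint A B → (∀ v, v ∈ A ∨ v ∈ B) →
    α * (min A.card B.card : ℕ) ≤ ((G.interedges A B).card : ℝ)

/-- Every vertex of `G` has degree at most `d`. -/
def MaxDegreeLE {V : Type*} (G : SimpleGraph V) (d : ℕ) : Prop :=
  ∀ v, (G.neighborSet v).ncard ≤ d

/-- A model of `H` in `G`: pairwise disjoint sets `branch u` of vertices of `G` inducing connected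
(in particular non-empty) subgraphs, and, for every edge `e` of `H`, a path of `G` that connects
the sets of the two endpoints of `e`, the paths being internally disjoint from each other and from
the union of the sets `branch u`. -/
structure MinorModel {U V : Type*} (H : SimpleGraph U) (G : SimpleGraph V) where
  branch : U → Set V
  src : H.edgeSet → V
  tgt : H.edgeSet → V
  path : ∀ e : H.edgeSet, G.Walk (src e) (tgt e)
  isPath : ∀ e, (path e).IsPath
  connected : ∀ u, (G.induce (branch u)).Connected
  connects : ∀ e : H.edgeSet, ∃ u w : U,
    (e : Sym2 U) = s(u, w) ∧ src e ∈ branch u ∧ tgt e ∈ branch w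
  disjoint : ∀ u w, u ≠ w → Disjoint (branch u) (branch w)
  path_path : ∀ e e', e ≠ e' → ∀ x, x ∈ (path e).support → x ∈ (path e').support →
    (x = src e ∨ x = tgt e) ∧ (x = src e' ∨ x = tgt e')
  path_branch : ∀ e u x, x ∈ (path e).support → x ∈ branch u → x = src e ∨ x = tgt e

/-- `H` is a minor of `G`. -/
def IsMinorOf {U V : Type*} (H : SimpleGraph U) (G : SimpleGraph V) : Prop :=
  Nonempty (MinorModel H G)

/-! ## Randomized random access machines

A program works on scalar variables and on one-dimensional arrays, all holding natural numbers.
The arithmetic operations are addition and truncated subtraction only, and every operation has unit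
cost.  In `t` steps a number grows by at most `O(t)` bits, so this machine and a probabilistic
Turing machine simulate each other with polynomial overhead. -/

namespace RAM

/-- A memory state: the scalar variables, the arrays, and the number of coins tossed so far. -/
structure State where
  var : ℕ → ℕ
  arr : ℕ → ℕ → ℕ
  coins : ℕ

/-- Expressions: constants, variables, array reads, addition, truncated subtraction. -/
inductive Expr where
  | const (k : ℕ) : Expr
  | var (x : ℕ) : Expr
  | get (a : ℕ) (i : Expr) : Expr
  | add (e f : Expr) : Expr
  | sub (e f : Expr) : Expr

/-- The value of an expression. -/
def Expr.eval (s : State) : Expr → ℕ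
  | .const k => k
  | .var x => s.var x
  | .get a i => s.arr a (i.eval s)
  | .add e f => e.eval s + f.eval s
  | .sub e f => e.eval s - f.eval s

/-- The number of operations needed to evaluate an expression. -/
def Expr.cost : Expr → ℕ
  | .const _ => 1
  | .var _ => 1
  | .get _ i => i.cost + 1
  | .add e f => e.cost + f.cost + 1
  | .sub e f => e.cost + f.cost + 1

/-- Programs.  Tests succeed if the value of the expression is non-zero. -/
inductive Program where
  | skip : Program
  /-- `x := e` -/
  | assign (x : ℕ) (e : Expr) : Program
  /-- `a[i] := e` -/
  | store (a : ℕ) (i e : Expr) : Program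
  /-- `x :=` a fresh random bit -/
  | toss (x : ℕ) : Program
  | seq (p q : Program) : Program
  | cond (e : Expr) (p q : Program) : Program
  | loop (e : Expr) (p : Program) : Program

/-- `Run ω p s t s'`: with the coin tosses `ω`, program `p` started in the state `s` halts after
exactly `t` steps in the state `s'`. -/
inductive Run (ω : ℕ → Bool) : Program → State → ℕ → State → Prop
  | skip (s : State) : Run ω .skip s 1 s
  | assign (x : ℕ) (e : Expr) (s : State) :
      Run ω (.assign x e) s (e.cost + 1) { s with var := Function.update s.var x (e.eval s) }
  | store (a : ℕ) (i e : Expr) (s : State) :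
      Run ω (.store a i e) s (i.cost + e.cost + 1)
        { s with arr := Function.update s.arr a
                          (Function.update (s.arr a) (i.eval s) (e.eval s)) }
  | toss (x : ℕ) (s : State) :
      Run ω (.toss x) s 1
        { s with var := Function.update s.var x (if ω s.coins then 1 else 0),
                 coins := s.coins + 1 }
  | seq {p q : Program} {s s' s'' : State} {t t' : ℕ} :
      Run ω p s t s' → Run ω q s' t' s'' → Run ω (.seq p q) s (t + t') s''
  | cond_true {e : Expr} {p q : Program} {s s' : State} {t : ℕ} :
      e.eval s ≠ 0 → Run ω p s t s' → Run ω (.cond e p q) s (e.cost + 1 + t) s'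
  | cond_false {e : Expr} {p q : Program} {s s' : State} {t : ℕ} :
      e.eval s = 0 → Run ω q s t s' → Run ω (.cond e p q) s (e.cost + 1 + t) s'
  | loop_false {e : Expr} {p : Program} {s : State} :
      e.eval s = 0 → Run ω (.loop e p) s (e.cost + 1) s
  | loop_true {e : Expr} {p : Program} {s s' s'' : State} {t t' : ℕ} :
      e.eval s ≠ 0 → Run ω p s t s' → Run ω (.loop e p) s' t' s'' →
        Run ω (.loop e p) s (e.cost + 1 + t + t') s''

/-- The law of an infinite sequence of independent fair coin tosses. -/
noncomputable def coinLaw : Measure (ℕ → Bool) :=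
  Measure.infinitePi fun _ => (PMF.uniformOfFintype Bool).toMeasure

open Classical in
/-- The adjacency matrix of a graph on `{0, …, n - 1}`, written row by row. -/
noncomputable def adjArray {n : ℕ} (G : SimpleGraph (Fin n)) (k : ℕ) : ℕ :=
  if ∃ i j : Fin n, G.Adj i j ∧ k = i * n + j then 1 else 0

/-- The input of the algorithm: variables `0` and `1` hold the numbers `n` and `h` of vertices of
`G` and `H`, arrays `0` and `1` hold their adjacency matrices; the rest of the memory is zero. -/
noncomputable def inputState {n h : ℕ} (G : SimpleGraph (Fin n)) (H : SimpleGraph (Fin h)) :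
    State where
  var := fun x => if x = 0 then n else if x = 1 then h else 0
  arr := fun a k => if a = 0 then adjArray G k else if a = 1 then adjArray H k else 0
  coins := 0

/-- The state `s` spells out the model `M`: array `2` holds, for every vertex `v` of `G`, the number
`u + 1` if `v` lies in the set of the vertex `u` of `H`, and a number outside `{1, …, h}` if `v` lies
in none of these sets; for every edge `{u, w}` of `H` with `u < w`, the sequence of
vertices of its path is the segment of array `5` whose starting position and number of entries are
the entries `u * h + w` of arrays `3` and `4`. -/
def State.Represents {n h : ℕ} {G : SimpleGraph (Fin n)} {H : SimpleGraph (Fin h)} (s : State)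
    (M : MinorModel H G) : Prop :=
  (∀ (u : Fin h) (v : Fin n), v ∈ M.branch u ↔ s.arr 2 v = u + 1) ∧
  ∀ (u w : Fin h) (huw : H.Adj u w), u < w →
    (M.path ⟨s(u, w), huw⟩).support.map (fun x : Fin n => (x : ℕ)) =
      (List.range (s.arr 4 (u * h + w))).map fun k => s.arr 5 (s.arr 3 (u * h + w) + k)

end RAM

/-!
The algorithm is deterministic: it tosses no coins and succeeds with probability one, and the
existence of a minor is read off from its result.  The constant is `115200 = 2 * 240 ^ 2`.

**The embedding.**  The vertices of `H` are embedded one after the other.  At any time each vertex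
of `G` is free, or lies in the branch set of a vertex of `H`, or is discarded; the set `D` of
discarded vertices has a thin boundary among the free vertices `R`, of at most `|D| / q` vertices
(`PartialModel`).  From a free vertex `c`, a set is grown inside `R` by adding its boundary as long
as this multiplies the size by more than `1 + 1 / q`; the result is a ball whose radius is at most
`ρ`, about `q * log n` (`grow_eq_ball`), and its boundary in `R` is thin.

* If the grown set has at most half of the free vertices, it is discarded
  (`PartialModel.discard`).
* If all free vertices grow larger sets, then any two of these meet, and so any two free vertices
  are at distance at most `l = 2 * ρ` in `R` (`mem_ball_of_large`).  Branch sets without free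
  neighbours are discarded too (`PartialModel.retire`).  A new vertex `x` of `H` is then embedded
  with a branch set consisting of the paths of a breadth-first search tree of `R` from one root to a
  free neighbour of the branch set of each embedded neighbour of `x` (`branch_of_paths`,
  `PartialModel.embed`).  It has at most `1 + deg x * l` vertices, and edges to all of these.

So all branch sets together have at most `M = m * (1 + l)` vertices, for `m = |V(H)| + 2 * |E(H)|`.
A set `D` with at most two thirds of all vertices has, by expansion and the bounded degree, at least
`α * |D| / (2 * d)` neighbours outside; these lie in the branch sets or in the thin boundary.
Therefore `|D|` is at most about `d * M / α`, a small part of `n`, if `q ≥ 4 * d / α`.  It follows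
that free vertices never run out, and that `D` remains below two thirds after each discarding.  The
choice `q = ⌊√(n / m)⌋` meets the requirements under the given bound on the size of `H`
(`IsExpander.params`).  Lexicographically, the number of discarded vertices, the number of embedded
vertices of `H` and the number of tested vertices increase in each step (`RAM.Algorithm.den_step`),
so the process ends after polynomially many steps (`RAM.Algorithm.den_loop`), with an edge of `G`
between the branch sets of any two adjacent vertices of `H` (`exists_model`).

**The program.**  The algorithm is written in a small language in which every loop and every sum
runs over `0, …, N - 1` for a fixed bound `N`.  A command has a denotation as a function on states
(`RAM.Cmd.den`), and is compiled to the random access machine with a running time polynomial in `N`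
(`RAM.Cmd.run_compile`).  The bound `N = 2 * n ^ 2` is computed by a first command, which has the
bound `n` (`RAM.Algorithm.run_program`).  Correctness is a statement about denotations
(`RAM.Algorithm.den_main`).  Vertices are natural numbers here, and `natGraph` carries the two
graphs over.
-/

/-! ### Balls and sparse sets inside a set of vertices -/

section Balls

variable {V : Type*} [DecidableEq V]

open Classical in
/-- The boundary of `S` in `R`: the vertices of `R` outside `S` with a neighbour in `S`. -/
noncomputable def bdry (G : SimpleGraph V) (R S : Finset V) : Finset V :=
  R.filter fun v => v ∉ S ∧ ∃ w ∈ S, G.Adj v w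

theorem mem_bdry {G : SimpleGraph V} {R S : Finset V} {v : V} :
    v ∈ bdry G R S ↔ v ∈ R ∧ v ∉ S ∧ ∃ w ∈ S, G.Adj v w := by
  simp [bdry]

/-- The ball of radius `j` about `c` in the subgraph induced by `R` (for `c ∈ R`). -/
noncomputable def ball (G : SimpleGraph V) (R : Finset V) (c : V) : ℕ → Finset V
  | 0 => {c}
  | j + 1 => ball G R c j ∪ bdry G R (ball G R c j)

/-- One round of growing a set inside `R`: its boundary is added to `S`, unless the boundary has at
most `|S| / q` vertices, in which case `S` is final. -/
noncomputable def growStep (G : SimpleGraph V) (R : Finset V) (q : ℕ) (S : Finset V) : Finset V :=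
  if (bdry G R S).card * q ≤ S.card then S else S ∪ bdry G R S

variable {G : SimpleGraph V} {R : Finset V} {c v w : V} {i j q : ℕ}

theorem bdry_subset (S : Finset V) : bdry G R S ⊆ R := fun _ h => (mem_bdry.1 h).1

theorem disjoint_bdry (S : Finset V) : Disjoint S (bdry G R S) :=
  Finset.disjoint_left.2 fun _ h h' => (mem_bdry.1 h').2.1 h

theorem ball_subset_succ : ball G R c j ⊆ ball G R c (j + 1) := Finset.subset_union_left

theorem ball_mono (h : i ≤ j) : ball G R c i ⊆ ball G R c j := by
  induction j, h using Nat.le_induction with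
  | base => exact subset_rfl
  | succ j _ ih => exact ih.trans ball_subset_succ

theorem mem_ball_self : c ∈ ball G R c j := ball_mono (Nat.zero_le j) (by simp [ball])

theorem ball_subset (hc : c ∈ R) : ball G R c j ⊆ R := by
  induction j with
  | zero => simpa [ball] using hc
  | succ j ih => exact Finset.union_subset ih (bdry_subset _)

theorem mem_ball_succ_of_adj (hv : v ∈ ball G R c j) (hw : w ∈ R) (h : G.Adj w v) :
    w ∈ ball G R c (j + 1) := by
  by_cases hwj : w ∈ ball G R c j
  · exact ball_subset_succ hwj
  · exact Finset.mem_union_right _ (mem_bdry.2 ⟨hw, hwj, v, hv, h⟩)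

theorem mem_ball_trans (hv : v ∈ ball G R c i) (hw : w ∈ ball G R v j) :
    w ∈ ball G R c (i + j) := by
  induction j generalizing w with
  | zero =>
    obtain rfl : w = v := by simpa [ball] using hw
    exact hv
  | succ j ih =>
    rcases Finset.mem_union.1 hw with hw | hw
    · exact ball_subset_succ (ih hw)
    · obtain ⟨hR, -, u, hu, ha⟩ := mem_bdry.1 hw
      exact mem_ball_succ_of_adj (ih hu) hR ha

theorem mem_ball_symm (hc : c ∈ R) (hv : v ∈ ball G R c j) : c ∈ ball G R v j := by
  induction j generalizing v with
  | zero =>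
    obtain rfl : v = c := by simpa [ball] using hv
    exact mem_ball_self
  | succ j ih =>
    rcases Finset.mem_union.1 hv with hv | hv
    · exact ball_subset_succ (ih hv)
    · obtain ⟨hR, -, u, hu, ha⟩ := mem_bdry.1 hv
      have h1 : u ∈ ball G R v 1 :=
        mem_ball_succ_of_adj (j := 0) mem_ball_self (ball_subset hc hu) ha.symm
      simpa [add_comm] using mem_ball_trans h1 (ih hu)

/-- A grown set is a ball, of a radius that is logarithmic in its size: every round but the idle
ones multiplies the size by at least `1 + 1 / q`. -/
theorem grow_eq_ball (G : SimpleGraph V) (R : Finset V) (q : ℕ) (c : V) (k : ℕ) :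
    ∃ j, (growStep G R q)^[k] {c} = ball G R c j ∧
      (q + 1) ^ j ≤ q ^ j * ((growStep G R q)^[k] {c}).card := by
  induction k with
  | zero => exact ⟨0, by simp [ball]⟩
  | succ k ih =>
    obtain ⟨j, h1, h2⟩ := ih
    rw [Function.iterate_succ_apply']
    set S := (growStep G R q)^[k] {c} with hS
    by_cases h : (bdry G R S).card * q ≤ S.card
    · exact ⟨j, by rw [growStep, if_pos h]; exact h1, by rw [growStep, if_pos h]; exact h2⟩
    · refine ⟨j + 1, by rw [growStep, if_neg h, h1]; rfl, ?_⟩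
      rw [growStep, if_neg h, Finset.card_union_of_disjoint (disjoint_bdry S)]
      push Not at h
      calc (q + 1) ^ (j + 1) ≤ q ^ j * S.card * (q + 1) := by
            rw [pow_succ]; exact Nat.mul_le_mul_right _ h2
        _ = q ^ j * (q * S.card + S.card) := by ring
        _ ≤ q ^ j * (q * S.card + (bdry G R S).card * q) := by gcongr
        _ = q ^ (j + 1) * (S.card + (bdry G R S).card) := by ring

theorem grow_subset (hc : c ∈ R) (k : ℕ) : (growStep G R q)^[k] {c} ⊆ R := by
  obtain ⟨j, h, -⟩ := grow_eq_ball G R q c k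
  rw [h]; exact ball_subset hc

theorem mem_grow_self (k : ℕ) : c ∈ (growStep G R q)^[k] {c} := by
  obtain ⟨j, h, -⟩ := grow_eq_ball G R q c k
  rw [h]; exact mem_ball_self

theorem grow_sparse (hc : c ∈ R) {k : ℕ} (hk : R.card ≤ k) :
    (bdry G R ((growStep G R q)^[k] {c})).card * q ≤ ((growStep G R q)^[k] {c}).card := by
  have key : ∀ k, (bdry G R ((growStep G R q)^[k] {c})).card * q ≤
      ((growStep G R q)^[k] {c}).card ∨ k + 1 ≤ ((growStep G R q)^[k] {c}).card := by
    intro k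
    induction k with
    | zero => right; simp
    | succ k ih =>
      rw [Function.iterate_succ_apply']
      set S := (growStep G R q)^[k] {c}
      by_cases h : (bdry G R S).card * q ≤ S.card
      · left; rw [growStep, if_pos h]; exact h
      · right
        have hpos : 0 < (bdry G R S).card := by
          rcases Nat.eq_zero_or_pos (bdry G R S).card with h0 | h0
          · simp [h0] at h
          · exact h0
        rw [growStep, if_neg h, Finset.card_union_of_disjoint (disjoint_bdry S)]
        have := ih.resolve_left h
        omega
  rcases key k with h | h
  · exact h
  · have := Finset.card_le_card (grow_subset (G := G) (q := q) hc k)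
    omega

/-- If the sets grown from `c` and `c'` both have more than half of the vertices of `R`, then they
meet, and so `c` and `c'` are at distance at most `2 * ρ` in `R`. -/
theorem mem_ball_of_large {n ρ k : ℕ} (hR : R.card ≤ n)
    (hρ : ∀ j, (q + 1) ^ j ≤ q ^ j * n → j ≤ ρ) {c' : V} (hc' : c' ∈ R)
    (hb : R.card < 2 * ((growStep G R q)^[k] {c}).card) (hcR : c ∈ R)
    (hb' : R.card < 2 * ((growStep G R q)^[k] {c'}).card) : c' ∈ ball G R c (2 * ρ) := by
  obtain ⟨j, h1, h2⟩ := grow_eq_ball G R q c k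
  obtain ⟨j', h1', h2'⟩ := grow_eq_ball G R q c' k
  have hs := grow_subset (G := G) (q := q) hcR k
  have hs' := grow_subset (G := G) (q := q) hc' k
  have hj : j ≤ ρ := hρ j (h2.trans (Nat.mul_le_mul_left _ ((Finset.card_le_card hs).trans hR)))
  have hj' : j' ≤ ρ :=
    hρ j' (h2'.trans (Nat.mul_le_mul_left _ ((Finset.card_le_card hs').trans hR)))
  have hmeet : ¬ Disjoint ((growStep G R q)^[k] {c}) ((growStep G R q)^[k] {c'}) := by
    intro hd
    have := Finset.card_le_card (Finset.union_subset hs hs')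
    rw [Finset.card_union_of_disjoint hd] at this
    omega
  obtain ⟨v, hv, hv'⟩ := Finset.not_disjoint_iff.1 hmeet
  rw [h1] at hv
  rw [h1'] at hv'
  exact ball_mono (by omega) (mem_ball_trans hv (mem_ball_symm hc' hv'))

end Balls

/-! ### Connected sets and unions of paths towards a root -/

/-- Any two vertices of `S` are joined by a path inside `S`. -/
def Linked {V : Type*} (G : SimpleGraph V) (S : Finset V) : Prop :=
  ∀ a ∈ S, ∀ b ∈ S, Relation.ReflTransGen (fun x y => G.Adj x y ∧ x ∈ S ∧ y ∈ S) a b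

theorem linked_of_root {V : Type*} {G : SimpleGraph V} {S : Finset V} {r : V}
    (h : ∀ a ∈ S, Relation.ReflTransGen (fun x y => G.Adj x y ∧ x ∈ S ∧ y ∈ S) a r) :
    Linked G S := fun a ha b hb =>
  haveI : Std.Symm fun x y => G.Adj x y ∧ x ∈ S ∧ y ∈ S :=
    ⟨fun _ _ hxy => ⟨hxy.1.symm, hxy.2.2, hxy.2.1⟩⟩
  (h a ha).trans (Std.Symm.symm _ _ (h b hb))

/-- `p` maps every vertex of the balls about `r`, other than `r`, to a neighbour in the next
smaller ball: a breadth-first search tree, given by its parent function. -/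
structure IsParent {V : Type*} [DecidableEq V] (G : SimpleGraph V) (R : Finset V) (r : V) (L : ℕ)
    (p : V → V) : Prop where
  root : p r = r
  desc : ∀ j < L, ∀ v ∈ ball G R r (j + 1), p v ∈ ball G R r j
  adj : ∀ v ∈ ball G R r L, v = r ∨ G.Adj v (p v)

namespace IsParent

variable {V : Type*} [DecidableEq V] {G : SimpleGraph V} {R : Finset V} {r : V} {L : ℕ} {p : V → V}

theorem iterate_root (hp : IsParent G R r L p) (j : ℕ) : p^[j] r = r :=
  Function.iterate_fixed hp.root j

theorem iterate_mem (hp : IsParent G R r L p) {l : ℕ} (hl : l ≤ L) {v : V}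
    (hv : v ∈ ball G R r l) : ∀ j ≤ l, p^[j] v ∈ ball G R r (l - j) := by
  intro j
  induction j with
  | zero => intro _; simpa using hv
  | succ j ih =>
    intro hj
    rw [Function.iterate_succ_apply']
    refine hp.desc (l - (j + 1)) (by omega) _ ?_
    rw [show l - (j + 1) + 1 = l - j by omega]
    exact ih (by omega)

theorem iterate_eq_root (hp : IsParent G R r L p) {l : ℕ} (hl : l ≤ L) {v : V}
    (hv : v ∈ ball G R r l) {j : ℕ} (hj : l ≤ j) : p^[j] v = r := by
  have h : p^[l] v = r := by
    have := hp.iterate_mem hl hv l le_rfl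
    simpa [ball] using this
  obtain ⟨k, rfl⟩ := Nat.exists_eq_add_of_le' hj
  rw [Function.iterate_add_apply, h, hp.iterate_root]

theorem iterate_mem_ball (hp : IsParent G R r L p) {v : V} (hv : v ∈ ball G R r L) (j : ℕ) :
    p^[j] v ∈ ball G R r L := by
  rcases le_total L j with h | h
  · rw [hp.iterate_eq_root le_rfl hv h]; exact mem_ball_self
  · exact ball_mono (by omega) (hp.iterate_mem le_rfl hv j h)

/-- The union of the tree paths from the vertices of `Z` to the root is connected and has at most
`1 + |Z| * l` vertices if `Z` lies in the ball of radius `l`. -/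
theorem linked_paths (hp : IsParent G R r L p) {l : ℕ} (hl : l ≤ L) {Z M : Finset V}
    (hZ : ∀ z ∈ Z, z ∈ ball G R r l)
    (hM : ∀ v, v ∈ M ↔ v = r ∨ ∃ z ∈ Z, ∃ j, v = p^[j] z) :
    Linked G M ∧ M.card ≤ 1 + Z.card * l ∧ M ⊆ ball G R r L := by
  have hZL : ∀ z ∈ Z, z ∈ ball G R r L := fun z hz => ball_mono hl (hZ z hz)
  refine ⟨linked_of_root (r := r) ?_, ?_, ?_⟩
  · intro a ha
    rcases (hM a).1 ha with rfl | ⟨z, hz, j, rfl⟩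
    · exact .refl
    · suffices ∀ i j, j + i = l →
          Relation.ReflTransGen (fun x y => G.Adj x y ∧ x ∈ M ∧ y ∈ M) (p^[j] z) r by
        rcases le_total j l with h | h
        · exact this (l - j) j (by omega)
        · rw [hp.iterate_eq_root hl (hZ z hz) h]
      intro i
      induction i with
      | zero =>
        intro j hj
        rw [hp.iterate_eq_root hl (hZ z hz) (by omega)]
      | succ i ih =>
        intro j hj
        rcases hp.adj _ (hp.iterate_mem_ball (hZL z hz) j) with h | h
        · rw [h]
        · refine .head ⟨h, (hM _).2 (.inr ⟨z, hz, j, rfl⟩), (hM _).2 (.inr ⟨z, hz, j + 1, ?_⟩)⟩ ?_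
          · rw [Function.iterate_succ_apply']
          · rw [← Function.iterate_succ_apply' p]
            exact ih (j + 1) (by omega)
  · have hsub : M ⊆ insert r ((Z ×ˢ Finset.range l).image fun zj => p^[zj.2] zj.1) := by
      intro v hv
      rcases (hM v).1 hv with rfl | ⟨z, hz, j, rfl⟩
      · exact Finset.mem_insert_self _ _
      · rcases le_or_gt l j with h | h
        · rw [hp.iterate_eq_root hl (hZ z hz) h]; exact Finset.mem_insert_self _ _
        · exact Finset.mem_insert_of_mem (Finset.mem_image.2
            ⟨(z, j), Finset.mem_product.2 ⟨hz, Finset.mem_range.2 h⟩, rfl⟩)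
    refine (Finset.card_le_card hsub).trans ((Finset.card_insert_le _ _).trans ?_)
    have := Finset.card_image_le (s := Z ×ˢ Finset.range l) (f := fun zj => p^[zj.2] zj.1)
    rw [Finset.card_product, Finset.card_range] at this
    omega
  · intro v hv
    rcases (hM v).1 hv with rfl | ⟨z, hz, j, rfl⟩
    · exact mem_ball_self
    · exact hp.iterate_mem_ball (hZL z hz) j

end IsParent

/-! ### Partial models given by labels -/

/-- The vertices among `0, …, n - 1` with label `k`.  A labelling `f` stands for a partial model of
a graph on `0, …, h - 1`: the label `0` means that a vertex is free, the label `u + 1` that it lies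
in the branch set of `u`, and the label `h + 1` that it is discarded. -/
def cls (n : ℕ) (f : ℕ → ℕ) (k : ℕ) : Finset ℕ := (Finset.range n).filter fun v => f v = k

theorem mem_cls {n : ℕ} {f : ℕ → ℕ} {k v : ℕ} : v ∈ cls n f k ↔ v < n ∧ f v = k := by
  simp [cls]

open Classical in
/-- The number of neighbours of `u` among `0, …, h - 1`. -/
noncomputable def degIn (H : SimpleGraph ℕ) (h u : ℕ) : ℕ :=
  ((Finset.range h).filter (H.Adj u)).card

/-- The invariant of the greedy embedding of `H` (on `0, …, h - 1`) into `G` (on `0, …, n - 1`). -/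
structure PartialModel (G H : SimpleGraph ℕ) (n h q l : ℕ) (f : ℕ → ℕ) : Prop where
  le : ∀ v < n, f v ≤ h + 1
  /-- Few free vertices have discarded neighbours. -/
  thin : (bdry G (cls n f 0) (cls n f (h + 1))).card * q ≤ (cls n f (h + 1)).card
  linked : ∀ u < h, Linked G (cls n f (u + 1))
  adj : ∀ u < h, ∀ w < h, H.Adj u w → (cls n f (u + 1)).Nonempty → (cls n f (w + 1)).Nonempty →
    ∃ a ∈ cls n f (u + 1), ∃ b ∈ cls n f (w + 1), G.Adj a b
  card : ∀ u < h, (cls n f (u + 1)).card ≤ 1 + degIn H h u * l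
  small : 3 * (cls n f (h + 1)).card ≤ 2 * n

/-- The numerical assumptions of the greedy embedding: the branch sets can never fill more than a
small part of the graph, and the expansion of `G` keeps every set of discarded vertices with a thin
boundary small.  `M` bounds the total size of the branch sets. -/
structure Params (G H : SimpleGraph ℕ) (n h q l M : ℕ) : Prop where
  n_pos : 0 < n
  total : ∑ u ∈ Finset.range h, (1 + degIn H h u * l) ≤ M
  total_le : 12 * M ≤ n
  expand : ∀ D W R : Finset ℕ, (∀ v, v < n ↔ v ∈ D ∨ v ∈ W ∨ v ∈ R) → D ⊆ Finset.range n →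
    3 * D.card ≤ 2 * n → (bdry G R D).card * q ≤ D.card → W.card ≤ M → 12 * D.card ≤ n
  l_le : l ≤ n
  large : ∀ j, (q + 1) ^ j ≤ q ^ j * n → 2 * j ≤ l

section Labels

variable {G H : SimpleGraph ℕ} {n h q l M : ℕ} {f f' : ℕ → ℕ}

theorem cls_disjoint {i j : ℕ} (hij : i ≠ j) : Disjoint (cls n f i) (cls n f j) :=
  Finset.disjoint_left.2 fun _ hv hv' => hij ((mem_cls.1 hv).2.symm.trans (mem_cls.1 hv').2)

/-- The vertices in branch sets. -/
def used (n h : ℕ) (f : ℕ → ℕ) : Finset ℕ := (Finset.range h).biUnion fun u => cls n f (u + 1)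

theorem mem_used {v : ℕ} : v ∈ used n h f ↔ v < n ∧ f v ≠ 0 ∧ f v ≤ h := by
  simp only [used, Finset.mem_biUnion, Finset.mem_range, mem_cls]
  constructor
  · rintro ⟨u, hu, hv, he⟩
    omega
  · rintro ⟨h1, h2, h3⟩
    exact ⟨f v - 1, by omega, h1, by omega⟩

theorem PartialModel.card_used (hI : PartialModel G H n h q l f) (hP : Params G H n h q l M) :
    (used n h f).card ≤ M :=
  (Finset.card_biUnion_le.trans
    (Finset.sum_le_sum fun u hu => hI.card u (Finset.mem_range.1 hu))).trans hP.total

/-- The expansion of `G` keeps the discarded set small: its boundary lies in the branch sets, which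
are small, and in the thin boundary among the free vertices. -/
theorem PartialModel.twelve_mul_card_le (hI : PartialModel G H n h q l f)
    (hP : Params G H n h q l M) :
    12 * (cls n f (h + 1)).card ≤ n := by
  refine hP.expand _ (used n h f) (cls n f 0) (fun v => ?_) ?_ hI.small hI.thin
    (hI.card_used hP)
  · simp only [mem_used, mem_cls]
    have := hI.le v
    grind
  · intro v hv
    exact Finset.mem_range.2 (mem_cls.1 hv).1

theorem PartialModel.exists_free (hI : PartialModel G H n h q l f) (hP : Params G H n h q l M) :
    (cls n f 0).Nonempty := by
  by_contra hne
  rw [Finset.not_nonempty_iff_eq_empty] at hne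
  have hsub : Finset.range n ⊆ cls n f (h + 1) ∪ used n h f := by
    intro v hv
    rw [Finset.mem_range] at hv
    have h0 : v ∉ cls n f 0 := by simp [hne]
    simp only [Finset.mem_union, mem_used, mem_cls] at h0 ⊢
    have := hI.le v hv
    grind
  have h1 := (Finset.card_le_card hsub).trans (Finset.card_union_le _ _)
  rw [Finset.card_range] at h1
  have h2 := hI.card_used hP
  have h3 := hI.twelve_mul_card_le hP
  have h4 := hP.total_le
  have h5 := hP.n_pos
  omega

theorem PartialModel.init (G H : SimpleGraph ℕ) (n h q l : ℕ) :
    PartialModel G H n h q l fun _ => 0 := by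
  have h0 : ∀ k, cls n (fun _ => 0) (k + 1) = ∅ := fun k => by ext v; simp [mem_cls]
  refine ⟨fun v _ => Nat.zero_le _, ?_, ?_, ?_, ?_, ?_⟩
  · have : bdry G (cls n (fun _ => 0) 0) ∅ = ∅ := by ext v; simp [mem_bdry]
    simp [h0, this]
  all_goals simp [h0, Linked]

theorem cls_update_self {S : Finset ℕ} {k : ℕ} (hS : S ⊆ Finset.range n)
    (hf : ∀ v < n, f' v = if v ∈ S then k else f v) : cls n f' k = cls n f k ∪ S := by
  ext v
  have := fun hv : v ∈ S => Finset.mem_range.1 (hS hv)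
  simp only [mem_cls, Finset.mem_union]
  grind

theorem cls_update_of_ne {S : Finset ℕ} {k j : ℕ} (hjk : j ≠ k)
    (hf : ∀ v < n, f' v = if v ∈ S then k else f v) : cls n f' j = cls n f j \ S := by
  ext v
  simp only [mem_cls, Finset.mem_sdiff]
  grind

theorem cls_subset_range {k : ℕ} : cls n f k ⊆ Finset.range n := Finset.filter_subset _ _

/-- Discarding a set of at most half of the free vertices with a thin boundary. -/
theorem PartialModel.discard (hI : PartialModel G H n h q l f) (hP : Params G H n h q l M)
    {S : Finset ℕ} (hS : S ⊆ cls n f 0) (hthin : (bdry G (cls n f 0) S).card * q ≤ S.card)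
    (hhalf : 2 * S.card ≤ (cls n f 0).card)
    (hf : ∀ v < n, f' v = if v ∈ S then h + 1 else f v) :
    PartialModel G H n h q l f' ∧ (cls n f' (h + 1)).card = (cls n f (h + 1)).card + S.card ∧
      ∀ u < h, cls n f' (u + 1) = cls n f (u + 1) := by
  have hD := cls_update_self (hS.trans cls_subset_range) hf
  have hR := cls_update_of_ne (j := 0) (by omega) hf
  have hB : ∀ u < h, cls n f' (u + 1) = cls n f (u + 1) := by
    intro u hu
    rw [cls_update_of_ne (by omega) hf, Finset.sdiff_eq_self_iff_disjoint]
    exact (cls_disjoint (by omega)).mono_right hS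
  have hdisj : Disjoint (cls n f (h + 1)) S := (cls_disjoint (by omega)).mono_right hS
  have hcard : (cls n f' (h + 1)).card = (cls n f (h + 1)).card + S.card := by
    rw [hD, Finset.card_union_of_disjoint hdisj]
  refine ⟨⟨?_, ?_, ?_, ?_, ?_, ?_⟩, hcard, hB⟩
  · intro v hv
    have := hI.le v hv
    rw [hf v hv]
    split_ifs <;> omega
  · have hsub : bdry G (cls n f' 0) (cls n f' (h + 1)) ⊆
        bdry G (cls n f 0) (cls n f (h + 1)) ∪ bdry G (cls n f 0) S := by
      intro v hv
      rw [hR, hD] at hv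
      simp only [mem_bdry, Finset.mem_union, Finset.mem_sdiff] at hv ⊢
      grind
    have h1 := (Finset.card_le_card hsub).trans (Finset.card_union_le _ _)
    have h2 := hI.thin
    rw [hcard]
    nlinarith
  · intro u hu; rw [hB u hu]; exact hI.linked u hu
  · intro u hu w hw; rw [hB u hu, hB w hw]; exact hI.adj u hu w hw
  · intro u hu; rw [hB u hu]; exact hI.card u hu
  · have h1 := hI.twelve_mul_card_le hP
    have h2 := Finset.card_le_card (cls_subset_range (n := n) (f := f) (k := 0))
    rw [Finset.card_range] at h2
    omega

/-- Discarding all branch sets without free neighbours. -/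
theorem PartialModel.retire (hI : PartialModel G H n h q l f) (hP : Params G H n h q l M)
    (hf₁ : ∀ v < n, (f v ≠ 0 ∧ f v ≤ h ∧
      ¬ ∃ a ∈ cls n f (f v), ∃ b ∈ cls n f 0, G.Adj a b) → f' v = h + 1)
    (hf₀ : ∀ v < n, ¬ (f v ≠ 0 ∧ f v ≤ h ∧
      ¬ ∃ a ∈ cls n f (f v), ∃ b ∈ cls n f 0, G.Adj a b) → f' v = f v) :
    PartialModel G H n h q l f' ∧ cls n f' 0 = cls n f 0 ∧
      (cls n f (h + 1)).card ≤ (cls n f' (h + 1)).card ∧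
      (∀ u < h, (cls n f (u + 1) = ∅ → cls n f' (u + 1) = ∅)) ∧
      (∀ u < h, (cls n f' (u + 1)).Nonempty → ∃ a ∈ cls n f' (u + 1), ∃ b ∈ cls n f' 0, G.Adj a b) ∧
      ((cls n f (h + 1)).card = (cls n f' (h + 1)).card →
        ∀ u < h, cls n f' (u + 1) = cls n f (u + 1)) := by
  classical
  set S := (used n h f).filter fun v =>
    ¬ ∃ a ∈ cls n f (f v), ∃ b ∈ cls n f 0, G.Adj a b with hSdef
  have hmem : ∀ v, v ∈ S ↔ (v < n ∧ f v ≠ 0 ∧ f v ≤ h) ∧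
      ¬ ∃ a ∈ cls n f (f v), ∃ b ∈ cls n f 0, G.Adj a b := by
    intro v; rw [hSdef, Finset.mem_filter, mem_used]
  have hf2 : ∀ v < n, f' v = if v ∈ S then h + 1 else f v := by
    intro v hv
    split_ifs with hvS
    · rw [hmem] at hvS
      exact hf₁ v hv (by tauto)
    · rw [hmem] at hvS
      exact hf₀ v hv (by tauto)
  have hSr : S ⊆ Finset.range n := fun v hv => Finset.mem_range.2 ((hmem v).1 hv).1.1
  have hD := cls_update_self hSr hf2
  have hR : cls n f' 0 = cls n f 0 := by
    rw [cls_update_of_ne (by omega) hf2, Finset.sdiff_eq_self_iff_disjoint,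
      Finset.disjoint_left]
    intro v hv hvS
    exact ((hmem v).1 hvS).1.2.1 (mem_cls.1 hv).2
  have hB : ∀ u < h, cls n f' (u + 1) =
      if (∃ a ∈ cls n f (u + 1), ∃ b ∈ cls n f 0, G.Adj a b) then cls n f (u + 1) else ∅ := by
    intro u hu
    rw [cls_update_of_ne (by omega) hf2]
    split_ifs with hc
    · rw [Finset.sdiff_eq_self_iff_disjoint, Finset.disjoint_left]
      intro v hv hvS
      have := ((hmem v).1 hvS).2
      rw [(mem_cls.1 hv).2] at this
      exact this hc
    · rw [Finset.sdiff_eq_empty_iff_subset]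
      intro v hv
      have h2 := mem_cls.1 hv
      rw [hmem, h2.2]
      exact ⟨⟨h2.1, by omega, by omega⟩, hc⟩
  have hBsub : ∀ u < h, cls n f' (u + 1) = cls n f (u + 1) ∨ cls n f' (u + 1) = ∅ := by
    intro u hu; rw [hB u hu]; split_ifs <;> simp
  have hSD : Disjoint (cls n f (h + 1)) S := by
    rw [Finset.disjoint_left]
    intro v hv hvS
    have := ((hmem v).1 hvS).1.2.2
    have := (mem_cls.1 hv).2
    omega
  have hcard : (cls n f' (h + 1)).card = (cls n f (h + 1)).card + S.card := by
    rw [hD, Finset.card_union_of_disjoint hSD]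
  refine ⟨⟨?_, ?_, ?_, ?_, ?_, ?_⟩, hR, by omega, ?_, ?_, ?_⟩
  · intro v hv
    have := hI.le v hv
    rw [hf2 v hv]
    split_ifs <;> omega
  · have hsub : bdry G (cls n f' 0) (cls n f' (h + 1)) ⊆
        bdry G (cls n f 0) (cls n f (h + 1)) := by
      intro v hv
      rw [hR, hD] at hv
      rw [mem_bdry] at hv ⊢
      obtain ⟨h1, h2, w, hw, ha⟩ := hv
      refine ⟨h1, fun h3 => h2 (Finset.mem_union_left _ h3), w, ?_, ha⟩
      rcases Finset.mem_union.1 hw with hw | hw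
      · exact hw
      · exact absurd ⟨w, mem_cls.2 ⟨((hmem w).1 hw).1.1, rfl⟩, v, h1, ha.symm⟩ ((hmem w).1 hw).2
    have h1 := Finset.card_le_card hsub
    have h2 := hI.thin
    rw [hcard]
    nlinarith
  · intro u hu
    rcases hBsub u hu with h1 | h1 <;> rw [h1]
    · exact hI.linked u hu
    · intro a ha; simp at ha
  · intro u hu w hw ha hue hwe
    rcases hBsub u hu with h1 | h1
    · rcases hBsub w hw with h2 | h2
      · rw [h1] at hue ⊢; rw [h2] at hwe ⊢
        exact hI.adj u hu w hw ha hue hwe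
      · simp [h2] at hwe
    · simp [h1] at hue
  · intro u hu
    rcases hBsub u hu with h1 | h1 <;> rw [h1]
    · exact hI.card u hu
    · simp
  · have h1 := hI.twelve_mul_card_le hP
    have h2 : S.card ≤ M := (Finset.card_le_card (Finset.filter_subset _ _)).trans (hI.card_used hP)
    have := hP.total_le
    omega
  · intro u hu h0
    rcases hBsub u hu with h1 | h1 <;> rw [h1]
    exact h0
  · intro u hu hne
    rw [hB u hu] at hne ⊢
    rw [hR]
    split_ifs at hne ⊢ with hc
    · exact hc
    · simp at hne
  · intro heq u hu
    have hS0 : S = ∅ := Finset.card_eq_zero.1 (by omega)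
    rw [cls_update_of_ne (by omega) hf2, hS0, Finset.sdiff_empty]

/-- A connected set of free vertices becomes the branch set of `x`. -/
theorem PartialModel.embed (hI : PartialModel G H n h q l f) {x : ℕ} (hx : x < h)
    (hxe : cls n f (x + 1) = ∅) {S : Finset ℕ} (hS : S ⊆ cls n f 0) (hlink : Linked G S)
    (hcard : S.card ≤ 1 + degIn H h x * l)
    (hadj : ∀ y < h, H.Adj x y → (cls n f (y + 1)).Nonempty →
      ∃ a ∈ S, ∃ b ∈ cls n f (y + 1), G.Adj a b)
    (hf : ∀ v < n, f' v = if v ∈ S then x + 1 else f v) :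
    PartialModel G H n h q l f' ∧ cls n f' (h + 1) = cls n f (h + 1) ∧ cls n f' (x + 1) = S ∧
      ∀ u < h, u ≠ x → cls n f' (u + 1) = cls n f (u + 1) := by
  have hX : cls n f' (x + 1) = S := by
    rw [cls_update_self (hS.trans cls_subset_range) hf, hxe, Finset.empty_union]
  have hR := cls_update_of_ne (j := 0) (by omega) hf
  have hO : ∀ u, u ≠ 0 → u ≠ x + 1 → cls n f' u = cls n f u := by
    intro u hu hux
    rw [cls_update_of_ne hux hf, Finset.sdiff_eq_self_iff_disjoint]
    exact (cls_disjoint hu).mono_right hS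
  have hD : cls n f' (h + 1) = cls n f (h + 1) := hO _ (by omega) (by omega)
  have hB : ∀ u < h, u ≠ x → cls n f' (u + 1) = cls n f (u + 1) :=
    fun u hu hux => hO _ (by omega) (by omega)
  refine ⟨⟨?_, ?_, ?_, ?_, ?_, ?_⟩, hD, hX, hB⟩
  · intro v hv
    have := hI.le v hv
    rw [hf v hv]
    split_ifs <;> omega
  · rw [hD]
    refine le_trans (Nat.mul_le_mul_right _ (Finset.card_le_card ?_)) hI.thin
    intro v hv
    rw [hR] at hv
    simp only [mem_bdry, Finset.mem_sdiff] at hv ⊢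
    tauto
  · intro u hu
    by_cases hux : u = x
    · rw [hux, hX]; exact hlink
    · rw [hB u hu hux]; exact hI.linked u hu
  · intro u hu w hw ha hue hwe
    by_cases hux : u = x
    · subst hux
      have hwu : w ≠ u := ha.ne'
      rw [hB w hw hwu] at hwe ⊢
      rw [hX]
      exact hadj w hw ha hwe
    · by_cases hwx : w = x
      · subst hwx
        rw [hB u hu hux] at hue ⊢
        rw [hX]
        obtain ⟨a, h1, b, h2, h3⟩ := hadj u hu ha.symm hue
        exact ⟨b, h2, a, h1, h3.symm⟩
      · rw [hB u hu hux] at hue ⊢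
        rw [hB w hw hwx] at hwe ⊢
        exact hI.adj u hu w hw ha hue hwe
  · intro u hu
    by_cases hux : u = x
    · rw [hux, hX]; exact hcard
    · rw [hB u hu hux]; exact hI.card u hu
  · rw [hD]; exact hI.small

/-- If the set grown from every free vertex is large, then any two free vertices are close to each
other. -/
theorem Params.mem_ball (hP : Params G H n h q l M) {k : ℕ}
    (hbig : ∀ c ∈ cls n f 0,
      (cls n f 0).card < 2 * ((growStep G (cls n f 0) q)^[k] {c}).card)
    {r z : ℕ} (hr : r ∈ cls n f 0) (hz : z ∈ cls n f 0) : z ∈ ball G (cls n f 0) r l := by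
  have hR : (cls n f 0).card ≤ n := by
    simpa using Finset.card_le_card (cls_subset_range (n := n) (f := f) (k := 0))
  have hρ : ∀ j, (q + 1) ^ j ≤ q ^ j * n → j ≤ l / 2 := fun j hj => by
    have := hP.large j hj
    omega
  exact ball_mono (Nat.mul_div_le l 2)
    (mem_ball_of_large hR hρ hz (hbig r hr) hr (hbig z hz))

/-- The vertex `z` is free and has a neighbour in the branch set of `y`. -/
def Attached (G : SimpleGraph ℕ) (n : ℕ) (f : ℕ → ℕ) (y z : ℕ) : Prop :=
  z ∈ cls n f 0 ∧ ∃ b ∈ cls n f (y + 1), G.Adj z b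

/-- The tree paths from the root `r` to the least free vertices attached to the branch sets of the
neighbours of `x` form a suitable branch set for `x`. -/
theorem branch_of_paths {r x L : ℕ} {p : ℕ → ℕ} {S : Finset ℕ} (hr : r ∈ cls n f 0)
    (hp : IsParent G (cls n f 0) r L p) (hl : l ≤ L)
    (hball : ∀ z ∈ cls n f 0, z ∈ ball G (cls n f 0) r l)
    (hnear : ∀ y < h, (cls n f (y + 1)).Nonempty →
      ∃ a ∈ cls n f (y + 1), ∃ b ∈ cls n f 0, G.Adj a b)
    (hS : ∀ v, v ∈ S ↔ v = r ∨ ∃ z, (∃ y < h, H.Adj x y ∧ IsLeast {z | Attached G n f y z} z) ∧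
      ∃ j, v = p^[j] z) :
    Linked G S ∧ S.card ≤ 1 + degIn H h x * l ∧ S ⊆ cls n f 0 ∧
      ∀ y < h, H.Adj x y → (cls n f (y + 1)).Nonempty →
        ∃ a ∈ S, ∃ b ∈ cls n f (y + 1), G.Adj a b := by
  classical
  set Z := (cls n f 0).filter fun z => ∃ y < h, H.Adj x y ∧ IsLeast {z | Attached G n f y z} z
    with hZ
  have hmem : ∀ z, z ∈ Z ↔ ∃ y < h, H.Adj x y ∧ IsLeast {z | Attached G n f y z} z := by
    intro z
    rw [hZ, Finset.mem_filter, and_iff_right_of_imp]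
    rintro ⟨y, -, -, hz⟩
    exact hz.1.1
  have hcard : Z.card ≤ degIn H h x := by
    have : Z ⊆ ((Finset.range h).filter (H.Adj x)).image fun y =>
        sInf {z | Attached G n f y z} := by
      intro z hz
      obtain ⟨y, hy, hxy, hz⟩ := (hmem z).1 hz
      exact Finset.mem_image.2 ⟨y, Finset.mem_filter.2 ⟨Finset.mem_range.2 hy, hxy⟩, hz.csInf_eq⟩
    exact (Finset.card_le_card this).trans Finset.card_image_le
  obtain ⟨h1, h2, h3⟩ := hp.linked_paths (Z := Z) (M := S) hl
    (fun z hz => hball z (Finset.mem_filter.1 hz).1) (by simpa only [hmem] using hS)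
  refine ⟨h1, h2.trans (by gcongr), h3.trans (ball_subset hr), fun y hy hxy hne => ?_⟩
  obtain ⟨a, ha, b, hb, hab⟩ := hnear y hy hne
  have hex : {z | Attached G n f y z}.Nonempty := ⟨b, hb, a, ha, hab.symm⟩
  have hz := Nat.sInf_mem hex
  obtain ⟨c, hc, hzc⟩ := hz.2
  exact ⟨_, (hS _).2 (.inr ⟨_, ⟨y, hy, hxy, hz, fun z hz' => Nat.sInf_le hz'⟩, 0, rfl⟩), c, hc, hzc⟩

open Classical in
/-- The number of vertices of `H` that have a branch set. -/
noncomputable def embedded (n h : ℕ) (f : ℕ → ℕ) : ℕ :=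
  ((Finset.range h).filter fun u => (cls n f (u + 1)).Nonempty).card

/-- The state of a breadth-first search after `i` rounds: the array `P` holds `0` for the vertices
that were not reached, and the parent of a vertex plus one for the others. -/
structure IsSearch (G : SimpleGraph ℕ) (R : Finset ℕ) (r i : ℕ) (P : ℕ → ℕ) : Prop where
  reached : ∀ v ∈ R, P v ≠ 0 ↔ v ∈ ball G R r i
  root : P r = r + 1
  desc : ∀ j < i, ∀ v ∈ ball G R r (j + 1), P v - 1 ∈ ball G R r j
  adj : ∀ v ∈ ball G R r i, v = r ∨ G.Adj v (P v - 1)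

theorem IsSearch.isParent {R : Finset ℕ} {r i : ℕ} {P : ℕ → ℕ} (hP : IsSearch G R r i P) :
    IsParent G R r i fun v => P v - 1 :=
  ⟨by simp [hP.root], hP.desc, hP.adj⟩

theorem IsSearch.succ {R : Finset ℕ} {r i : ℕ} {P P' : ℕ → ℕ} (hr : r ∈ R)
    (hP : IsSearch G R r i P) (hold : ∀ v ∈ R, P v ≠ 0 → P' v = P v)
    (hnew : ∀ v ∈ R, P v = 0 → (∃ w ∈ R, G.Adj v w ∧ P w ≠ 0) →
      ∃ w ∈ R, G.Adj v w ∧ P w ≠ 0 ∧ P' v = w + 1)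
    (hnone : ∀ v ∈ R, P v = 0 → ¬ (∃ w ∈ R, G.Adj v w ∧ P w ≠ 0) → P' v = 0) :
    IsSearch G R r (i + 1) P' := by
  have hb : ∀ v ∈ R, P v = 0 → ((∃ w ∈ R, G.Adj v w ∧ P w ≠ 0) ↔ v ∈ ball G R r (i + 1)) := by
    intro v hv h0
    constructor
    · rintro ⟨w, hw, ha, hPw⟩
      exact mem_ball_succ_of_adj ((hP.reached w hw).1 hPw) hv ha
    · intro hvb
      rcases Finset.mem_union.1 hvb with h1 | h1
      · exact absurd h0 ((hP.reached v hv).2 h1)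
      · obtain ⟨-, -, w, hw, ha⟩ := mem_bdry.1 h1
        exact ⟨w, ball_subset hr hw, ha, (hP.reached w (ball_subset hr hw)).2 hw⟩
  have hkeep : ∀ v ∈ ball G R r i, P' v = P v := fun v hv =>
    hold v (ball_subset hr hv) ((hP.reached v (ball_subset hr hv)).2 hv)
  have hnext : ∀ v ∈ ball G R r (i + 1), v ∉ ball G R r i →
      P' v - 1 ∈ ball G R r i ∧ G.Adj v (P' v - 1) := by
    intro v hv hvi
    have hvR := ball_subset hr hv
    have h0 : P v = 0 := by
      by_contra h0
      exact hvi ((hP.reached v hvR).1 h0)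
    obtain ⟨w, hw, ha, hPw, he⟩ := hnew v hvR h0 ((hb v hvR h0).2 hv)
    rw [he]
    exact ⟨(hP.reached w hw).1 hPw, ha⟩
  refine ⟨fun v hv => ?_, ?_, fun j hj v hv => ?_, fun v hv => ?_⟩
  · by_cases h0 : P v = 0
    · rw [← hb v hv h0]
      by_cases hw : ∃ w ∈ R, G.Adj v w ∧ P w ≠ 0
      · obtain ⟨w, -, -, -, he⟩ := hnew v hv h0 hw
        simpa [he] using hw
      · simp only [hnone v hv h0 hw, hw]; simp
    · rw [hold v hv h0]
      exact ⟨fun h => ball_subset_succ ((hP.reached v hv).1 h), fun _ => h0⟩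
  · rw [hkeep r mem_ball_self, hP.root]
  · by_cases hvi : v ∈ ball G R r i
    · rw [hkeep v hvi]
      rcases Nat.lt_succ_iff_lt_or_eq.1 hj with h | rfl
      · exact hP.desc j h v hv
      · rcases Nat.eq_zero_or_pos j with rfl | hj0
        · obtain rfl : v = r := by simpa [ball] using hvi
          simpa [hP.root] using hvi
        · obtain ⟨k, rfl⟩ := Nat.exists_eq_add_of_le' hj0
          exact ball_subset_succ (hP.desc k (by omega) v hvi)
    · have hji : j = i := by
        by_contra hne
        exact hvi (ball_mono (by omega) hv)
      subst hji
      exact (hnext v hv hvi).1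
  · by_cases hvi : v ∈ ball G R r i
    · rw [hkeep v hvi]; exact hP.adj v hvi
    · exact .inr (hnext v hv hvi).2

end Labels

/-! ### A language of terminating programs and its compiler -/

namespace RAM

open Polynomial

/-- Terms with bounded summation: `sum x e` is the sum of `e` over the values `0, …, N - 1` of the
variable `x`, where `N` is a global bound. -/
inductive Term where
  | const (k : ℕ) : Term
  | var (x : ℕ) : Term
  | get (a : ℕ) (i : Term) : Term
  | add (e f : Term) : Term
  | sub (e f : Term) : Term
  | ite (c e f : Term) : Term
  | sum (x : ℕ) (e : Term) : Term

namespace Term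

/-- The value of a term for the bound `N`, the arrays `A` and the values `v` of the variables. -/
def val (N : ℕ) (A : ℕ → ℕ → ℕ) : Term → (ℕ → ℕ) → ℕ
  | const k, _ => k
  | var x, v => v x
  | get a i, v => A a (i.val N A v)
  | add e f, v => e.val N A v + f.val N A v
  | sub e f, v => e.val N A v - f.val N A v
  | ite c e f, v => if c.val N A v = 0 then f.val N A v else e.val N A v
  | sum x e, v => ∑ i ∈ Finset.range N, e.val N A (Function.update v x i)

/-- All variables of the term are below `k`, and the variable `b` is not bound in it. -/
def ok (b k : ℕ) : Term → Bool
  | const _ => true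
  | var x => decide (x < k)
  | get _ i => i.ok b k
  | add e f => e.ok b k && f.ok b k
  | sub e f => e.ok b k && f.ok b k
  | ite c e f => c.ok b k && (e.ok b k && f.ok b k)
  | sum x e => decide (x < k) && (decide (x ≠ b) && e.ok b k)

/-- The array `a` does not occur in the term. -/
def avoids (a : ℕ) : Term → Bool
  | const _ => true
  | var _ => true
  | get a' i => decide (a' ≠ a) && i.avoids a
  | add e f => e.avoids a && f.avoids a
  | sub e f => e.avoids a && f.avoids a
  | ite c e f => c.avoids a && (e.avoids a && f.avoids a)
  | sum _ e => e.avoids a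

/-- A program that puts the value of the term into the variable `k`.  It uses the variables from `k`
on as scratch space, and the bound `N` is the value of the variable `b`.  The old value of a
summation variable is saved and restored. -/
def compile (b : ℕ) : Term → ℕ → Program
  | const j, k => .assign k (.const j)
  | var x, k => .assign k (.var x)
  | get a i, k => .seq (i.compile b k) (.assign k (.get a (.var k)))
  | add e f, k => .seq (e.compile b k) (.seq (f.compile b (k + 1))
      (.assign k (.add (.var k) (.var (k + 1)))))
  | sub e f, k => .seq (e.compile b k) (.seq (f.compile b (k + 1))
      (.assign k (.sub (.var k) (.var (k + 1)))))
  | ite c e f, k => .seq (c.compile b k) (.cond (.var k) (e.compile b k) (f.compile b k))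
  | sum x e, k =>
      .seq (.assign k (.var x)) (.seq (.assign (k + 1) (.const 0)) (.seq (.assign x (.const 0))
        (.seq (.loop (.sub (.var b) (.var x)) (.seq (e.compile b (k + 2))
            (.seq (.assign (k + 1) (.add (.var (k + 1)) (.var (k + 2))))
              (.assign x (.add (.var x) (.const 1))))))
          (.seq (.assign x (.var k)) (.assign k (.var (k + 1)))))))

/-- A bound on the running time of the compiled term, as a polynomial in `N`. -/
noncomputable def cost : Term → ℕ[X]
  | const _ => 2
  | var _ => 2
  | get _ i => i.cost + 3
  | add e f => e.cost + f.cost + 4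
  | sub e f => e.cost + f.cost + 4
  | ite c e f => c.cost + e.cost + f.cost + 2
  | sum _ e => X * (e.cost + 12) + 14

theorem ok_mono {b k k' : ℕ} (h : k ≤ k') : ∀ {e : Term}, e.ok b k → e.ok b k' := by
  intro e
  induction e <;> simp only [ok, Bool.and_eq_true, decide_eq_true_eq] <;> grind

theorem val_congr {b k N : ℕ} {A : ℕ → ℕ → ℕ} : ∀ {e : Term} {v v' : ℕ → ℕ}, e.ok b k →
    (∀ x < k, v x = v' x) → e.val N A v = e.val N A v' := by
  intro e
  induction e with
  | const _ => intros; rfl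
  | var x => intro v v' h hv; exact hv x (by simpa [ok] using h)
  | get a i ih => intro v v' h hv; simp only [val]; rw [ih h hv]
  | add e f ihe ihf =>
    intro v v' h hv
    simp only [ok, Bool.and_eq_true] at h
    simp only [val]; rw [ihe h.1 hv, ihf h.2 hv]
  | sub e f ihe ihf =>
    intro v v' h hv
    simp only [ok, Bool.and_eq_true] at h
    simp only [val]; rw [ihe h.1 hv, ihf h.2 hv]
  | ite c e f ihc ihe ihf =>
    intro v v' h hv
    simp only [ok, Bool.and_eq_true] at h
    simp only [val]; rw [ihc h.1 hv, ihe h.2.1 hv, ihf h.2.2 hv]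
  | sum x e ih =>
    intro v v' h hv
    simp only [ok, Bool.and_eq_true] at h
    simp only [val]
    refine Finset.sum_congr rfl fun i _ => ih h.2.2 fun y hy => ?_
    by_cases hyx : y = x
    · simp [hyx]
    · simp [hyx, hv y hy]

theorem val_congr_arr {a N : ℕ} {A A' : ℕ → ℕ → ℕ} (hA : ∀ a', a' ≠ a → A a' = A' a') :
    ∀ {e : Term} {v : ℕ → ℕ}, e.avoids a → e.val N A v = e.val N A' v := by
  intro e
  induction e with
  | const _ => intros; rfl
  | var x => intros; rfl
  | get a i ih =>
    intro v h
    simp only [avoids, Bool.and_eq_true, decide_eq_true_eq] at h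
    simp only [val]; rw [ih h.2, hA _ h.1]
  | add e f ihe ihf =>
    intro v h
    simp only [avoids, Bool.and_eq_true] at h
    simp only [val]; rw [ihe h.1, ihf h.2]
  | sub e f ihe ihf =>
    intro v h
    simp only [avoids, Bool.and_eq_true] at h
    simp only [val]; rw [ihe h.1, ihf h.2]
  | ite c e f ihc ihe ihf =>
    intro v h
    simp only [avoids, Bool.and_eq_true] at h
    simp only [val]; rw [ihc h.1, ihe h.2.1, ihf h.2.2]
  | sum x e ih =>
    intro v h
    simp only [val]
    exact Finset.sum_congr rfl fun i _ => ih h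

end Term

theorem run_assign (ω : ℕ → Bool) (s : State) (x : ℕ) (e : Expr) :
    ∃ t s', Run ω (.assign x e) s t s' ∧ t = e.cost + 1 ∧ s'.arr = s.arr ∧
      s'.var x = e.eval s ∧ ∀ y, y ≠ x → s'.var y = s.var y :=
  ⟨_, _, .assign x e s, rfl, rfl, by simp, fun y hy => by simp [hy]⟩

/-- A loop whose body increases the counter `x` by one is run until `x` reaches the bound. -/
theorem run_loop {ω : ℕ → Bool} {b x T N : ℕ} {P : Program} (I : ℕ → State → Prop)
    (hI : ∀ i s, I i s → s.var b = N ∧ s.var x = i)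
    (hstep : ∀ i < N, ∀ s, I i s → ∃ t s', Run ω P s t s' ∧ t ≤ T ∧ I (i + 1) s')
    {s : State} (hs : I 0 s) :
    ∃ t s', Run ω (.loop (.sub (.var b) (.var x)) P) s t s' ∧ t ≤ N * (T + 4) + 4 ∧ I N s' := by
  suffices ∀ m i s, i + m = N → I i s → ∃ t s',
      Run ω (.loop (.sub (.var b) (.var x)) P) s t s' ∧ t ≤ m * (T + 4) + 4 ∧ I N s' from
    this N 0 s (by omega) hs
  intro m
  induction m with
  | zero =>
    intro i s hi hs
    obtain ⟨h1, h2⟩ := hI i s hs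
    refine ⟨_, s, .loop_false ?_, ?_, ?_⟩
    · simp only [Expr.eval]; omega
    · simp [Expr.cost]
    · obtain rfl : i = N := by omega
      exact hs
  | succ m ih =>
    intro i s hi hs
    obtain ⟨h1, h2⟩ := hI i s hs
    obtain ⟨t, s', hr, ht, hs'⟩ := hstep i (by omega) s hs
    obtain ⟨t', s'', hr', ht', hs''⟩ := ih (i + 1) s' (by omega) hs'
    refine ⟨_, s'', .loop_true ?_ hr hr', ?_, hs''⟩
    · simp only [Expr.eval]; omega
    · simp only [Expr.cost]
      have : (m + 1) * (T + 4) = m * (T + 4) + (T + 4) := by ring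
      omega

theorem Term.run_compile {b : ℕ} (ω : ℕ → Bool) : ∀ (e : Term) (k : ℕ), b < k → e.ok b k →
    ∀ s : State, ∃ t s', Run ω (e.compile b k) s t s' ∧ t ≤ e.cost.eval (s.var b) ∧
      s'.arr = s.arr ∧ (∀ x < k, s'.var x = s.var x) ∧
      s'.var k = e.val (s.var b) s.arr s.var := by
  intro e
  induction e with
  | const j =>
    intro k hb _ s
    obtain ⟨t, s', hr, ht, ha, hx, hy⟩ := run_assign ω s k (.const j)
    exact ⟨t, s', hr, by simp [ht, cost, Expr.cost], ha, fun x hx => hy x (by omega), hx⟩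
  | var x =>
    intro k hb _ s
    obtain ⟨t, s', hr, ht, ha, hx, hy⟩ := run_assign ω s k (.var x)
    exact ⟨t, s', hr, by simp [ht, cost, Expr.cost], ha, fun x hx => hy x (by omega), hx⟩
  | get a i ih =>
    intro k hb hok s
    obtain ⟨t, s₁, hr, ht, ha, hv, hk⟩ := ih k hb hok s
    obtain ⟨t', s₂, hr', ht', ha', hx', hy'⟩ := run_assign ω s₁ k (.get a (.var k))
    refine ⟨_, s₂, .seq hr hr', ?_, ha'.trans ha, fun x hx => ?_, ?_⟩
    · simp only [cost, eval_add, eval_ofNat, ht', Expr.cost]; omega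
    · rw [hy' x (by omega), hv x hx]
    · rw [hx']; simp only [Expr.eval, val, ha, hk]
  | add e f ihe ihf =>
    intro k hb hok s
    simp only [ok, Bool.and_eq_true] at hok
    obtain ⟨t₁, s₁, hr₁, ht₁, ha₁, hv₁, hk₁⟩ := ihe k hb hok.1 s
    obtain ⟨t₂, s₂, hr₂, ht₂, ha₂, hv₂, hk₂⟩ := ihf (k + 1) (by omega)
      (ok_mono (by omega) hok.2) s₁
    obtain ⟨t₃, s₃, hr₃, ht₃, ha₃, hx₃, hy₃⟩ :=
      run_assign ω s₂ k (.add (.var k) (.var (k + 1)))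
    refine ⟨_, s₃, .seq hr₁ (.seq hr₂ hr₃), ?_, by rw [ha₃, ha₂, ha₁], fun x hx => ?_, ?_⟩
    · rw [hv₁ b hb] at ht₂
      simp only [cost, eval_add, eval_ofNat, ht₃, Expr.cost]; omega
    · rw [hy₃ x (by omega), hv₂ x (by omega), hv₁ x hx]
    · rw [hx₃]
      simp only [Expr.eval, val]
      rw [hk₂, hv₂ k (by omega), hk₁, ha₁, hv₁ b hb, val_congr hok.2 hv₁]
  | sub e f ihe ihf =>
    intro k hb hok s
    simp only [ok, Bool.and_eq_true] at hok
    obtain ⟨t₁, s₁, hr₁, ht₁, ha₁, hv₁, hk₁⟩ := ihe k hb hok.1 s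
    obtain ⟨t₂, s₂, hr₂, ht₂, ha₂, hv₂, hk₂⟩ := ihf (k + 1) (by omega)
      (ok_mono (by omega) hok.2) s₁
    obtain ⟨t₃, s₃, hr₃, ht₃, ha₃, hx₃, hy₃⟩ :=
      run_assign ω s₂ k (.sub (.var k) (.var (k + 1)))
    refine ⟨_, s₃, .seq hr₁ (.seq hr₂ hr₃), ?_, by rw [ha₃, ha₂, ha₁], fun x hx => ?_, ?_⟩
    · rw [hv₁ b hb] at ht₂
      simp only [cost, eval_add, eval_ofNat, ht₃, Expr.cost]; omega
    · rw [hy₃ x (by omega), hv₂ x (by omega), hv₁ x hx]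
    · rw [hx₃]
      simp only [Expr.eval, val]
      rw [hk₂, hv₂ k (by omega), hk₁, ha₁, hv₁ b hb, val_congr hok.2 hv₁]
  | ite c e f ihc ihe ihf =>
    intro k hb hok s
    simp only [ok, Bool.and_eq_true] at hok
    obtain ⟨t₁, s₁, hr₁, ht₁, ha₁, hv₁, hk₁⟩ := ihc k hb hok.1 s
    by_cases hc : c.val (s.var b) s.arr s.var = 0
    · obtain ⟨t₂, s₂, hr₂, ht₂, ha₂, hv₂, hk₂⟩ := ihf k hb hok.2.2 s₁
      refine ⟨_, s₂, .seq hr₁ (.cond_false (by simp [Expr.eval, hk₁, hc]) hr₂), ?_,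
        by rw [ha₂, ha₁], fun x hx => by rw [hv₂ x hx, hv₁ x hx], ?_⟩
      · rw [hv₁ b hb] at ht₂
        simp only [cost, eval_add, eval_ofNat, Expr.cost]; omega
      · simp only [val, if_pos hc]
        rw [hk₂, ha₁, hv₁ b hb, val_congr hok.2.2 hv₁]
    · obtain ⟨t₂, s₂, hr₂, ht₂, ha₂, hv₂, hk₂⟩ := ihe k hb hok.2.1 s₁
      refine ⟨_, s₂, .seq hr₁ (.cond_true (by simp [Expr.eval, hk₁, hc]) hr₂), ?_,
        by rw [ha₂, ha₁], fun x hx => by rw [hv₂ x hx, hv₁ x hx], ?_⟩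
      · rw [hv₁ b hb] at ht₂
        simp only [cost, eval_add, eval_ofNat, Expr.cost]; omega
      · simp only [val, if_neg hc]
        rw [hk₂, ha₁, hv₁ b hb, val_congr hok.2.1 hv₁]
  | sum x e ih =>
    intro k hb hok s
    simp only [ok, Bool.and_eq_true, decide_eq_true_eq] at hok
    obtain ⟨hxk, hxb, hok⟩ := hok
    obtain ⟨t₁, s₁, hr₁, ht₁, ha₁, hx₁, hy₁⟩ := run_assign ω s k (.var x)
    obtain ⟨t₂, s₂, hr₂, ht₂, ha₂, hx₂, hy₂⟩ := run_assign ω s₁ (k + 1) (.const 0)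
    obtain ⟨t₃, s₃, hr₃, ht₃, ha₃, hx₃, hy₃⟩ := run_assign ω s₂ x (.const 0)
    obtain ⟨t₄, s₄, hr₄, ht₄, hI⟩ := run_loop (ω := ω) (b := b) (x := x)
      (T := e.cost.eval (s.var b) + 8) (N := s.var b)
      (P := .seq (e.compile b (k + 2))
            (.seq (.assign (k + 1) (.add (.var (k + 1)) (.var (k + 2))))
              (.assign x (.add (.var x) (.const 1)))))
      (fun i r => r.arr = s.arr ∧ (∀ y < k, y ≠ x → r.var y = s.var y) ∧ r.var x = i ∧
        r.var k = s.var x ∧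
        r.var (k + 1) = ∑ j ∈ Finset.range i, e.val (s.var b) s.arr (Function.update s.var x j))
      (fun i r hr => ⟨hr.2.1 b hb (Ne.symm hxb), hr.2.2.1⟩)
      (by
        rintro i hi r ⟨hra, hrv, hrx, hrk, hrs⟩
        obtain ⟨u₁, r₁, hu₁, hc₁, hra₁, hrv₁, hrk₁⟩ := ih (k + 2) (by omega)
          (ok_mono (by omega) hok) r
        obtain ⟨u₂, r₂, hu₂, hc₂, hra₂, hrx₂, hry₂⟩ :=
          run_assign ω r₁ (k + 1) (.add (.var (k + 1)) (.var (k + 2)))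
        obtain ⟨u₃, r₃, hu₃, hc₃, hra₃, hrx₃, hry₃⟩ :=
          run_assign ω r₂ x (.add (.var x) (.const 1))
        have hrb : r.var b = s.var b := hrv b hb (Ne.symm hxb)
        refine ⟨_, r₃, .seq hu₁ (.seq hu₂ hu₃), ?_, ?_, ?_, ?_, ?_, ?_⟩
        · rw [hrb] at hc₁
          simp only [hc₂, hc₃, Expr.cost]; omega
        · rw [hra₃, hra₂, hra₁, hra]
        · intro y hy hyx
          rw [hry₃ y hyx, hry₂ y (by omega), hrv₁ y (by omega), hrv y hy hyx]
        · rw [hrx₃]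
          simp only [Expr.eval]
          rw [hry₂ x (by omega), hrv₁ x (by omega), hrx]
        · rw [hry₃ k (by omega), hry₂ k (by omega), hrv₁ k (by omega), hrk]
        · rw [hry₃ (k + 1) (by omega), hrx₂]
          simp only [Expr.eval]
          rw [hrv₁ (k + 1) (by omega), hrs, hrk₁, hrb, hra, Finset.sum_range_succ]
          congr 1
          refine val_congr hok fun y hy => ?_
          by_cases hyx : y = x
          · simp [hyx, hrx]
          · simp [hyx, hrv y hy hyx])
      (s := s₃)
      ⟨by rw [ha₃, ha₂, ha₁],
        fun y hy hyx => by rw [hy₃ y hyx, hy₂ y (by omega), hy₁ y (by omega)],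
        by rw [hx₃]; rfl,
        by rw [hy₃ k (by omega), hy₂ k (by omega), hx₁]; rfl,
        by rw [hy₃ (k + 1) (by omega), hx₂]; simp [Expr.eval]⟩
    obtain ⟨ha₄, hv₄, hx₄, hk₄, hs₄⟩ := hI
    obtain ⟨t₅, s₅, hr₅, ht₅, ha₅, hx₅, hy₅⟩ := run_assign ω s₄ x (.var k)
    obtain ⟨t₆, s₆, hr₆, ht₆, ha₆, hx₆, hy₆⟩ := run_assign ω s₅ k (.var (k + 1))
    refine ⟨_, s₆, .seq hr₁ (.seq hr₂ (.seq hr₃ (.seq hr₄ (.seq hr₅ hr₆)))), ?_,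
      by rw [ha₆, ha₅, ha₄], fun y hy => ?_, ?_⟩
    · simp only [cost, eval_add, eval_mul, eval_X, eval_ofNat, ht₁, ht₂, ht₃, ht₅, ht₆, Expr.cost]
      have : s.var b * (eval (s.var b) e.cost + 8 + 4) =
          s.var b * (eval (s.var b) e.cost + 12) := by
        ring
      omega
    · rw [hy₆ y (by omega)]
      by_cases hyx : y = x
      · rw [hyx, hx₅]; exact hk₄
      · rw [hy₅ y hyx, hv₄ y hy hyx]
    · rw [hx₆]
      simp only [Expr.eval, val]
      rw [hy₅ (k + 1) (by omega), hs₄]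

/-- Commands: `fill a x e` replaces the entries `x = 0, …, N - 1` of the array `a` by the values of
`e`, and `rep c` runs `c` for `N` times. -/
inductive Cmd where
  | skip : Cmd
  | assign (x : ℕ) (e : Term) : Cmd
  | fill (a x : ℕ) (e : Term) : Cmd
  | seq (c d : Cmd) : Cmd
  | ite (e : Term) (c d : Cmd) : Cmd
  | rep (c : Cmd) : Cmd

namespace Cmd

/-- The effect of a command for the bound `N`. -/
def den (N : ℕ) : Cmd → State → State
  | skip, s => s
  | assign x e, s => { s with var := Function.update s.var x (e.val N s.arr s.var) }
  | fill a x e, s =>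
    { s with
      arr := Function.update s.arr a
        (fun i => if i < N then e.val N s.arr (Function.update s.var x i) else s.arr a i) }
  | seq c d, s => d.den N (c.den N s)
  | ite e c d, s => if e.val N s.arr s.var = 0 then d.den N s else c.den N s
  | rep c, s => (c.den N)^[N] s

/-- All variables of the command are below `k`, the variable `b` is never changed, and the term of
a `fill` does not read the array that is being filled. -/
def ok (b k : ℕ) : Cmd → Bool
  | skip => true
  | assign x e => decide (x < k) && (decide (x ≠ b) && e.ok b k)
  | fill a x e => decide (x < k) && (decide (x ≠ b) && (e.ok b k && e.avoids a))
  | seq c d => c.ok b k && d.ok b k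
  | ite e c d => e.ok b k && (c.ok b k && d.ok b k)
  | rep c => c.ok b k

/-- A program with the effect of the command.  The variables from `k` on are scratch space, and the
variable `b` holds the bound. -/
def compile (b : ℕ) : Cmd → ℕ → Program
  | skip, _ => .skip
  | assign x e, k => .seq (e.compile b k) (.assign x (.var k))
  | fill a x e, k =>
      .seq (.assign k (.var x)) (.seq (.assign x (.const 0))
        (.seq (.loop (.sub (.var b) (.var x)) (.seq (e.compile b (k + 1))
            (.seq (.store a (.var x) (.var (k + 1))) (.assign x (.add (.var x) (.const 1))))))
          (.assign x (.var k))))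
  | seq c d, k => .seq (c.compile b k) (d.compile b k)
  | ite e c d, k => .seq (e.compile b k) (.cond (.var k) (c.compile b k) (d.compile b k))
  | rep c, k => .seq (.assign k (.const 0))
      (.loop (.sub (.var b) (.var k)) (.seq (c.compile b (k + 1))
        (.assign k (.add (.var k) (.const 1)))))

/-- A bound on the running time of the compiled command, as a polynomial in `N`. -/
noncomputable def cost : Cmd → ℕ[X]
  | skip => 1
  | assign _ e => e.cost + 2
  | fill _ _ e => X * (e.cost + 11) + 10
  | seq c d => c.cost + d.cost
  | ite e c d => e.cost + c.cost + d.cost + 2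
  | rep c => X * (c.cost + 8) + 6

theorem ok_mono {b k k' : ℕ} (h : k ≤ k') : ∀ {c : Cmd}, c.ok b k → c.ok b k' := by
  have := @Term.ok_mono b k k' h
  intro c
  induction c <;> simp only [ok, Bool.and_eq_true, decide_eq_true_eq] <;> grind

/-- Equality of states up to scratch space. -/
def Sim (k : ℕ) (s s' : State) : Prop := s.arr = s'.arr ∧ ∀ x < k, s.var x = s'.var x

theorem Sim.trans {k : ℕ} {s s' s'' : State} (h : Sim k s s') (h' : Sim k s' s'') : Sim k s s'' :=
  ⟨h.1.trans h'.1, fun x hx => (h.2 x hx).trans (h'.2 x hx)⟩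

theorem Sim.mono {k k' : ℕ} {s s' : State} (hk : k ≤ k') (h : Sim k' s s') : Sim k s s' :=
  ⟨h.1, fun x hx => h.2 x (by omega)⟩

theorem Sim.den {b k N : ℕ} : ∀ {c : Cmd}, c.ok b k → ∀ {s s' : State}, Sim k s s' →
    Sim k (c.den N s) (c.den N s') := by
  intro c
  induction c with
  | skip => intro _ s s' h; exact h
  | assign x e =>
    intro hok s s' h
    simp only [ok, Bool.and_eq_true, decide_eq_true_eq] at hok
    refine ⟨h.1, fun y hy => ?_⟩
    simp only [Cmd.den, Function.update_apply]
    split_ifs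
    · rw [h.1]; exact Term.val_congr hok.2.2 h.2
    · exact h.2 y hy
  | fill a x e =>
    intro hok s s' h
    simp only [ok, Bool.and_eq_true, decide_eq_true_eq] at hok
    refine ⟨?_, h.2⟩
    simp only [Cmd.den]
    rw [h.1]
    congr 1
    funext i
    split_ifs
    · refine Term.val_congr hok.2.2.1 fun y hy => ?_
      simp only [Function.update_apply]
      split_ifs
      · rfl
      · exact h.2 y hy
    · rfl
  | seq c d ihc ihd =>
    intro hok s s' h
    simp only [ok, Bool.and_eq_true] at hok
    exact ihd hok.2 (ihc hok.1 h)
  | ite e c d ihc ihd =>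
    intro hok s s' h
    simp only [ok, Bool.and_eq_true] at hok
    simp only [Cmd.den]
    rw [h.1, Term.val_congr hok.1 h.2]
    split_ifs
    · exact ihd hok.2.2 h
    · exact ihc hok.2.1 h
  | rep c ih =>
    intro hok s s' h
    have : ∀ m, Sim k ((c.den N)^[m] s) ((c.den N)^[m] s') := by
      intro m
      induction m with
      | zero => exact h
      | succ m ihm =>
        rw [Function.iterate_succ_apply', Function.iterate_succ_apply']
        exact ih hok ihm
    exact this N

theorem den_var {b k N y : ℕ} (hy : y = b ∨ k ≤ y) : ∀ {c : Cmd}, c.ok b k → ∀ s : State,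
    (c.den N s).var y = s.var y := by
  intro c
  induction c with
  | skip => intros; rfl
  | assign x e =>
    intro hok s
    simp only [ok, Bool.and_eq_true, decide_eq_true_eq] at hok
    have : y ≠ x := by rintro rfl; omega
    simp [den, this]
  | fill a x e => intros; rfl
  | seq c d ihc ihd =>
    intro hok s
    simp only [ok, Bool.and_eq_true] at hok
    simp only [den]
    rw [ihd hok.2, ihc hok.1]
  | ite e c d ihc ihd =>
    intro hok s
    simp only [ok, Bool.and_eq_true] at hok
    simp only [den]
    split_ifs
    · exact ihd hok.2.2 s
    · exact ihc hok.2.1 s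
  | rep c ih =>
    intro hok s
    have : ∀ m, ((c.den N)^[m] s).var y = s.var y := by
      intro m
      induction m with
      | zero => rfl
      | succ m ihm => rw [Function.iterate_succ_apply', ih hok, ihm]
    exact this N

theorem run_compile {b : ℕ} (ω : ℕ → Bool) : ∀ (c : Cmd) (k : ℕ), b < k → c.ok b k →
    ∀ s : State, ∃ t s', Run ω (c.compile b k) s t s' ∧ t ≤ c.cost.eval (s.var b) ∧
      Sim k s' (c.den (s.var b) s) := by
  intro c
  induction c with
  | skip => intro k _ _ s; exact ⟨_, s, .skip s, by simp [cost], rfl, fun _ _ => rfl⟩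
  | assign x e =>
    intro k hb hok s
    simp only [ok, Bool.and_eq_true, decide_eq_true_eq] at hok
    obtain ⟨t₁, s₁, hr₁, ht₁, ha₁, hv₁, hk₁⟩ := e.run_compile ω k hb hok.2.2 s
    obtain ⟨t₂, s₂, hr₂, ht₂, ha₂, hx₂, hy₂⟩ := run_assign ω s₁ x (.var k)
    refine ⟨_, s₂, .seq hr₁ hr₂, ?_, ha₂.trans ha₁, fun y hy => ?_⟩
    · simp only [cost, eval_add, eval_ofNat, ht₂, Expr.cost]; omega
    · simp only [den, Function.update_apply]
      split_ifs with hyx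
      · rw [hyx, hx₂]; exact hk₁
      · rw [hy₂ y hyx, hv₁ y hy]
  | fill a x e =>
    intro k hb hok s
    simp only [ok, Bool.and_eq_true, decide_eq_true_eq] at hok
    obtain ⟨hxk, hxb, hok, hav⟩ := hok
    obtain ⟨t₁, s₁, hr₁, ht₁, ha₁, hx₁, hy₁⟩ := run_assign ω s k (.var x)
    obtain ⟨t₂, s₂, hr₂, ht₂, ha₂, hx₂, hy₂⟩ := run_assign ω s₁ x (.const 0)
    obtain ⟨t₃, s₃, hr₃, ht₃, hI⟩ := run_loop (ω := ω) (b := b) (x := x)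
      (T := e.cost.eval (s.var b) + 7) (N := s.var b)
      (P := .seq (e.compile b (k + 1))
            (.seq (.store a (.var x) (.var (k + 1))) (.assign x (.add (.var x) (.const 1)))))
      (fun i r => (r.arr = Function.update s.arr a fun j =>
          if j < i then e.val (s.var b) s.arr (Function.update s.var x j) else s.arr a j) ∧
        (∀ y < k, y ≠ x → r.var y = s.var y) ∧ r.var x = i ∧ r.var k = s.var x)
      (fun i r hr => ⟨hr.2.1 b hb (Ne.symm hxb), hr.2.2.1⟩)
      (by
        rintro i hi r ⟨hra, hrv, hrx, hrk⟩
        obtain ⟨u₁, r₁, hu₁, hc₁, hra₁, hrv₁, hrk₁⟩ := e.run_compile ω (k + 1) (by omega)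
          (Term.ok_mono (by omega) hok) r
        obtain ⟨u₃, r₃, hu₃, hc₃, hra₃, hrx₃, hry₃⟩ := run_assign ω
          { r₁ with arr := Function.update r₁.arr a (Function.update (r₁.arr a)
              ((Expr.var x).eval r₁) ((Expr.var (k + 1)).eval r₁)) } x (.add (.var x) (.const 1))
        have hrb : r.var b = s.var b := hrv b hb (Ne.symm hxb)
        refine ⟨_, r₃, .seq hu₁ (.seq (.store a (.var x) (.var (k + 1)) r₁) hu₃), ?_, ?_, ?_, ?_,
          ?_⟩
        · rw [hrb] at hc₁
          simp only [hc₃, Expr.cost]; omega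
        · rw [hra₃, hra₁, hra]
          simp only [Expr.eval, Function.update_self, Function.update_idem]
          congr 1
          funext j
          rw [hrv₁ x (by omega), hrx]
          by_cases hj : j = i
          · subst hj
            rw [Function.update_self, if_pos (by omega), hrk₁, hrb]
            rw [Term.val_congr_arr (a := a) (A' := s.arr)
              (fun a' ha' => by rw [hra]; simp [ha']) hav]
            refine Term.val_congr hok fun y hy => ?_
            by_cases hyx : y = x
            · simp [hyx, hrx]
            · simp [hyx, hrv y hy hyx]
          · rw [Function.update_of_ne hj]
            congr 1
            simp only [eq_iff_iff]
            omega
        · intro y hy hyx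
          rw [hry₃ y hyx, hrv₁ y (by omega), hrv y hy hyx]
        · rw [hrx₃]
          simp only [Expr.eval]
          rw [hrv₁ x (by omega), hrx]
        · rw [hry₃ k (by omega), hrv₁ k (by omega), hrk])
      (s := s₂)
      ⟨by rw [ha₂, ha₁]; simp,
        fun y hy hyx => by rw [hy₂ y hyx, hy₁ y (by omega)],
        by rw [hx₂]; rfl,
        by rw [hy₂ k (by omega), hx₁]; rfl⟩
    obtain ⟨ha₃, hv₃, hx₃, hk₃⟩ := hI
    obtain ⟨t₄, s₄, hr₄, ht₄, ha₄, hx₄, hy₄⟩ := run_assign ω s₃ x (.var k)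
    refine ⟨_, s₄, .seq hr₁ (.seq hr₂ (.seq hr₃ hr₄)), ?_, ?_, fun y hy => ?_⟩
    · simp only [cost, eval_add, eval_mul, eval_X, eval_ofNat, ht₁, ht₂, ht₄, Expr.cost]
      have : s.var b * (eval (s.var b) e.cost + 7 + 4) =
          s.var b * (eval (s.var b) e.cost + 11) := by
        ring
      omega
    · rw [ha₄, ha₃]; rfl
    · change _ = s.var y
      by_cases hyx : y = x
      · rw [hyx, hx₄]; exact hk₃
      · rw [hy₄ y hyx, hv₃ y hy hyx]
  | seq c d ihc ihd =>
    intro k hb hok s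
    simp only [ok, Bool.and_eq_true] at hok
    obtain ⟨t₁, s₁, hr₁, ht₁, hs₁⟩ := ihc k hb hok.1 s
    obtain ⟨t₂, s₂, hr₂, ht₂, hs₂⟩ := ihd k hb hok.2 s₁
    have hN : s₁.var b = s.var b := by rw [hs₁.2 b hb, den_var (.inl rfl) hok.1]
    rw [hN] at ht₂ hs₂
    refine ⟨_, s₂, .seq hr₁ hr₂, ?_, hs₂.trans (hs₁.den hok.2)⟩
    simp only [cost, eval_add]; omega
  | ite e c d ihc ihd =>
    intro k hb hok s
    simp only [ok, Bool.and_eq_true] at hok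
    obtain ⟨t₁, s₁, hr₁, ht₁, ha₁, hv₁, hk₁⟩ := e.run_compile ω k hb hok.1 s
    have hs₁ : Sim k s₁ s := ⟨ha₁, hv₁⟩
    by_cases hc : e.val (s.var b) s.arr s.var = 0
    · obtain ⟨t₂, s₂, hr₂, ht₂, hs₂⟩ := ihd k hb hok.2.2 s₁
      rw [hv₁ b hb] at ht₂ hs₂
      refine ⟨_, s₂, .seq hr₁ (.cond_false (by simp [Expr.eval, hk₁, hc]) hr₂), ?_, ?_⟩
      · simp only [cost, eval_add, eval_ofNat, Expr.cost]; omega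
      · simp only [den, if_pos hc]; exact hs₂.trans (hs₁.den hok.2.2)
    · obtain ⟨t₂, s₂, hr₂, ht₂, hs₂⟩ := ihc k hb hok.2.1 s₁
      rw [hv₁ b hb] at ht₂ hs₂
      refine ⟨_, s₂, .seq hr₁ (.cond_true (by simp [Expr.eval, hk₁, hc]) hr₂), ?_, ?_⟩
      · simp only [cost, eval_add, eval_ofNat, Expr.cost]; omega
      · simp only [den, if_neg hc]; exact hs₂.trans (hs₁.den hok.2.1)
  | rep c ih =>
    intro k hb hok s
    simp only [ok] at hok
    obtain ⟨t₁, s₁, hr₁, ht₁, ha₁, hx₁, hy₁⟩ := run_assign ω s k (.const 0)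
    obtain ⟨t₂, s₂, hr₂, ht₂, hI⟩ := run_loop (ω := ω) (b := b) (x := k)
      (T := c.cost.eval (s.var b) + 4) (N := s.var b)
      (P := .seq (c.compile b (k + 1)) (.assign k (.add (.var k) (.const 1))))
      (fun i r => Sim k r ((c.den (s.var b))^[i] s) ∧ r.var b = s.var b ∧ r.var k = i)
      (fun i r hr => hr.2)
      (by
        rintro i hi r ⟨hsim, hrb, hrk⟩
        obtain ⟨u₁, r₁, hu₁, hc₁, hs₁⟩ := ih (k + 1) (by omega) (ok_mono (by omega) hok) r
        obtain ⟨u₂, r₂, hu₂, hc₂, hra₂, hrx₂, hry₂⟩ :=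
          run_assign ω r₁ k (.add (.var k) (.const 1))
        rw [hrb] at hc₁ hs₁
        have h12 : Sim k r₂ r₁ := ⟨hra₂, fun y hy => hry₂ y (by omega)⟩
        refine ⟨_, r₂, .seq hu₁ hu₂, ?_, ?_, ?_, ?_⟩
        · simp only [hc₂, Expr.cost]; omega
        · rw [Function.iterate_succ_apply']
          exact (h12.trans (hs₁.mono (by omega))).trans (hsim.den hok)
        · rw [hry₂ b (by omega), hs₁.2 b (by omega), den_var (.inl rfl) hok, hrb]
        · rw [hrx₂]
          simp only [Expr.eval]
          rw [hs₁.2 k (by omega), den_var (.inr le_rfl) hok, hrk])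
      (s := s₁)
      ⟨⟨ha₁, fun y hy => hy₁ y (by omega)⟩, hy₁ b (by omega), by rw [hx₁]; rfl⟩
    refine ⟨_, s₂, .seq hr₁ hr₂, ?_, hI.1⟩
    simp only [cost, eval_add, eval_mul, eval_X, eval_ofNat, ht₁, Expr.cost]
    have : s.var b * (eval (s.var b) c.cost + 4 + 4) = s.var b * (eval (s.var b) c.cost + 8) := by
      ring
    omega

end Cmd

end RAM

/-! ### Formulas and other derived terms -/

/-- The graph on the natural numbers with the edges of a given graph on `{0, …, n - 1}`. -/
def natGraph {n : ℕ} (G : SimpleGraph (Fin n)) : SimpleGraph ℕ := G.map Fin.valEmbedding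

theorem natGraph_adj {n : ℕ} {G : SimpleGraph (Fin n)} {a b : ℕ} :
    (natGraph G).Adj a b ↔ ∃ (ha : a < n) (hb : b < n), G.Adj ⟨a, ha⟩ ⟨b, hb⟩ := by
  constructor
  · rintro ⟨-, x, y, h, rfl, rfl⟩
    exact ⟨x.2, y.2, h⟩
  · rintro ⟨ha, hb, h⟩
    exact ⟨fun hab => h.ne (Fin.ext hab), _, _, h, rfl, rfl⟩

namespace RAM

/-- The adjacency matrix is stored row by row. -/
theorem adjArray_ne_zero {n : ℕ} {G : SimpleGraph (Fin n)} {a b : ℕ} (ha : a < n) (hb : b < n) :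
    adjArray G (a * n + b) ≠ 0 ↔ (natGraph G).Adj a b := by
  rw [natGraph_adj, adjArray]
  have hn : 0 < n := by omega
  have key : (∃ i j : Fin n, G.Adj i j ∧ a * n + b = i * n + j) ↔
      ∃ (ha : a < n) (hb : b < n), G.Adj ⟨a, ha⟩ ⟨b, hb⟩ := by
    constructor
    · rintro ⟨i, j, h, he⟩
      have h1 : a = i := by
        have := congrArg (· / n) he
        simpa [Nat.mul_comm _ n, Nat.mul_add_div hn, Nat.div_eq_of_lt hb,
          Nat.div_eq_of_lt j.2] using this
      have h2 : b = j := by subst h1; omega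
      subst h1 h2
      exact ⟨i.2, j.2, h⟩
    · rintro ⟨ha, hb, h⟩
      exact ⟨_, _, h, rfl⟩
  by_cases h : ∃ i j : Fin n, G.Adj i j ∧ a * n + b = i * n + j
  · rw [if_pos h]
    simpa using key.1 h
  · rw [if_neg h]
    simpa using fun h1 h2 h3 => h (key.2 ⟨h1, h2, h3⟩)

namespace Term

/-- A term is read as a formula, which holds if the value is not zero. -/
def Holds (N : ℕ) (A : ℕ → ℕ → ℕ) (e : Term) (v : ℕ → ℕ) : Prop := e.val N A v ≠ 0

instance (N : ℕ) (A : ℕ → ℕ → ℕ) (e : Term) (v : ℕ → ℕ) : Decidable (e.Holds N A v) :=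
  inferInstanceAs (Decidable (_ ≠ _))

/-- The formula `e = f`: the sum of the two truncated differences is zero. -/
def eq (e f : Term) : Term := ite (add (sub e f) (sub f e)) (const 0) (const 1)
/-- The formula `e < f`. -/
def lt (e f : Term) : Term := sub f e
/-- The formula `e ≤ f`. -/
def le (e f : Term) : Term := sub (add f (const 1)) e
/-- Negation. -/
def not (e : Term) : Term := ite e (const 0) (const 1)
/-- Conjunction. -/
def and (e f : Term) : Term := ite e f (const 0)
/-- Disjunction. -/
def or (e f : Term) : Term := ite e (const 1) f
/-- The formula `e` holds for some value of `x` below the global bound. -/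
def ex (x : ℕ) (e : Term) : Term := sum x e
/-- The number of values of `x` below the global bound for which the formula `e` holds. -/
def count (x : ℕ) (e : Term) : Term := sum x (ite e (const 1) (const 0))

/-- The least value of the variable `x` for which the formula `e x` holds.  The formula is given as
a function of the name of its variable, because it is used with the names `x` and `y`. -/
def least (x y : ℕ) (e : ℕ → Term) : Term :=
  sum x (ite (and (e x) (not (ex y (and (lt (var y) (var x)) (e y))))) (var x) (const 0))

/-- The product of the variables `x` and `y`, for `x` at most the global bound. -/
def mul (x y : ℕ) : Term := sum 19 (ite (lt (var 19) (var x)) (var y) (const 0))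

/-- Adjacency of the vertices `x` and `y` in the graph whose number of vertices is the variable `m`
and whose adjacency matrix is the array `a`. -/
def adj (a m x y : ℕ) : Term :=
  and (lt (var x) (var m)) (and (lt (var y) (var m)) (get a (add (mul x m) (var y))))

section

variable {N : ℕ} {A : ℕ → ℕ → ℕ} {v : ℕ → ℕ} {c e f : Term} {x y : ℕ}

@[simp] theorem val_const {k : ℕ} : (const k).val N A v = k := rfl
@[simp] theorem val_var : (var x).val N A v = v x := rfl
@[simp] theorem val_get {a : ℕ} : (get a e).val N A v = A a (e.val N A v) := rfl
@[simp] theorem val_add : (add e f).val N A v = e.val N A v + f.val N A v := rfl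
@[simp] theorem val_sub : (sub e f).val N A v = e.val N A v - f.val N A v := rfl
@[simp] theorem val_sum : (sum x e).val N A v =
    ∑ i ∈ Finset.range N, e.val N A (Function.update v x i) := rfl

@[simp] theorem val_ite : (ite c e f).val N A v =
    if c.Holds N A v then e.val N A v else f.val N A v := by
  simp only [val, Holds]
  split_ifs <;> simp_all

@[simp] theorem holds_get {a : ℕ} : (get a e).Holds N A v ↔ A a (e.val N A v) ≠ 0 := Iff.rfl

@[simp] theorem holds_eq : (eq e f).Holds N A v ↔ e.val N A v = f.val N A v := by
  simp [eq, Holds, val]; omega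

@[simp] theorem holds_lt : (lt e f).Holds N A v ↔ e.val N A v < f.val N A v := by
  simp [lt, Holds]; omega

@[simp] theorem holds_le : (le e f).Holds N A v ↔ e.val N A v ≤ f.val N A v := by
  simp [le, Holds, val]; omega

@[simp] theorem holds_not : (not e).Holds N A v ↔ ¬ e.Holds N A v := by
  simp only [not, Holds, val]; split_ifs <;> simp_all

@[simp] theorem holds_and : (and e f).Holds N A v ↔ e.Holds N A v ∧ f.Holds N A v := by
  simp only [and, Holds, val]; split_ifs <;> simp_all

@[simp] theorem holds_or : (or e f).Holds N A v ↔ e.Holds N A v ∨ f.Holds N A v := by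
  simp only [or, Holds, val]
  split_ifs <;> simp_all

@[simp] theorem holds_ex : (ex x e).Holds N A v ↔ ∃ i < N, e.Holds N A (Function.update v x i) := by
  simp [ex, Holds]

@[simp] theorem val_count : (count x e).val N A v =
    ((Finset.range N).filter fun i => e.Holds N A (Function.update v x i)).card := by
  simp only [count, val_sum, val_ite, val_const, Finset.card_filter]

/-- The two assumptions on `e` say that it expresses `P`, under both names of its variable. -/
theorem val_least {e : ℕ → Term} {P : ℕ → Prop}
    (hx : ∀ i, (e x).Holds N A (Function.update v x i) ↔ P i)
    (hy : ∀ i j, (e y).Holds N A (Function.update (Function.update v x i) y j) ↔ P j)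
    (hxy : x ≠ y) (hP : ∃ i < N, P i) :
    (least x y e).val N A v < N ∧ P ((least x y e).val N A v) := by
  classical
  obtain ⟨i, hi, hPi⟩ := hP
  have hex : ∃ i, P i := ⟨i, hPi⟩
  have hlt : Nat.find hex < N := (Nat.find_min' hex hPi).trans_lt hi
  have : (least x y e).val N A v = Nat.find hex := by
    simp only [least, val_sum]
    rw [Finset.sum_eq_single_of_mem (Nat.find hex) (Finset.mem_range.2 hlt)]
    · rw [val_ite, if_pos]
      · simp
      · simp only [holds_and, holds_not, holds_ex, holds_lt, val_var, hx, hy]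
        refine ⟨Nat.find_spec hex, ?_⟩
        rintro ⟨j, -, hj, hPj⟩
        simp only [Function.update_self, Function.update_of_ne hxy] at hj
        exact Nat.find_min hex hj hPj
    · intro j hj hne
      rw [val_ite, if_neg]
      · rfl
      · simp only [holds_and, holds_not, holds_ex, holds_lt, val_var, hx, hy]
        rintro ⟨hPj, hmin⟩
        refine hmin ⟨Nat.find hex, hlt, ?_, Nat.find_spec hex⟩
        simp only [Function.update_self, Function.update_of_ne hxy]
        exact lt_of_le_of_ne (Nat.find_min' hex hPj) (Ne.symm hne)
  rw [this]
  exact ⟨hlt, Nat.find_spec hex⟩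

theorem val_mul (hx : x ≠ 19) (hy : y ≠ 19) (hN : v x ≤ N) :
    (mul x y).val N A v = v x * v y := by
  simp only [mul, val_sum, val_ite, holds_lt, val_var, val_const, Function.update_self,
    Function.update_of_ne hx, Function.update_of_ne hy]
  rw [← Finset.sum_filter, Finset.sum_const, smul_eq_mul]
  congr 1
  rw [show (Finset.range N).filter (fun i => i < v x) = Finset.range (v x) by
    ext i; simp only [Finset.mem_filter, Finset.mem_range]; omega, Finset.card_range]

theorem holds_adj {n a m : ℕ} {G : SimpleGraph (Fin n)} (hA : A a = adjArray G) (hm : v m = n)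
    (hN : n ≤ N) (hx : x ≠ 19) (hm' : m ≠ 19) :
    (adj a m x y).Holds N A v ↔ (natGraph G).Adj (v x) (v y) := by
  simp only [adj, holds_and, holds_lt, val_var, holds_get, val_add, hA, hm]
  constructor
  · rintro ⟨h1, h2, h3⟩
    rw [val_mul hx hm' (by omega), hm] at h3
    exact (adjArray_ne_zero h1 h2).1 h3
  · intro h
    obtain ⟨h1, h2, -⟩ := natGraph_adj.1 h
    refine ⟨h1, h2, ?_⟩
    rw [val_mul hx hm' (by omega), hm]
    exact (adjArray_ne_zero h1 h2).2 h

end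

end Term

theorem Cmd.den_seq {N : ℕ} {c d : Cmd} {s : State} :
    (Cmd.seq c d).den N s = d.den N (c.den N s) := rfl

theorem Cmd.den_rep {N : ℕ} {c : Cmd} {s : State} : (Cmd.rep c).den N s = (c.den N)^[N] s := rfl

theorem Cmd.den_ite {N : ℕ} {e : Term} {c d : Cmd} {s : State} :
    (Cmd.ite e c d).den N s = if e.Holds N s.arr s.var then c.den N s else d.den N s := by
  simp only [Cmd.den, Term.Holds]
  split_ifs <;> simp_all

/-! ### The algorithm

The variables `0`, `1`, `2` hold `n`, `h` and the loop bound `N = 2 * n ^ 2`, the variable `3` the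
vertex that is tested next, `4` the vertex to be embedded, `5` the root of its branch set, `6` the
growth parameter `q`, and `7` the number of vertices plus the number of ordered adjacent pairs of
`H`.  The arrays `0`, `1` hold the adjacency matrices, `2` the labels, `6` a grown set, `7` is
scratch space, `8` holds the parent function of a search tree (shifted by one), `9` a new branch
set, and `10`, `11` the endpoints of the edges that connect the branch sets. -/

namespace Algorithm

open Term Cmd

/-- The vertex `x` is free. -/
def free (x : ℕ) : Term := and (lt (var x) (var 0)) (eq (get 2 (var x)) (const 0))

/-- The vertices `x` and `y` are adjacent in `G`. -/
def adjG (x y : ℕ) : Term := adj 0 0 x y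
/-- The vertices `x` and `y` are adjacent in `H`. -/
def adjH (x y : ℕ) : Term := adj 1 1 x y

/-- The variable `2` is set to `2 * N ^ 2`. -/
def setBound : Cmd := .assign 2 (.sum 10 (.sum 11 (.const 2)))

/-- The variable `7` is set to `m = h + ∑ deg u`, and the variable `6` to the number of `i` with
`m * (i + 1) ^ 2 ≤ n`, which is `⌊√(n / m)⌋`. -/
def setParameters : Cmd :=
  .seq (.assign 7 (.add (.var 1) (.sum 10 (count 11 (adjH 10 11)))))
    (.assign 6 (count 10 (le (.sum 11 (.sum 12 (.ite (and (le (var 11) (var 10))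
      (le (var 12) (var 10))) (var 7) (const 0)))) (var 0))))

/-- One growth step of the set in the array `6`. -/
def grow : Cmd :=
  .seq (.fill 7 10 (and (free 10) (and (not (get 6 (var 10)))
      (ex 11 (and (adjG 10 11) (get 6 (var 11)))))))
    (.ite (le (.sum 10 (.ite (get 7 (var 10)) (var 6) (const 0))) (count 10 (get 6 (var 10))))
      .skip
      (.seq (.fill 8 10 (or (get 6 (var 10)) (get 7 (var 10)))) (.fill 6 10 (get 8 (var 10)))))

/-- A set is grown from the vertex in the variable `3` and discarded if it has at most half of the
free vertices. -/
def testVertex : Cmd :=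
  .ite (eq (get 2 (var 3)) (const 0))
    (.seq (.fill 6 10 (eq (var 10) (var 3))) (.seq (.rep grow)
      (.ite (le (.add (count 10 (get 6 (var 10))) (count 10 (get 6 (var 10)))) (count 10 (free 10)))
        (.seq (.fill 7 10 (.ite (get 6 (var 10)) (.add (var 1) (const 1)) (get 2 (var 10))))
          (.seq (.fill 2 10 (get 7 (var 10))) (.assign 3 (const 0))))
        (.assign 3 (.add (var 3) (const 1))))))
    (.assign 3 (.add (var 3) (const 1)))

/-- The vertex `u` of `H` is not embedded. -/
def missing (u : ℕ) : Term :=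
  and (lt (var u) (var 1)) (not (ex 12 (and (lt (var 12) (var 0))
    (eq (get 2 (var 12)) (.add (var u) (const 1))))))

/-- Branch sets without free neighbours are discarded. -/
def retire : Cmd :=
  .seq (.fill 7 10 (.ite (and (lt (var 10) (var 0)) (and (not (eq (get 2 (var 10)) (const 0)))
      (and (le (get 2 (var 10)) (var 1))
        (not (ex 11 (ex 12 (and (eq (get 2 (var 11)) (get 2 (var 10)))
          (and (adjG 11 12) (eq (get 2 (var 12)) (const 0))))))))))
      (.add (var 1) (const 1)) (get 2 (var 10))))
    (.fill 2 10 (get 7 (var 10)))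

/-- One round of the breadth-first search. -/
def search : Cmd :=
  .seq (.fill 7 10 (.ite (get 8 (var 10)) (get 8 (var 10))
      (.ite (and (free 10) (ex 11 (and (adjG 10 11) (get 8 (var 11)))))
        (.add (least 11 12 fun w => and (adjG 10 w) (get 8 (var w))) (const 1)) (const 0))))
    (.fill 8 10 (get 7 (var 10)))

/-- The free vertex `z` is adjacent to the branch set of `y`. -/
def attached (y z : ℕ) : Term :=
  and (free z) (ex 13 (and (adjG z 13) (eq (get 2 (var 13)) (.add (var y) (const 1)))))

/-- The new branch set is to contain the root and, for every neighbour of the new vertex, the least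
free vertex adjacent to its branch set. -/
def markEnds : Cmd :=
  .fill 9 10 (or (eq (var 10) (var 5)) (ex 11 (and (adjH 4 11) (and (attached 11 10)
    (not (ex 12 (and (lt (var 12) (var 10)) (attached 11 12))))))))

/-- The parents of the marked vertices are marked. -/
def markParents : Cmd :=
  .seq (.fill 7 10 (or (get 9 (var 10)) (ex 11 (and (get 9 (var 11))
      (eq (get 8 (var 11)) (.add (var 10) (const 1)))))))
    (.fill 9 10 (get 7 (var 10)))

/-- A vertex of `H` without a branch set gets one: the branch sets without free neighbours are
discarded, a search tree is built from the least free vertex, and the tree paths from the marked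
vertices to the root are labelled.  All free vertices have to be tested again afterwards. -/
def embed : Cmd :=
  .seq (.assign 3 (const 0)) (.seq (.assign 4 (least 10 11 missing)) (.seq retire
    (.seq (.assign 5 (least 10 11 free))
      (.seq (.fill 8 10 (.ite (eq (var 10) (var 5)) (.add (var 10) (const 1)) (const 0)))
        (.seq (.rep search) (.seq markEnds (.seq (.rep markParents)
          (.seq (.fill 7 10 (.ite (get 9 (var 10)) (.add (var 4) (const 1)) (get 2 (var 10))))
            (.fill 2 10 (get 7 (var 10)))))))))))

/-- One step of the main loop, without effect if all vertices of `H` are embedded. -/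
def step : Cmd :=
  .ite (ex 10 (missing 10)) (.ite (lt (var 3) (var 0)) testVertex embed) .skip

/-- The array `10` gets, at the position `u * h + w`, a vertex of the branch set of `u` with a
neighbour in the branch set of `w`, the array `11` such a neighbour. -/
def findEdges : Cmd :=
  .seq (.fill 10 10 (least 13 14 fun a => ex 11 (ex 12 (and (lt (var 12) (var 1))
      (and (lt (var 11) (var 1))
      (and (eq (.var 10) (.add (mul 11 1) (var 12)))
        (and (eq (get 2 (var a)) (.add (var 11) (const 1)))
          (ex 15 (and (adjG a 15) (eq (get 2 (var 15)) (.add (var 12) (const 1))))))))))))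
    (.fill 11 10 (least 13 14 fun a => ex 11 (ex 12 (and (lt (var 12) (var 1))
      (and (lt (var 11) (var 1))
      (and (eq (.var 10) (.add (mul 11 1) (var 12)))
        (and (eq (get 2 (var a)) (.add (var 12) (const 1)))
          (ex 15 (and (eq (var 15) (get 10 (var 10))) (adjG 15 a))))))))))

/-- The output of the paths: the path for the position `p` of the adjacency matrix of `H` is the
segment of length `2` that begins at the position `2 * p` of the array `5`. -/
def writePaths : Cmd :=
  .seq (.fill 3 10 (.add (var 10) (var 10))) (.seq (.fill 4 10 (const 2))
    (.fill 5 10 (.add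
      (.sum 11 (.ite (eq (var 10) (.add (var 11) (var 11))) (get 10 (var 11)) (const 0)))
      (.sum 11 (.ite (eq (var 10) (.add (.add (var 11) (var 11)) (const 1))) (get 11 (var 11))
        (const 0))))))

/-- The algorithm for the loop bound `N = 2 * n ^ 2`; the main loop makes `N ^ 2` steps. -/
def main : Cmd :=
  .seq setParameters (.seq (.rep (.rep step)) (.seq findEdges writePaths))

/-- The program: the loop bound is computed by a command whose own bound is `n`. -/
def program : Program := .seq (setBound.compile 0 20) (main.compile 2 20)

theorem setBound_ok : setBound.ok 0 20 = true := by decide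
theorem main_ok : main.ok 2 20 = true := by decide

end Algorithm

end RAM

/-! ### Correctness of the parts of the algorithm -/

namespace RAM

section Fill

variable {N a x i : ℕ} {e : Term} {s : State}

theorem den_fill_of_lt (hi : i < N) :
    ((Cmd.fill a x e).den N s).arr a i = e.val N s.arr (Function.update s.var x i) := by
  simp [Cmd.den, hi]

theorem den_fill_holds (hi : i < N) :
    ((Cmd.fill a x e).den N s).arr a i ≠ 0 ↔ e.Holds N s.arr (Function.update s.var x i) := by
  rw [den_fill_of_lt hi, Term.Holds]

theorem den_fill_of_ne {b : ℕ} (hb : b ≠ a) : ((Cmd.fill a x e).den N s).arr b = s.arr b := by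
  simp [Cmd.den, hb]

theorem den_assign_arr : ((Cmd.assign x e).den N s).arr = s.arr := rfl

/-- Computing the new contents of the array `a` in the array `b`, and copying them to `a`. -/
theorem den_fill_copy {b : ℕ} (hi : i < N) :
    ((Cmd.seq (.fill b x e) (.fill a 10 (.get b (.var 10)))).den N s).arr a i =
      e.val N s.arr (Function.update s.var x i) := by
  rw [Cmd.den, den_fill_of_lt hi]
  simp [den_fill_of_lt hi]

theorem den_fill_copy_of_ne {a' b : ℕ} (ha : a' ≠ a) (hb : a' ≠ b) :
    ((Cmd.seq (.fill b x e) (.fill a 10 (.get b (.var 10)))).den N s).arr a' = s.arr a' := by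
  rw [Cmd.den, den_fill_of_ne ha, den_fill_of_ne hb]

theorem den_fill_copy_var {b : ℕ} :
    ((Cmd.seq (.fill b x e) (.fill a 10 (.get b (.var 10)))).den N s).var = s.var := rfl

end Fill

/-- The part of the memory that stays fixed during the main loop. -/
structure Ctx {n h : ℕ} (G : SimpleGraph (Fin n)) (H : SimpleGraph (Fin h)) (q : ℕ) (s : State) :
    Prop where
  var0 : s.var 0 = n
  var1 : s.var 1 = h
  var6 : s.var 6 = q
  arr0 : s.arr 0 = adjArray G
  arr1 : s.arr 1 = adjArray H

theorem card_filter_eq {N : ℕ} {P : ℕ → Prop} [DecidablePred P] {T : Finset ℕ}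
    (hT : T ⊆ Finset.range N) (h : ∀ i < N, P i ↔ i ∈ T) : (Finset.range N).filter P = T := by
  ext i
  rw [Finset.mem_filter, Finset.mem_range]
  constructor
  · rintro ⟨h1, h2⟩; exact (h i h1).1 h2
  · intro hi; exact ⟨Finset.mem_range.1 (hT hi), (h i (Finset.mem_range.1 (hT hi))).2 hi⟩

namespace Algorithm

open Term Cmd

variable {n h q N : ℕ} {G : SimpleGraph (Fin n)} {H : SimpleGraph (Fin h)} {s : State}

theorem Ctx_congr {s' : State} (hs : Ctx G H q s) (hv : ∀ x, x ≠ 3 → x ≠ 4 → x ≠ 5 →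
    s'.var x = s.var x) (ha : ∀ a < 2, s'.arr a = s.arr a) : Ctx G H q s' :=
  ⟨by rw [hv 0 (by omega) (by omega) (by omega), hs.var0],
    by rw [hv 1 (by omega) (by omega) (by omega), hs.var1],
    by rw [hv 6 (by omega) (by omega) (by omega), hs.var6],
    by rw [ha 0 (by omega), hs.arr0], by rw [ha 1 (by omega), hs.arr1]⟩

theorem holds_free {A : ℕ → ℕ → ℕ} {v : ℕ → ℕ} {x : ℕ} (hv : v 0 = n) :
    (free x).Holds N A v ↔ v x ∈ cls n (A 2) 0 := by
  simp [free, mem_cls, hv]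

theorem holds_adjG {A : ℕ → ℕ → ℕ} {v : ℕ → ℕ} {x y : ℕ} (hA : A 0 = adjArray G) (hv : v 0 = n)
    (hN : n ≤ N) (hx : x ≠ 19) : (adjG x y).Holds N A v ↔ (natGraph G).Adj (v x) (v y) :=
  holds_adj hA hv hN hx (by omega)

theorem holds_adjH {A : ℕ → ℕ → ℕ} {v : ℕ → ℕ} {x y : ℕ} (hA : A 1 = adjArray H) (hv : v 1 = h)
    (hN : h ≤ N) (hx : x ≠ 19) : (adjH x y).Holds N A v ↔ (natGraph H).Adj (v x) (v y) :=
  holds_adj hA hv hN hx (by omega)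

theorem natGraph_lt {a b : ℕ} (hab : (natGraph G).Adj a b) : a < n ∧ b < n := by
  obtain ⟨h1, h2, -⟩ := natGraph_adj.1 hab
  exact ⟨h1, h2⟩

theorem den_grow (hs : Ctx G H q s) (hN : n ≤ N) {S : Finset ℕ}
    (hS : ∀ v < N, s.arr 6 v ≠ 0 ↔ v ∈ S) (hSR : S ⊆ cls n (s.arr 2) 0) :
    (grow.den N s).var = s.var ∧ (∀ a < 6, (grow.den N s).arr a = s.arr a) ∧
      ∀ v < N, (grow.den N s).arr 6 v ≠ 0 ↔
        v ∈ growStep (natGraph G) (cls n (s.arr 2) 0) q S := by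
  have hlt : ∀ {v k}, v ∈ cls n (s.arr 2) k → v < N := fun hv => (mem_cls.1 hv).1.trans_le hN
  rw [grow, den_seq]
  generalize hs₁ : Cmd.den N _ s = s₁
  have hv₁ : s₁.var = s.var := by rw [← hs₁]; rfl
  have ha₁ : ∀ a, a ≠ 7 → s₁.arr a = s.arr a := fun a ha => by rw [← hs₁, den_fill_of_ne ha]
  have h7 : ∀ v < N, s₁.arr 7 v ≠ 0 ↔ v ∈ bdry (natGraph G) (cls n (s.arr 2) 0) S := by
    intro v hv
    rw [← hs₁, den_fill_holds hv]
    simp only [holds_and, holds_not, holds_ex, holds_get, val_var, mem_bdry]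
    rw [holds_free (n := n) (by simp [hs.var0])]
    have h1 : ∀ i, (adjG 10 11).Holds N s.arr (Function.update (Function.update s.var 10 v) 11 i) ↔
        (natGraph G).Adj v i := by
      intro i
      rw [holds_adjG hs.arr0 (by simp [hs.var0]) hN (by decide)]
      simp
    simp only [h1, Function.update_self]
    rw [hS v hv]
    refine and_congr_right fun _ => and_congr_right fun _ => ?_
    constructor
    · rintro ⟨i, hi, ha, hi6⟩
      exact ⟨i, (hS i hi).1 hi6, ha⟩
    · rintro ⟨i, hi, ha⟩
      exact ⟨i, hlt (hSR hi), ha, (hS i (hlt (hSR hi))).2 hi⟩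
  have hcardS : (count 10 (get 6 (var 10))).val N s₁.arr s₁.var = S.card := by
    rw [val_count, card_filter_eq (T := S)]
    · intro v hv; exact Finset.mem_range.2 (hlt (hSR hv))
    · intro v hv; simp [ha₁, ← hS v hv]
  have hcardB : (sum 10 (.ite (get 7 (var 10)) (var 6) (const 0))).val N s₁.arr s₁.var =
      (bdry (natGraph G) (cls n (s.arr 2) 0) S).card * q := by
    simp only [val_sum, val_ite, val_const, holds_get, val_var, Function.update_self]
    rw [← Finset.sum_filter, card_filter_eq (T := bdry (natGraph G) (cls n (s.arr 2) 0) S)]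
    · simp [hv₁, hs.var6]
    · intro v hv; exact Finset.mem_range.2 (hlt (bdry_subset _ hv))
    · exact h7
  rw [den_ite]
  split_ifs with hc <;> rw [holds_le, hcardS, hcardB] at hc <;>
    simp only [growStep, hc, if_true, if_false]
  · refine ⟨hv₁, fun a ha => ha₁ a (by omega), fun v hv => ?_⟩
    rw [Cmd.den, ha₁ 6 (by omega)]
    exact hS v hv
  · refine ⟨hv₁, fun a ha => ?_, fun v hv => ?_⟩
    · rw [den_fill_copy_of_ne (by omega) (by omega), ha₁ a (by omega)]
    · rw [den_fill_copy hv, ← Holds, holds_or, Finset.mem_union, ← hS v hv, ← h7 v hv]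
      simp [ha₁]

/-- Iterating `grow` in the memory follows the iteration of `growStep`. -/
theorem den_rep_grow (hs : Ctx G H q s) (hN : n ≤ N) {c : ℕ} (hc : c ∈ cls n (s.arr 2) 0)
    (hS : ∀ v < N, s.arr 6 v ≠ 0 ↔ v = c) (k : ℕ) :
    ((grow.den N)^[k] s).var = s.var ∧ (∀ a < 6, ((grow.den N)^[k] s).arr a = s.arr a) ∧
      ∀ v < N, ((grow.den N)^[k] s).arr 6 v ≠ 0 ↔
        v ∈ (growStep (natGraph G) (cls n (s.arr 2) 0) q)^[k] {c} := by
  induction k with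
  | zero => exact ⟨rfl, fun _ _ => rfl, by simpa using hS⟩
  | succ k ih =>
    obtain ⟨h1, h2, h3⟩ := ih
    rw [Function.iterate_succ_apply', Function.iterate_succ_apply']
    have h22 := h2 2 (by omega)
    have := den_grow (s := (grow.den N)^[k] s) (Ctx_congr hs (fun x _ _ _ => by rw [h1])
      (fun a ha => h2 a (by omega))) hN (by simpa using h3)
      (by rw [h22]; exact grow_subset hc k)
    rw [h22] at this
    exact ⟨this.1.trans h1, fun a ha => (this.2.1 a ha).trans (h2 a ha), this.2.2⟩

/-- The set grown from `c` has more than half of the free vertices. -/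
def Big (G : SimpleGraph ℕ) (n q N : ℕ) (f : ℕ → ℕ) (c : ℕ) : Prop :=
  (cls n f 0).card < 2 * ((growStep G (cls n f 0) q)^[N] {c}).card

/-- A test either passes to the next vertex, and then the tested vertex, if free, grows a large set,
or enlarges the discarded set and starts again. -/
theorem den_testVertex {l M : ℕ} (hs : Ctx G H q s) (hN : n ≤ N) (hc : s.var 3 < n)
    (hI : PartialModel (natGraph G) (natGraph H) n h q l (s.arr 2))
    (hP : Params (natGraph G) (natGraph H) n h q l M) :
    Ctx G H q (testVertex.den N s) ∧
    ((testVertex.den N s).arr 2 = s.arr 2 ∧ (testVertex.den N s).var 3 = s.var 3 + 1 ∧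
        (s.arr 2 (s.var 3) = 0 → Big (natGraph G) n q N (s.arr 2) (s.var 3)) ∨
      (testVertex.den N s).var 3 = 0 ∧
        PartialModel (natGraph G) (natGraph H) n h q l ((testVertex.den N s).arr 2) ∧
        (cls n (s.arr 2) (h + 1)).card < (cls n ((testVertex.den N s).arr 2) (h + 1)).card) := by
  have hnext : ∀ s' : State, s'.var = s.var → (∀ a < 6, s'.arr a = s.arr a) →
      Ctx G H q ((Cmd.assign 3 (.add (.var 3) (const 1))).den N s') ∧
      ((Cmd.assign 3 (.add (.var 3) (const 1))).den N s').arr 2 = s.arr 2 ∧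
      ((Cmd.assign 3 (.add (.var 3) (const 1))).den N s').var 3 = s.var 3 + 1 := by
    intro s' hv ha
    refine ⟨Ctx_congr hs (fun x h3 _ _ => ?_) (fun a ha' => ha a (by omega)), ha 2 (by omega), ?_⟩
    · simp [Cmd.den, hv, h3]
    · simp [Cmd.den, hv]
  rw [testVertex, den_ite]
  split_ifs with h0
  swap
  · obtain ⟨h1, h2, h3⟩ := hnext s rfl (fun _ _ => rfl)
    refine ⟨h1, .inl ⟨h2, h3, fun h4 => absurd ?_ h0⟩⟩
    simpa using h4
  have hcR : s.var 3 ∈ cls n (s.arr 2) 0 := mem_cls.2 ⟨hc, by simpa using h0⟩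
  rw [den_seq]
  generalize hs₁ : Cmd.den N (.fill _ _ _) s = s₁
  have hv₁ : s₁.var = s.var := by rw [← hs₁]; rfl
  have ha₁ : ∀ a < 6, s₁.arr a = s.arr a := fun a ha => by rw [← hs₁, den_fill_of_ne (by omega)]
  have h6 : ∀ v < N, s₁.arr 6 v ≠ 0 ↔ v = s.var 3 := by
    intro v hv
    rw [← hs₁, den_fill_holds hv]
    simp
  have hs₁ctx : Ctx G H q s₁ := Ctx_congr hs (fun x _ _ _ => by rw [hv₁])
    (fun a ha => ha₁ a (by omega))
  obtain ⟨hv₂, ha₂, hg₂⟩ := den_rep_grow hs₁ctx hN (by rw [ha₁ 2 (by omega)]; exact hcR) h6 N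
  rw [den_seq, den_rep]
  generalize (grow.den N)^[N] s₁ = s₂ at hv₂ ha₂ hg₂
  rw [ha₁ 2 (by omega)] at hg₂
  set S := (growStep (natGraph G) (cls n (s.arr 2) 0) q)^[N] {s.var 3} with hSdef
  have hv : s₂.var = s.var := hv₂.trans hv₁
  have ha : ∀ a < 6, s₂.arr a = s.arr a := fun a h => (ha₂ a h).trans (ha₁ a h)
  have hSR : S ⊆ cls n (s.arr 2) 0 := grow_subset hcR N
  have hlt : ∀ {v}, v ∈ cls n (s.arr 2) 0 → v < N := fun hv => (mem_cls.1 hv).1.trans_le hN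
  have hcardS : (count 10 (get 6 (var 10))).val N s₂.arr s₂.var = S.card := by
    rw [val_count, card_filter_eq (T := S)]
    · intro v hv; exact Finset.mem_range.2 (hlt (hSR hv))
    · intro v hv; simp [← hg₂ v hv]
  have hcardR : (count 10 (free 10)).val N s₂.arr s₂.var = (cls n (s.arr 2) 0).card := by
    rw [val_count, card_filter_eq (T := cls n (s.arr 2) 0)]
    · intro v hv; exact Finset.mem_range.2 (hlt hv)
    · intro v _
      rw [holds_free (n := n) (by simp [hv, hs.var0]), ha 2 (by omega), Function.update_self]
  rw [den_ite]
  split_ifs with hsmall <;> rw [holds_le, val_add, hcardS, hcardR] at hsmall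
  swap
  · obtain ⟨h1, h2, h3⟩ := hnext s₂ hv ha
    refine ⟨h1, .inl ⟨h2, h3, fun _ => ?_⟩⟩
    change _ < 2 * S.card
    omega
  generalize hs₃ : Cmd.den N _ s₂ = s₃
  have ha₃ : ∀ a < 2, s₃.arr a = s.arr a := by
    intro a ha'
    rw [← hs₃, den_seq, den_seq, den_assign_arr, den_fill_of_ne (by omega),
      den_fill_of_ne (by omega),
      ha a (by omega)]
  have hv₃ : ∀ x, x ≠ 3 → s₃.var x = s.var x := by
    intro x hx
    rw [← hs₃]
    simp [Cmd.den, hx, hv]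
  have h30 : s₃.var 3 = 0 := by
    rw [← hs₃]
    simp [Cmd.den]
  have h2 : ∀ v < n, s₃.arr 2 v = if v ∈ S then h + 1 else s.arr 2 v := by
    intro v hvn
    have hvN : v < N := hvn.trans_le hN
    have : s₃.arr 2 v = (Term.ite (get 6 (var 10)) (.add (var 1) (const 1)) (get 2 (var 10))).val N
        s₂.arr (Function.update s₂.var 10 v) := by
      rw [← hs₃, ← den_fill_copy (a := 2) (b := 7) hvN]; rfl
    rw [this]
    simp only [val_ite, holds_get, val_var, Function.update_self, hg₂ v hvN, val_add, val_const,
      val_get, ha 2 (by omega)]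
    simp [hv, hs.var1]
  refine ⟨Ctx_congr hs (fun x hx _ _ => hv₃ x hx) ha₃, .inr ⟨h30, ?_⟩⟩
  have hk : (cls n (s.arr 2) 0).card ≤ N := by
    have := Finset.card_le_card (cls_subset_range (n := n) (f := s.arr 2) (k := 0))
    rw [Finset.card_range] at this
    omega
  obtain ⟨h3, h4, -⟩ := hI.discard hP hSR (grow_sparse hcR hk) (by omega) h2
  refine ⟨h3, ?_⟩
  have : 0 < S.card := Finset.card_pos.2 ⟨_, mem_grow_self N⟩
  omega

end Algorithm

end RAM

namespace RAM

namespace Algorithm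

open Term Cmd

variable {n h q N : ℕ} {G : SimpleGraph (Fin n)} {H : SimpleGraph (Fin h)} {s : State}

theorem holds_missing {A : ℕ → ℕ → ℕ} {v : ℕ → ℕ} {u : ℕ} (hv0 : v 0 = n) (hv1 : v 1 = h)
    (hN : n ≤ N) (hu : u ≠ 12) :
    (missing u).Holds N A v ↔ v u < h ∧ cls n (A 2) (v u + 1) = ∅ := by
  simp only [missing, holds_and, holds_lt, val_var, holds_not, holds_ex, holds_eq, val_get, val_add,
    val_const, Function.update_self, hv1, Function.update_of_ne hu]
  refine and_congr_right fun _ => ?_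
  rw [Finset.eq_empty_iff_forall_notMem]
  simp only [mem_cls]
  constructor
  · rintro h1 v ⟨h2, h3⟩
    exact h1 ⟨v, by omega, by simpa [hv0] using h2, h3⟩
  · rintro h1 ⟨v, -, h2, h3⟩
    exact h1 v ⟨by simpa [hv0] using h2, h3⟩

theorem den_retire (hs : Ctx G H q s) (hN : n ≤ N) :
    (retire.den N s).var = s.var ∧ (∀ a < 2, (retire.den N s).arr a = s.arr a) ∧
    (∀ v < n, (s.arr 2 v ≠ 0 ∧ s.arr 2 v ≤ h ∧ ¬ ∃ a ∈ cls n (s.arr 2) (s.arr 2 v),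
      ∃ b ∈ cls n (s.arr 2) 0, (natGraph G).Adj a b) → (retire.den N s).arr 2 v = h + 1) ∧
    (∀ v < n, ¬ (s.arr 2 v ≠ 0 ∧ s.arr 2 v ≤ h ∧ ¬ ∃ a ∈ cls n (s.arr 2) (s.arr 2 v),
      ∃ b ∈ cls n (s.arr 2) 0, (natGraph G).Adj a b) →
      (retire.den N s).arr 2 v = s.arr 2 v) := by
  classical
  have hval : ∀ v < n, (retire.den N s).arr 2 v = if (s.arr 2 v ≠ 0 ∧ s.arr 2 v ≤ h ∧
      ¬ ∃ i < N, ∃ j < N, s.arr 2 i = s.arr 2 v ∧ (natGraph G).Adj i j ∧ s.arr 2 j = 0)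
      then h + 1 else s.arr 2 v := by
    intro v hv
    have h1 : ∀ i j, (adjG 11 12).Holds N s.arr
        (Function.update (Function.update (Function.update s.var 10 v) 11 i) 12 j) ↔
          (natGraph G).Adj i j := by
      intro i j
      rw [holds_adjG hs.arr0 (by simp [hs.var0]) hN (by decide)]
      simp
    rw [retire, den_fill_copy (hv.trans_le hN), val_ite]
    simp only [holds_and, holds_not, holds_ex, holds_eq, holds_le, holds_lt, val_var, val_get,
      val_const, val_add, h1, Function.update_self]
    simp [hs.var0, hs.var1, hv]
  have hiff : ∀ v, (∃ i < N, ∃ j < N, s.arr 2 i = s.arr 2 v ∧ (natGraph G).Adj i j ∧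
      s.arr 2 j = 0) ↔ ∃ a ∈ cls n (s.arr 2) (s.arr 2 v), ∃ b ∈ cls n (s.arr 2) 0,
        (natGraph G).Adj a b := by
    intro v
    simp only [mem_cls]
    constructor
    · rintro ⟨i, -, j, -, h1, h2, h3⟩
      obtain ⟨hi, hj⟩ := natGraph_lt h2
      exact ⟨i, ⟨hi, h1⟩, j, ⟨hj, h3⟩, h2⟩
    · rintro ⟨i, ⟨hi, h1⟩, j, ⟨hj, h3⟩, h2⟩
      exact ⟨i, by omega, j, by omega, h1, h2, h3⟩
  refine ⟨rfl, fun a ha => ?_, fun v hv hc => ?_, fun v hv hc => ?_⟩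
  · rw [retire, den_fill_copy_of_ne (by omega) (by omega)]
  · rw [hval v hv, if_pos (by rwa [hiff])]
  · rw [hval v hv, if_neg (by rwa [hiff])]

theorem den_search (hs : Ctx G H q s) (hN : n ≤ N) {r i : ℕ} (hr : r ∈ cls n (s.arr 2) 0)
    (hP : IsSearch (natGraph G) (cls n (s.arr 2) 0) r i (s.arr 8))
    (h0 : ∀ v < N, v ∉ cls n (s.arr 2) 0 → s.arr 8 v = 0) :
    (search.den N s).var = s.var ∧ (∀ a < 6, (search.den N s).arr a = s.arr a) ∧
      IsSearch (natGraph G) (cls n (s.arr 2) 0) r (i + 1) ((search.den N s).arr 8) ∧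
      ∀ v < N, v ∉ cls n (s.arr 2) 0 → (search.den N s).arr 8 v = 0 := by
  classical
  set R := cls n (s.arr 2) 0 with hR
  have hlt : ∀ {v}, v ∈ R → v < N := fun hv => (mem_cls.1 hv).1.trans_le hN
  have hadj : ∀ v y i, y = 11 ∨ y = 12 → ∀ u, u 0 = n → u 10 = v →
      ((and (adjG 10 y) (get 8 (var y))).Holds N s.arr (Function.update u y i) ↔
        (natGraph G).Adj v i ∧ s.arr 8 i ≠ 0) := by
    intro v y i hy u hu0 hu
    have hy0 : 0 ≠ y := by omega
    have hy10 : 10 ≠ y := by omega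
    rw [holds_and, holds_adjG hs.arr0 (by rw [Function.update_of_ne hy0, hu0]) hN (by decide)]
    simp [Function.update_of_ne hy10, hu]
  have hex : ∀ v, (∃ i < N, (natGraph G).Adj v i ∧ s.arr 8 i ≠ 0) ↔
      ∃ w ∈ R, (natGraph G).Adj v w ∧ s.arr 8 w ≠ 0 := by
    intro v
    constructor
    · rintro ⟨w, hw, h1, h2⟩
      refine ⟨w, ?_, h1, h2⟩
      by_contra hwR
      exact h2 (h0 w hw hwR)
    · rintro ⟨w, hw, h1⟩
      exact ⟨w, hlt hw, h1⟩
  have hval : ∀ v < N, (search.den N s).arr 8 v = if s.arr 8 v ≠ 0 then s.arr 8 v else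
      if v ∈ R ∧ ∃ i < N, (natGraph G).Adj v i ∧ s.arr 8 i ≠ 0 then
        (least 11 12 fun w => and (adjG 10 w) (get 8 (var w))).val N s.arr
          (Function.update s.var 10 v) + 1 else 0 := by
    intro v hv
    rw [search, den_fill_copy hv, val_ite, val_ite]
    have h1 : (free 10).Holds N s.arr (Function.update s.var 10 v) ↔ v ∈ R := by
      rw [holds_free (n := n) (by simp [hs.var0]), Function.update_self]
    simp only [holds_and, holds_ex, h1]
    simp only [← holds_and, hadj v 11 _ (.inl rfl) (Function.update s.var 10 v)
      (by simp [hs.var0]) (by simp)]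
    simp
  have hnew : ∀ v, (∃ i < N, (natGraph G).Adj v i ∧ s.arr 8 i ≠ 0) →
      ∃ w ∈ R, (natGraph G).Adj v w ∧ s.arr 8 w ≠ 0 ∧
        (least 11 12 fun w => and (adjG 10 w) (get 8 (var w))).val N s.arr
          (Function.update s.var 10 v) = w := by
    intro v hv
    obtain ⟨h1, h2, h3⟩ := val_least (A := s.arr) (v := Function.update s.var 10 v)
      (x := 11) (y := 12)
      (e := fun w => and (adjG 10 w) (get 8 (var w)))
      (fun i => hadj v 11 i (.inl rfl) _ (by simp [hs.var0]) (by simp))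
      (fun i j => hadj v 12 j (.inr rfl) _ (by simp [hs.var0]) (by simp)) (by decide) hv
    refine ⟨_, ?_, h2, h3, rfl⟩
    by_contra hwR
    exact h3 (h0 _ h1 hwR)
  refine ⟨rfl, fun a ha => ?_, hP.succ hr ?_ ?_ ?_, ?_⟩
  · rw [search, den_fill_copy_of_ne (by omega) (by omega)]
  · intro v hv h1
    rw [hval v (hlt hv), if_pos h1]
  · intro v hv h1 hw
    rw [← hex] at hw
    obtain ⟨w, hwR, h2, h3, h4⟩ := hnew v hw
    refine ⟨w, hwR, h2, h3, ?_⟩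
    rw [hval v (hlt hv), if_neg (by simpa using h1), if_pos ⟨hv, hw⟩, h4]
  · intro v hv h1 hw
    rw [← hex] at hw
    rw [hval v (hlt hv), if_neg (by simpa using h1), if_neg (fun hc => hw hc.2)]
  · intro v hv hvR
    rw [hval v hv, if_neg (by simpa using h0 v hv hvR), if_neg (fun hc => hvR hc.1)]

theorem den_rep_search (hs : Ctx G H q s) (hN : n ≤ N) {r : ℕ} (hr : r ∈ cls n (s.arr 2) 0)
    (h8 : ∀ v < N, s.arr 8 v = if v = r then v + 1 else 0) (i : ℕ) :
    ((search.den N)^[i] s).var = s.var ∧ (∀ a < 6, ((search.den N)^[i] s).arr a = s.arr a) ∧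
      IsSearch (natGraph G) (cls n (s.arr 2) 0) r i (((search.den N)^[i] s).arr 8) ∧
      ∀ v < N, v ∉ cls n (s.arr 2) 0 → ((search.den N)^[i] s).arr 8 v = 0 := by
  have hlt : ∀ {v}, v ∈ cls n (s.arr 2) 0 → v < N := fun hv => (mem_cls.1 hv).1.trans_le hN
  induction i with
  | zero =>
    refine ⟨rfl, fun _ _ => rfl, ⟨fun v hv => ?_, ?_, fun j hj => absurd hj (by omega),
      fun v hv => .inl (by simpa [ball] using hv)⟩, fun v hv hvR => ?_⟩
    · rw [Function.iterate_zero_apply, h8 v (hlt hv)]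
      simp [ball]
    · rw [Function.iterate_zero_apply, h8 r (hlt hr), if_pos rfl]
    · rw [Function.iterate_zero_apply, h8 v hv, if_neg]
      rintro rfl
      exact hvR hr
  | succ i ih =>
    obtain ⟨h1, h2, h3, h4⟩ := ih
    rw [Function.iterate_succ_apply']
    have h22 := h2 2 (by omega)
    have := den_search (s := (search.den N)^[i] s) (Ctx_congr hs (fun x _ _ _ => by rw [h1])
      (fun a ha => h2 a (by omega))) hN (by rw [h22]; exact hr) (by rw [h22]; exact h3)
      (by rw [h22]; exact h4)
    rw [h22] at this
    exact ⟨this.1.trans h1, fun a ha => (this.2.1 a ha).trans (h2 a ha), this.2.2⟩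

theorem holds_attached {A : ℕ → ℕ → ℕ} {v : ℕ → ℕ} {y z : ℕ} (hA : A 0 = adjArray G)
    (hv0 : v 0 = n) (hN : n ≤ N) (hy : y ≠ 13) (hz : z ≠ 13) (hz' : z ≠ 19) :
    (attached y z).Holds N A v ↔ Attached (natGraph G) n (A 2) (v y) (v z) := by
  rw [attached, holds_and, holds_free hv0, holds_ex, Attached]
  refine and_congr_right fun _ => ?_
  have h1 : ∀ i, (adjG z 13).Holds N A (Function.update v 13 i) ↔ (natGraph G).Adj (v z) i := by
    intro i
    rw [holds_adjG hA (by simp [hv0]) hN hz', Function.update_of_ne hz, Function.update_self]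
  simp only [holds_and, holds_eq, val_get, val_var, val_add, val_const, h1, Function.update_self,
    Function.update_of_ne hy, mem_cls]
  constructor
  · rintro ⟨i, -, h2, h3⟩
    exact ⟨i, ⟨(natGraph_lt h2).2, h3⟩, h2⟩
  · rintro ⟨i, ⟨h2, h3⟩, h4⟩
    exact ⟨i, by omega, h4, h3⟩

theorem den_markEnds (hs : Ctx G H q s) (hN : n ≤ N) (hN' : h ≤ N) {v : ℕ} (hv : v < N) :
    (markEnds.den N s).arr 9 v ≠ 0 ↔ v = s.var 5 ∨ ∃ y < h, (natGraph H).Adj (s.var 4) y ∧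
      IsLeast {z | Attached (natGraph G) n (s.arr 2) y z} v := by
  have h1 : ∀ i, (adjH 4 11).Holds N s.arr (Function.update (Function.update s.var 10 v) 11 i) ↔
      (natGraph H).Adj (s.var 4) i := by
    intro i
    rw [holds_adjH hs.arr1 (by simp [hs.var1]) hN' (by decide)]
    simp
  have h2 : ∀ i, (attached 11 10).Holds N s.arr
      (Function.update (Function.update s.var 10 v) 11 i) ↔
        Attached (natGraph G) n (s.arr 2) i v := by
    intro i
    rw [holds_attached hs.arr0 (by simp [hs.var0]) hN (by decide) (by decide) (by decide)]
    simp
  have h3 : ∀ i j, (attached 11 12).Holds N s.arr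
      (Function.update (Function.update (Function.update s.var 10 v) 11 i) 12 j) ↔
        Attached (natGraph G) n (s.arr 2) i j := by
    intro i j
    rw [holds_attached hs.arr0 (by simp [hs.var0]) hN (by decide) (by decide) (by decide)]
    simp
  rw [markEnds, den_fill_holds hv]
  simp only [holds_or, holds_and, holds_ex, holds_eq, holds_not, holds_lt, val_var, h1, h2, h3]
  simp only [Function.update_self, ne_eq, not_false_eq_true,
    Function.update_of_ne, Nat.reduceEqDiff]
  refine or_congr Iff.rfl ?_
  constructor
  · rintro ⟨y, -, h4, h5, h6⟩
    refine ⟨y, (natGraph_lt h4).2, h4, h5, fun z hz => ?_⟩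
    by_contra hlt
    exact h6 ⟨z, by omega, by omega, hz⟩
  · rintro ⟨y, hy, h4, h5, h6⟩
    refine ⟨y, by omega, h4, h5, ?_⟩
    rintro ⟨z, -, hz, hz'⟩
    have := h6 hz'
    omega

/-- After `i` rounds, the tree paths of length at most `i` that start at the vertices in `Z` are
marked. -/
theorem den_rep_markParents {r : ℕ} {Z : ℕ → Prop} {R : Finset ℕ}
    (hR : R ⊆ Finset.range N) (hP : IsSearch (natGraph G) R r N (s.arr 8)) (hr : r ∈ R)
    (hZ : ∀ z, Z z → z ∈ ball (natGraph G) R r N)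
    (h9 : ∀ v < N, s.arr 9 v ≠ 0 ↔ v = r ∨ Z v) (i : ℕ) :
    ((markParents.den N)^[i] s).var = s.var ∧
      (∀ a, a ≠ 7 → a ≠ 9 → ((markParents.den N)^[i] s).arr a = s.arr a) ∧
      ∀ v < N, ((markParents.den N)^[i] s).arr 9 v ≠ 0 ↔
        v = r ∨ ∃ z, Z z ∧ ∃ j ≤ i, v = (fun v => s.arr 8 v - 1)^[j] z := by
  have hpar := hP.isParent
  induction i with
  | zero =>
    refine ⟨rfl, fun _ _ _ => rfl, fun v hv => ?_⟩
    rw [Function.iterate_zero_apply, h9 v hv]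
    refine or_congr Iff.rfl ⟨fun h => ⟨v, h, 0, le_rfl, rfl⟩, ?_⟩
    rintro ⟨z, hz, j, hj, rfl⟩
    obtain rfl : j = 0 := by omega
    exact hz
  | succ i ih =>
    obtain ⟨h1, h2, h3⟩ := ih
    rw [Function.iterate_succ_apply']
    generalize (markParents.den N)^[i] s = s₁ at h1 h2 h3
    refine ⟨h1, fun a h7 h9 => ?_, fun v hv => ?_⟩
    · rw [markParents, den_fill_copy_of_ne h9 h7, h2 a h7 h9]
    · rw [markParents, den_fill_copy hv, ← Holds]
      simp only [holds_or, holds_get, holds_ex, holds_and, holds_eq, val_get, val_var, val_add,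
        val_const, Function.update_self, h2 8 (by decide) (by decide)]
      rw [h3 v hv]
      have hmem : ∀ w, (w = r ∨ ∃ z, Z z ∧ ∃ j ≤ i, w = (fun v => s.arr 8 v - 1)^[j] z) →
          w ∈ ball (natGraph G) R r N := by
        rintro w (rfl | ⟨z, hz, j, -, rfl⟩)
        · exact mem_ball_self
        · exact hpar.iterate_mem_ball (hZ z hz) j
      constructor
      · rintro (h4 | ⟨w, hw, h5, h6⟩)
        · rcases h4 with h4 | ⟨z, hz, j, hj, h4⟩
          · exact .inl h4
          · exact .inr ⟨z, hz, j, by omega, h4⟩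
        · have h7 : s.arr 8 w - 1 = v := by
            rw [h6]
            simp
          rcases (h3 w hw).1 h5 with rfl | ⟨z, hz, j, hj, rfl⟩
          · left
            rw [← h7]
            exact hpar.root
          · right
            refine ⟨z, hz, j + 1, by omega, ?_⟩
            rw [Function.iterate_succ_apply']
            exact h7.symm
      · rintro (h4 | ⟨z, hz, j, hj, h4⟩)
        · exact .inl (.inl h4)
        · rcases Nat.lt_or_ge i j with hij | hij
          · obtain rfl : j = i + 1 := by omega
            right
            rw [Function.iterate_succ_apply'] at h4
            set w := (fun v => s.arr 8 v - 1)^[i] z with hw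
            have hwm : w = r ∨ ∃ z, Z z ∧ ∃ j ≤ i, w = (fun v => s.arr 8 v - 1)^[j] z :=
              .inr ⟨z, hz, i, le_rfl, rfl⟩
            have hwR := ball_subset hr (hmem w hwm)
            have hwN := Finset.mem_range.1 (hR hwR)
            refine ⟨w, hwN, (h3 w hwN).2 hwm, ?_⟩
            have h5 := (hP.reached w hwR).2 (hmem w hwm)
            simp only [ne_eq, not_false_eq_true, Function.update_of_ne,
              Nat.reduceEqDiff, Function.update_self]
            replace h4 : v = s.arr 8 w - 1 := h4
            clear_value w
            clear hwm hw
            omega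
          · exact .inl (.inr ⟨z, hz, j, hij, h4⟩)

/-- If all free vertices grow large sets, then `embed` enlarges the discarded set or the number of
embedded vertices. -/
theorem den_embed {l M : ℕ} (hs : Ctx G H q s) (hN : n ≤ N) (hN' : h ≤ N)
    (hI : PartialModel (natGraph G) (natGraph H) n h q l (s.arr 2))
    (hP : Params (natGraph G) (natGraph H) n h q l M)
    (hbig : ∀ c ∈ cls n (s.arr 2) 0, Big (natGraph G) n q N (s.arr 2) c)
    (hmiss : ∃ u < h, cls n (s.arr 2) (u + 1) = ∅) :
    Ctx G H q (embed.den N s) ∧ (embed.den N s).var 3 = 0 ∧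
      PartialModel (natGraph G) (natGraph H) n h q l ((embed.den N s).arr 2) ∧
      ((cls n (s.arr 2) (h + 1)).card < (cls n ((embed.den N s).arr 2) (h + 1)).card ∨
        (cls n (s.arr 2) (h + 1)).card = (cls n ((embed.den N s).arr 2) (h + 1)).card ∧
        embedded n h (s.arr 2) < embedded n h ((embed.den N s).arr 2)) := by
  -- the choice of the new vertex
  obtain ⟨s₁, hs₁⟩ : ∃ s₁, s₁ =
    (Cmd.assign 4 (least 10 11 missing)).den N ((Cmd.assign 3 (const 0)).den N s) := ⟨_, rfl⟩
  have ha₁ : s₁.arr = s.arr := by rw [hs₁]; rfl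
  have hv₁ : ∀ x, x ≠ 3 → x ≠ 4 → s₁.var x = s.var x := by
    intro x h3 h4
    rw [hs₁]
    simp [Cmd.den, h3, h4]
  have hv₁3 : s₁.var 3 = 0 := by rw [hs₁]; simp [Cmd.den]
  have hx : s₁.var 4 < h ∧ cls n (s.arr 2) (s₁.var 4 + 1) = ∅ := by
    have := val_least (N := N) (A := s.arr) (v := Function.update s.var 3 0) (x := 10) (y := 11)
      (e := missing) (P := fun u => u < h ∧ cls n (s.arr 2) (u + 1) = ∅)
      (fun i => by
        rw [holds_missing (n := n) (h := h) (by simp [hs.var0]) (by simp [hs.var1]) hN (by decide)]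
        simp)
      (fun i j => by
        rw [holds_missing (n := n) (h := h) (by simp [hs.var0]) (by simp [hs.var1]) hN (by decide)]
        simp)
      (by decide)
      (by obtain ⟨u, hu, hue⟩ := hmiss; exact ⟨u, by omega, hu, hue⟩)
    have h4 : s₁.var 4 = (least 10 11 missing).val N s.arr (Function.update s.var 3 0) := by
      rw [hs₁]; simp [Cmd.den]
    rw [h4]
    exact this.2
  have hctx₁ : Ctx G H q s₁ :=
    Ctx_congr hs (fun x h3 h4 _ => hv₁ x h3 h4) (fun a _ => by rw [ha₁])
  -- branch sets without free neighbours are discarded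
  obtain ⟨hv₂, ha₂, hf₁, hf₀⟩ := den_retire hctx₁ hN
  obtain ⟨s₂, hs₂⟩ : ∃ s₂, s₂ = retire.den N s₁ := ⟨_, rfl⟩
  rw [← hs₂] at hv₂ ha₂ hf₁ hf₀
  rw [ha₁] at hf₁ hf₀
  obtain ⟨hI₂, hR₂, hD₂, hE₂, hnear, hsame⟩ := hI.retire hP hf₁ hf₀
  have hctx₂ : Ctx G H q s₂ := Ctx_congr hctx₁ (fun x _ _ _ => by rw [hv₂]) ha₂
  have hbig₂ : ∀ c ∈ cls n (s₂.arr 2) 0, (cls n (s₂.arr 2) 0).card <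
      2 * ((growStep (natGraph G) (cls n (s₂.arr 2) 0) q)^[N] {c}).card := by
    rw [hR₂]; exact hbig
  -- the root
  obtain ⟨s₃, hs₃⟩ : ∃ s₃, s₃ = (Cmd.assign 5 (least 10 11 free)).den N s₂ := ⟨_, rfl⟩
  have ha₃ : s₃.arr = s₂.arr := by rw [hs₃]; rfl
  have hv₃ : ∀ x, x ≠ 5 → s₃.var x = s₂.var x := by
    intro x h5; rw [hs₃]; simp [Cmd.den, h5]
  have hr : s₃.var 5 ∈ cls n (s₂.arr 2) 0 := by
    have := val_least (N := N) (A := s₂.arr) (v := s₂.var) (x := 10) (y := 11)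
      (e := free) (P := fun u => u ∈ cls n (s₂.arr 2) 0)
      (fun i => by rw [holds_free (n := n) (by simp [hctx₂.var0])]; simp)
      (fun i j => by rw [holds_free (n := n) (by simp [hctx₂.var0])]; simp)
      (by decide)
      (by
        obtain ⟨u, hu⟩ := hI₂.exists_free hP
        exact ⟨u, (mem_cls.1 hu).1.trans_le hN, hu⟩)
    have h5 : s₃.var 5 = (least 10 11 free).val N s₂.arr s₂.var := by
      rw [hs₃]; simp [Cmd.den]
    rw [h5]
    exact this.2
  have hctx₃ : Ctx G H q s₃ := Ctx_congr hctx₂ (fun x _ _ h5 => hv₃ x h5) (fun a _ => by rw [ha₃])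
  -- the search tree
  obtain ⟨s₄, hs₄⟩ : ∃ s₄, s₄ =
    (Cmd.fill 8 10 (.ite (eq (var 10) (var 5)) (.add (var 10) (const 1)) (const 0))).den N s₃ :=
    ⟨_, rfl⟩
  have hv₄ : s₄.var = s₃.var := by rw [hs₄]; rfl
  have ha₄ : ∀ a < 6, s₄.arr a = s₂.arr a := fun a ha => by
    rw [hs₄, den_fill_of_ne (by omega), ha₃]
  have h8₄ : ∀ v < N, s₄.arr 8 v = if v = s₃.var 5 then v + 1 else 0 := by
    intro v hv
    rw [hs₄, den_fill_of_lt hv]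
    simp
  have hctx₄ : Ctx G H q s₄ := Ctx_congr hctx₃ (fun x _ _ h5 => by rw [hv₄])
    (fun a ha => by rw [ha₄ a (by omega), ha₃])
  obtain ⟨hv₅, ha₅, hsearch, h0⟩ := den_rep_search hctx₄ hN (r := s₃.var 5)
    (by rw [ha₄ 2 (by omega)]; exact hr) h8₄ N
  obtain ⟨s₅, hs₅⟩ : ∃ s₅, s₅ = (Cmd.rep search).den N s₄ := ⟨_, rfl⟩
  rw [← den_rep, ← hs₅] at hv₅ ha₅ hsearch h0
  rw [ha₄ 2 (by omega)] at hsearch h0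
  have hctx₅ : Ctx G H q s₅ := Ctx_congr hctx₄ (fun x _ _ h5 => by rw [hv₅])
    (fun a ha => ha₅ a (by omega))
  have ha₅2 : s₅.arr 2 = s₂.arr 2 := by rw [ha₅ 2 (by omega), ha₄ 2 (by omega)]
  -- the marked vertices
  obtain ⟨s₆, hs₆⟩ : ∃ s₆, s₆ = markEnds.den N s₅ := ⟨_, rfl⟩
  have hv₆ : s₆.var = s₅.var := by rw [hs₆]; rfl
  have ha₆ : ∀ a, a ≠ 9 → s₆.arr a = s₅.arr a := fun a ha => by
    rw [hs₆, markEnds, den_fill_of_ne ha]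
  have hlN : l ≤ N := hP.l_le.trans hN
  have hball : ∀ z ∈ cls n (s₂.arr 2) 0, z ∈ ball (natGraph G) (cls n (s₂.arr 2) 0) (s₃.var 5) l :=
    fun z hz => hP.mem_ball hbig₂ hr hz
  obtain ⟨x, hxdef⟩ : ∃ x, x = s₁.var 4 := ⟨_, rfl⟩
  have hx5 : s₅.var 4 = x := by
    rw [hv₅, hv₄, hv₃ 4 (by decide), hv₂, hxdef]
  have hr5 : s₅.var 5 = s₃.var 5 := by rw [hv₅, hv₄]
  have h9₆ : ∀ v < N, s₆.arr 9 v ≠ 0 ↔ v = s₃.var 5 ∨ ∃ y < h, (natGraph H).Adj x y ∧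
      IsLeast {z | Attached (natGraph G) n (s₂.arr 2) y z} v := by
    intro v hv
    rw [hs₆, den_markEnds hctx₅ hN hN' hv, hx5, hr5, ha₅2]
  rw [← ha₆ 8 (by decide)] at hsearch
  obtain ⟨hv₇, ha₇, h9₇⟩ := den_rep_markParents
    (cls_subset_range.trans (Finset.range_mono hN)) hsearch hr
    (fun z hz => by
      obtain ⟨y, hy, hxy, hz⟩ := hz
      exact ball_mono hlN (hball z hz.1.1)) h9₆ N
  obtain ⟨s₇, hs₇⟩ : ∃ s₇, s₇ = (Cmd.rep markParents).den N s₆ := ⟨_, rfl⟩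
  rw [← den_rep, ← hs₇] at hv₇ ha₇ h9₇
  have hpar := hsearch.isParent
  -- the new branch set
  set S := (Finset.range n).filter fun v => s₇.arr 9 v ≠ 0 with hSdef
  have hSmem : ∀ v, v ∈ S ↔ v = s₃.var 5 ∨ ∃ z, (∃ y < h, (natGraph H).Adj x y ∧
      IsLeast {z | Attached (natGraph G) n (s₂.arr 2) y z} z) ∧
        ∃ j, v = (fun v => s₆.arr 8 v - 1)^[j] z := by
    intro v
    have hzN : ∀ z, (∃ y < h, (natGraph H).Adj x y ∧
        IsLeast {z | Attached (natGraph G) n (s₂.arr 2) y z} z) →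
        z ∈ ball (natGraph G) (cls n (s₂.arr 2) 0) (s₃.var 5) N := by
      rintro z ⟨y, hy, hxy, hz⟩
      exact ball_mono hlN (hball z hz.1.1)
    rw [hSdef, Finset.mem_filter, Finset.mem_range]
    constructor
    · rintro ⟨hv, h1⟩
      rcases (h9₇ v (by omega)).1 h1 with h1 | ⟨z, hz, j, -, h1⟩
      · exact .inl h1
      · exact .inr ⟨z, hz, j, h1⟩
    · intro h1
      have h2 : v = s₃.var 5 ∨ ∃ z, (∃ y < h, (natGraph H).Adj x y ∧
          IsLeast {z | Attached (natGraph G) n (s₂.arr 2) y z} z) ∧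
          ∃ j ≤ N, v = (fun v => s₆.arr 8 v - 1)^[j] z := by
        rcases h1 with h1 | ⟨z, hz, j, h1⟩
        · exact .inl h1
        · rcases le_total j N with hj | hj
          · exact .inr ⟨z, hz, j, hj, h1⟩
          · left
            rw [h1, hpar.iterate_eq_root le_rfl (hzN z hz) hj]
      have hvR : v ∈ cls n (s₂.arr 2) 0 := by
        rcases h1 with rfl | ⟨z, hz, j, rfl⟩
        · exact hr
        · exact ball_subset hr (hpar.iterate_mem_ball (hzN z hz) j)
      have hvn := (mem_cls.1 hvR).1
      exact ⟨hvn, (h9₇ v (by omega)).2 h2⟩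
  obtain ⟨hlink, hcard, hSR, hadj⟩ := branch_of_paths hr hpar hlN hball hnear hSmem
  obtain ⟨s₈, hs₈⟩ : ∃ s₈, s₈ = (Cmd.seq
    (.fill 7 10 (.ite (get 9 (var 10)) (.add (var 4) (const 1)) (get 2 (var 10))))
    (.fill 2 10 (get 7 (var 10)))).den N s₇ := ⟨_, rfl⟩
  have hfinal : embed.den N s = s₈ := by
    rw [hs₈, hs₇, hs₆, hs₅, hs₄, hs₃, hs₂, hs₁]
    rfl
  rw [hfinal]
  have hv₈ : s₈.var = s₅.var := by rw [hs₈, den_fill_copy_var, hv₇, hv₆]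
  have ha₈ : ∀ a < 2, s₈.arr a = s₅.arr a := by
    intro a ha
    rw [hs₈, den_fill_copy_of_ne (by omega) (by omega), ha₇ a (by omega) (by omega),
      ha₆ a (by omega)]
  have hf₈ : ∀ v < n, s₈.arr 2 v = if v ∈ S then x + 1 else s₂.arr 2 v := by
    intro v hv
    have hvS : v ∈ S ↔ s₇.arr 9 v ≠ 0 := by
      rw [hSdef, Finset.mem_filter, Finset.mem_range]
      exact and_iff_right hv
    rw [hs₈, den_fill_copy (hv.trans_le hN), val_ite]
    simp only [holds_get, val_var, Function.update_self, ← hvS, val_add, val_const, val_get]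
    rw [Function.update_of_ne (by decide), hv₇, hv₆, hx5, ha₇ 2 (by decide) (by decide),
      ha₆ 2 (by decide), ha₅2]
  rw [← hxdef] at hx
  obtain ⟨hI₈, hD₈, hX₈, hO₈⟩ := hI₂.embed hx.1 (hE₂ x hx.1 hx.2) hSR hlink hcard hadj hf₈
  refine ⟨Ctx_congr hctx₅ (fun x _ _ _ => by rw [hv₈]) ha₈, ?_, hI₈, ?_⟩
  · rw [hv₈, hv₅, hv₄, hv₃ 3 (by decide), hv₂, hv₁3]
  · rw [hD₈]
    rcases hD₂.lt_or_eq with hlt | heq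
    · exact .inl hlt
    · right
      refine ⟨heq, ?_⟩
      have hsub := hsame heq
      refine Finset.card_lt_card (Finset.ssubset_iff.2 ⟨x, ?_, ?_⟩)
      · simp [hx.2]
      · intro u hu
        rcases Finset.mem_insert.1 hu with rfl | hu
        · refine Finset.mem_filter.2 ⟨Finset.mem_range.2 hx.1, ?_⟩
          rw [hX₈]
          exact ⟨s₃.var 5, (hSmem _).2 (.inl rfl)⟩
        · obtain ⟨hu, hune⟩ := Finset.mem_filter.1 hu
          have hux : u ≠ x := by rintro rfl; simp [hx.2] at hune
          have huh := Finset.mem_range.1 hu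
          refine Finset.mem_filter.2 ⟨hu, ?_⟩
          rw [hO₈ u huh hux, hsub u huh]
          exact hune

end Algorithm

end RAM

/-! ### The main loop and the output -/

namespace RAM

namespace Algorithm

open Term Cmd

variable {n h q N : ℕ} {G : SimpleGraph (Fin n)} {H : SimpleGraph (Fin h)} {s : State}

/-- The invariant of the main loop: all free vertices before the vertex in the variable `3` have
been tested and grow large sets. -/
structure LoopInv (G : SimpleGraph (Fin n)) (H : SimpleGraph (Fin h)) (q l N : ℕ) (s : State) :
    Prop where
  ctx : Ctx G H q s
  model : PartialModel (natGraph G) (natGraph H) n h q l (s.arr 2)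
  le : s.var 3 ≤ n
  big : ∀ c < s.var 3, c ∈ cls n (s.arr 2) 0 → Big (natGraph G) n q N (s.arr 2) c

/-- The progress measure of the main loop: lexicographically, the number of discarded vertices, the
number of embedded vertices, and the number of tested vertices. -/
noncomputable def progress (n h : ℕ) (s : State) : ℕ :=
  (cls n (s.arr 2) (h + 1)).card * ((h + 1) * (n + 1)) + embedded n h (s.arr 2) * (n + 1) + s.var 3

theorem embedded_le (f : ℕ → ℕ) : embedded n h f ≤ h :=
  (Finset.card_filter_le _ _).trans (by simp)

theorem progress_lt_of_discard {s s' : State} (h3 : s.var 3 ≤ n)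
    (hD : (cls n (s.arr 2) (h + 1)).card < (cls n (s'.arr 2) (h + 1)).card) :
    progress n h s < progress n h s' := by
  have h1 := embedded_le (n := n) (h := h) (s.arr 2)
  have h2 : ((cls n (s.arr 2) (h + 1)).card + 1) * ((h + 1) * (n + 1)) ≤
      (cls n (s'.arr 2) (h + 1)).card * ((h + 1) * (n + 1)) := Nat.mul_le_mul_right _ hD
  have h4 := Nat.mul_le_mul_right (n + 1) h1
  simp only [progress]
  nlinarith

/-- A step keeps the invariant, and makes progress until every vertex of `H` has a branch set. -/
theorem den_step {l M : ℕ} (hN : n ≤ N) (hN' : h ≤ N)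
    (hP : Params (natGraph G) (natGraph H) n h q l M) (hs : LoopInv G H q l N s) :
    LoopInv G H q l N (step.den N s) ∧
      ((∀ u < h, (cls n (s.arr 2) (u + 1)).Nonempty) ∧ step.den N s = s ∨
        ¬ (∀ u < h, (cls n (s.arr 2) (u + 1)).Nonempty) ∧
          progress n h s < progress n h (step.den N s)) := by
  have hmiss : (ex 10 (missing 10)).Holds N s.arr s.var ↔
      ∃ u < h, cls n (s.arr 2) (u + 1) = ∅ := by
    have h1 : ∀ i, (missing 10).Holds N s.arr (Function.update s.var 10 i) ↔
        i < h ∧ cls n (s.arr 2) (i + 1) = ∅ := by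
      intro i
      rw [holds_missing (n := n) (h := h) (by simp [hs.ctx.var0]) (by simp [hs.ctx.var1]) hN
        (by decide)]
      simp
    simp only [holds_ex, h1]
    constructor
    · rintro ⟨i, -, h2, h3⟩
      exact ⟨i, h2, h3⟩
    · rintro ⟨i, h2, h3⟩
      exact ⟨i, by omega, h2, h3⟩
  rw [step, den_ite]
  split_ifs with hc <;> rw [hmiss] at hc
  swap
  · refine ⟨hs, .inl ⟨fun u hu => ?_, rfl⟩⟩
    rw [Finset.nonempty_iff_ne_empty]
    exact fun he => hc ⟨u, hu, he⟩
  have hnot : ¬ ∀ u < h, (cls n (s.arr 2) (u + 1)).Nonempty := by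
    obtain ⟨u, hu, hue⟩ := hc
    exact fun hall => (hall u hu).ne_empty hue
  rw [den_ite]
  split_ifs with hlt <;> simp only [holds_lt, val_var, hs.ctx.var0] at hlt
  · obtain ⟨h1, h2 | h2⟩ := den_testVertex hs.ctx hN hlt hs.model hP
    · obtain ⟨h2, h3, h4⟩ := h2
      refine ⟨⟨h1, by rw [h2]; exact hs.model, by omega, ?_⟩, .inr ⟨hnot, ?_⟩⟩
      · rw [h2, h3]
        intro c hc hcR
        rcases Nat.lt_succ_iff_lt_or_eq.1 hc with hc | rfl
        · exact hs.big c hc hcR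
        · exact h4 (mem_cls.1 hcR).2
      · simp only [progress]
        rw [h2, h3]
        omega
    · obtain ⟨h2, h3, h4⟩ := h2
      refine ⟨⟨h1, h3, by omega, ?_⟩, .inr ⟨hnot, progress_lt_of_discard hs.le h4⟩⟩
      intro c hc
      omega
  · obtain ⟨h1, h2, h3, h4⟩ := den_embed hs.ctx hN hN' hs.model hP
      (fun c hcR => hs.big c ((mem_cls.1 hcR).1.trans_le (by omega)) hcR) hc
    refine ⟨⟨h1, h3, by omega, ?_⟩, .inr ⟨hnot, ?_⟩⟩
    · intro c hc
      omega
    · rcases h4 with h4 | ⟨h4, h5⟩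
      · exact progress_lt_of_discard hs.le h4
      · simp only [progress]
        rw [h2, ← h4]
        have := Nat.mul_le_mul_right (n + 1) (Nat.succ_le_of_lt h5)
        have := hs.le
        rw [Nat.succ_mul] at *
        omega

theorem progress_lt (h3 : s.var 3 ≤ n) : progress n h s < (n + 1) * ((h + 1) * (n + 1)) := by
  have h1 := embedded_le (n := n) (h := h) (s.arr 2)
  have h2 := Finset.card_le_card (cls_subset_range (n := n) (f := s.arr 2) (k := h + 1))
  rw [Finset.card_range] at h2
  have h4 := Nat.mul_le_mul_right (n + 1) h1
  have h5 := Nat.mul_le_mul_right ((h + 1) * (n + 1)) h2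
  simp only [progress]
  nlinarith

/-- The progress is bounded by the number of steps, so all vertices of `H` are embedded at the
end. -/
theorem den_loop {l M : ℕ} (hN : n ≤ N) (hN' : h ≤ N)
    (hP : Params (natGraph G) (natGraph H) n h q l M)
    (hbound : (n + 1) * ((h + 1) * (n + 1)) ≤ N * N) (hs : LoopInv G H q l N s) :
    LoopInv G H q l N ((Cmd.rep (.rep step)).den N s) ∧
      ∀ u < h, (cls n (((Cmd.rep (.rep step)).den N s).arr 2) (u + 1)).Nonempty := by
  have key : ∀ k, LoopInv G H q l N ((step.den N)^[k] s) ∧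
      ((∀ u < h, (cls n (((step.den N)^[k] s).arr 2) (u + 1)).Nonempty) ∨
        k ≤ progress n h ((step.den N)^[k] s)) := by
    intro k
    induction k with
    | zero => exact ⟨hs, .inr (Nat.zero_le _)⟩
    | succ k ih =>
      obtain ⟨h1, h2⟩ := ih
      rw [Function.iterate_succ_apply']
      obtain ⟨h3, h4⟩ := den_step hN hN' hP h1
      refine ⟨h3, ?_⟩
      rcases h4 with ⟨h4, h5⟩ | h4
      · rw [h5]; exact .inl h4
      · rcases h2 with h2 | h2
        · exact absurd h2 h4.1
        · exact .inr (by omega)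
  have heq : (Cmd.rep (.rep step)).den N s = (step.den N)^[N * N] s := by
    rw [Function.iterate_mul]
    rfl
  rw [heq]
  obtain ⟨h1, h2⟩ := key (N * N)
  refine ⟨h1, h2.resolve_right fun h3 => ?_⟩
  have := progress_lt (h := h) h1.le
  omega

theorem den_setParameters (h0 : s.var 0 = n) (h1 : s.var 1 = h) (hH : s.arr 1 = adjArray H)
    (hN' : h ≤ N) (hN : n < N) :
    (setParameters.den N s).arr = s.arr ∧
    (∀ x < 6, (setParameters.den N s).var x = s.var x) ∧
    ∃ m, m = h + ∑ u ∈ Finset.range h, degIn (natGraph H) h u ∧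
      (0 < m → m * (setParameters.den N s).var 6 ^ 2 ≤ n ∧
        n < m * ((setParameters.den N s).var 6 + 1) ^ 2) := by
  classical
  refine ⟨rfl, fun x hx => ?_, _, rfl, fun hm => ?_⟩
  · simp [setParameters, Cmd.den, show x ≠ 6 by omega, show x ≠ 7 by omega]
  set m := h + ∑ u ∈ Finset.range h, degIn (natGraph H) h u with hmdef
  obtain ⟨s₁, hs₁⟩ : ∃ s₁, s₁ =
    (Cmd.assign 7 (.add (.var 1) (.sum 10 (count 11 (adjH 10 11))))).den N s := ⟨_, rfl⟩
  have hv₁ : ∀ x, x ≠ 7 → s₁.var x = s.var x := by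
    intro x hx; rw [hs₁]; simp [Cmd.den, hx]
  have h7 : s₁.var 7 = m := by
    rw [hs₁]
    simp only [Cmd.den, Function.update_self, val_add, val_var, val_sum, val_count, h1]
    rw [hmdef]
    congr 1
    have hdeg : ∀ i, ((Finset.range N).filter fun j => (adjH 10 11).Holds N s.arr
        (Function.update (Function.update s.var 10 i) 11 j)).card =
          if i < h then degIn (natGraph H) h i else 0 := by
      intro i
      have hiff : ∀ j, (adjH 10 11).Holds N s.arr
          (Function.update (Function.update s.var 10 i) 11 j) ↔ (natGraph H).Adj i j := by
        intro j
        rw [holds_adjH hH (by simp [h1]) hN' (by decide)]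
        simp
      simp only [hiff]
      split_ifs with hi
      · rw [degIn]
        congr 1
        ext j
        simp only [Finset.mem_filter, Finset.mem_range]
        constructor
        · rintro ⟨-, hj⟩; exact ⟨(natGraph_lt hj).2, hj⟩
        · rintro ⟨hj, hj'⟩; exact ⟨by omega, hj'⟩
      · rw [Finset.card_eq_zero, Finset.filter_eq_empty_iff]
        intro j _ hj
        exact hi (natGraph_lt hj).1
    simp only [hdeg]
    rw [← Finset.sum_filter]
    congr 1
    ext i
    simp only [Finset.mem_filter, Finset.mem_range]
    omega
  have hsq : ∀ i < N, (Term.sum 11 (.sum 12 (.ite (and (le (var 11) (var 10))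
      (le (var 12) (var 10))) (var 7) (const 0)))).val N s₁.arr (Function.update s₁.var 10 i) =
        m * (i + 1) ^ 2 := by
    intro i hi
    simp only [val_sum, val_ite, holds_and, holds_le, val_var, val_const, Function.update_self,
      ne_eq, Nat.reduceEqDiff, not_false_eq_true, Function.update_of_ne, h7]
    have hfil : ∀ c : ℕ, ∑ b ∈ Finset.range N, (if b ≤ i then c else 0) = (i + 1) * c := by
      intro c
      rw [← Finset.sum_filter, Finset.sum_const, smul_eq_mul]
      congr 1
      rw [show (Finset.range N).filter (fun b => b ≤ i) = Finset.range (i + 1) by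
        ext b; simp only [Finset.mem_filter, Finset.mem_range]; omega, Finset.card_range]
    have hin : ∀ a, (∑ b ∈ Finset.range N, if a ≤ i ∧ b ≤ i then m else 0) =
        if a ≤ i then (i + 1) * m else 0 := by
      intro a
      split_ifs with ha
      · simp only [ha, true_and]; exact hfil m
      · simp [ha]
    simp only [hin, hfil]
    ring
  have h6 : (setParameters.den N s).var 6 =
      ((Finset.range N).filter fun i => m * (i + 1) ^ 2 ≤ n).card := by
    rw [setParameters, den_seq, ← hs₁]
    simp only [Cmd.den, Function.update_self, val_count]
    congr 1
    ext i
    simp only [Finset.mem_filter, Finset.mem_range]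
    refine and_congr_right fun hi => ?_
    rw [holds_le, hsq i hi]
    simp [hv₁, h0]
  -- the values with `m * (i + 1) ^ 2 ≤ n` form an initial segment, so their number is `⌊√(n / m)⌋`
  have hmono : ∀ a b : ℕ, a ≤ b → m * (a + 1) ^ 2 ≤ m * (b + 1) ^ 2 := fun a b hab => by gcongr
  obtain ⟨k, hk1, hk2⟩ : ∃ k, m * k ^ 2 ≤ n ∧ n < m * (k + 1) ^ 2 := by
    have hex : ∃ k, n < m * (k + 1) ^ 2 := ⟨n, by nlinarith⟩
    refine ⟨Nat.find hex, ?_, Nat.find_spec hex⟩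
    rcases Nat.eq_zero_or_pos (Nat.find hex) with h0 | h0
    · rw [h0]; simp
    · obtain ⟨j, hj⟩ : ∃ j, Nat.find hex = j + 1 := ⟨Nat.find hex - 1, by omega⟩
      have := Nat.find_min hex (m := j) (by omega)
      rw [hj]
      omega
  have hkn : k ≤ n := by nlinarith
  have hcard : (setParameters.den N s).var 6 = k := by
    rw [h6, show (Finset.range N).filter (fun i => m * (i + 1) ^ 2 ≤ n) = Finset.range k from ?_,
      Finset.card_range]
    ext i
    simp only [Finset.mem_filter, Finset.mem_range]
    constructor
    · rintro ⟨-, hi⟩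
      by_contra hki
      have := hmono k i (by omega)
      omega
    · intro hi
      obtain ⟨j, rfl⟩ := Nat.exists_eq_add_of_le' (show 1 ≤ k by omega)
      have := hmono i j (by omega)
      exact ⟨by omega, by omega⟩
  rw [hcard]
  exact ⟨hk1, hk2⟩

/-- The output for an embedded graph: the position `u * h + w` of the arrays `3` and `4` describes a
segment of two entries of the array `5`, which holds the edge chosen for the pair `u`, `w`. -/
theorem den_output (hs : Ctx G H q s) (hN : n ≤ N) (hN' : 2 * (h * h) ≤ N) {u w : ℕ} (hu : u < h)
    (hw : w < h) (hedge : ∃ a ∈ cls n (s.arr 2) (u + 1), ∃ b ∈ cls n (s.arr 2) (w + 1),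
      (natGraph G).Adj a b) :
    ∃ a ∈ cls n (s.arr 2) (u + 1), ∃ b ∈ cls n (s.arr 2) (w + 1), (natGraph G).Adj a b ∧
      (List.range (((Cmd.seq findEdges writePaths).den N s).arr 4 (u * h + w))).map
        (fun k => ((Cmd.seq findEdges writePaths).den N s).arr 5
          (((Cmd.seq findEdges writePaths).den N s).arr 3 (u * h + w) + k)) = [a, b] := by
  have hp : u * h + w < h * h := by nlinarith
  set p := u * h + w with hpdef
  have hhN : h ≤ N := by nlinarith
  have hdec : ∀ u' w', u' < h → w' < h → p = u' * h + w' → u' = u ∧ w' = w := by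
    intro u' w' hu' hw' he
    have h1 : u = u' := by
      have := congrArg (· / h) (hpdef.symm.trans he)
      simpa [Nat.mul_comm _ h, Nat.mul_add_div (show 0 < h by omega), Nat.div_eq_of_lt hw,
        Nat.div_eq_of_lt hw'] using this
    subst h1
    exact ⟨rfl, by omega⟩
  have hpair : ∀ P : ℕ → ℕ → Prop,
      (∃ i < N, ∃ j < N, j < h ∧ i < h ∧ p = i * h + j ∧ P i j) ↔ P u w := by
    intro P
    constructor
    · rintro ⟨i, -, j, -, hj, hi, he, hPij⟩
      obtain ⟨rfl, rfl⟩ := hdec i j hi hj he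
      exact hPij
    · intro hPuw
      exact ⟨u, by omega, w, by omega, hw, hu, rfl, hPuw⟩
  -- decoding of the pair `u`, `w`
  have hpick : ∀ (A : ℕ → ℕ → ℕ) (e : ℕ → Term) (P : ℕ → Prop),
      (∀ x i v, x = 13 ∨ x = 14 → v 0 = n → v 1 = h → v 10 = p → v 11 = u → v 12 = w →
        v x = i → ((e x).Holds N A v ↔ P i)) → (∃ i < N, P i) →
      P ((least 13 14 fun a => ex 11 (ex 12 (and (lt (var 12) (var 1)) (and (lt (var 11) (var 1))
        (and (eq (.var 10) (.add (mul 11 1) (var 12))) (e a)))))).val N A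
          (Function.update s.var 10 p)) := by
    intro A e P he hex
    have hholds : ∀ (x i : ℕ) (v : ℕ → ℕ), x = 13 ∨ x = 14 → v 0 = n → v 1 = h → v 10 = p →
        v x = i → ((ex 11 (ex 12 (and (lt (var 12) (var 1)) (and (lt (var 11) (var 1))
        (and (eq (.var 10) (.add (mul 11 1) (var 12))) (e x)))))).Holds N A v ↔ P i) := by
      intro x i v hx hv0 hv1 hv10 hvx
      rw [← hpair fun _ _ => P i]
      simp only [holds_ex, holds_and, holds_lt, holds_eq, val_var, val_add]
      refine exists_congr fun u' => and_congr_right fun hu'N => exists_congr fun w' =>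
        and_congr_right fun hw'N => ?_
      rw [val_mul (by decide) (by decide) (by simpa using hu'N.le)]
      simp only [Function.update_self, ne_eq, Nat.reduceEqDiff, not_false_eq_true,
        Function.update_of_ne, hv1, hv10, OfNat.one_ne_ofNat]
      refine and_congr_right fun hw' => and_congr_right fun hu' => and_congr_right fun he' => ?_
      obtain ⟨rfl, rfl⟩ := hdec u' w' hu' hw' he'
      apply he x i _ hx
      · simpa using hv0
      · simpa using hv1
      · simpa using hv10
      · simp
      · simp
      · rw [Function.update_of_ne (by omega), Function.update_of_ne (by omega), hvx]
    refine (val_least (P := P) (fun i => ?_) (fun i j => ?_) (by decide) hex).2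
    · exact hholds 13 i _ (.inl rfl) (by simp [hs.var0]) (by simp [hs.var1]) (by simp) (by simp)
    · exact hholds 14 j _ (.inr rfl) (by simp [hs.var0]) (by simp [hs.var1]) (by simp) (by simp)
  obtain ⟨s₁, hs₁⟩ : ∃ s₁, s₁ = (Cmd.fill 10 10 (least 13 14 fun a => ex 11 (ex 12
      (and (lt (var 12) (var 1)) (and (lt (var 11) (var 1))
      (and (eq (.var 10) (.add (mul 11 1) (var 12)))
        (and (eq (get 2 (var a)) (.add (var 11) (const 1)))
          (ex 15 (and (adjG a 15) (eq (get 2 (var 15)) (.add (var 12) (const 1)))))))))))).den N s :=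
    ⟨_, rfl⟩
  obtain ⟨a, ha⟩ : ∃ a, a = s₁.arr 10 p := ⟨_, rfl⟩
  have ha₁ : ∀ i, i ≠ 10 → s₁.arr i = s.arr i := fun i hi => by rw [hs₁, den_fill_of_ne hi]
  have haP : a ∈ cls n (s.arr 2) (u + 1) ∧ ∃ b ∈ cls n (s.arr 2) (w + 1),
      (natGraph G).Adj a b := by
    rw [ha, hs₁, den_fill_of_lt (by omega)]
    refine hpick s.arr (fun a => and (eq (get 2 (var a)) (.add (var 11) (const 1)))
          (ex 15 (and (adjG a 15) (eq (get 2 (var 15)) (.add (var 12) (const 1))))))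
        (fun a => a ∈ cls n (s.arr 2) (u + 1) ∧ ∃ b ∈ cls n (s.arr 2) (w + 1),
          (natGraph G).Adj a b) ?_ ?_
    · intro x i v hx hv0 hv1 _ hv11 hv12 hvx
      have hadj : ∀ j, (adjG x 15).Holds N s.arr (Function.update v 15 j) ↔
          (natGraph G).Adj i j := by
        intro j
        rw [holds_adjG hs.arr0 (by simp [hv0]) hN (by omega), Function.update_of_ne (by omega),
          Function.update_self, hvx]
      simp only [holds_and, holds_eq, holds_ex, val_get, val_var, val_add, val_const, hadj, hvx,
        hv11, Function.update_self, ne_eq, Nat.reduceEqDiff, not_false_eq_true, Function.update_of_ne,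
        hv12, mem_cls]
      constructor
      · rintro ⟨h1, j, -, h2, h3⟩
        exact ⟨⟨(natGraph_lt h2).1, h1⟩, j, ⟨(natGraph_lt h2).2, h3⟩, h2⟩
      · rintro ⟨⟨h0, h1⟩, j, ⟨h2, h3⟩, h4⟩
        exact ⟨h1, j, by omega, h4, h3⟩
    · obtain ⟨a, ha, hb⟩ := hedge
      exact ⟨a, (mem_cls.1 ha).1.trans_le hN, ha, hb⟩
  obtain ⟨s₂, hs₂⟩ : ∃ s₂, s₂ = findEdges.den N s := ⟨_, rfl⟩
  obtain ⟨b, hb⟩ : ∃ b, b = s₂.arr 11 p := ⟨_, rfl⟩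
  have ha₂ : ∀ i, i ≠ 11 → s₂.arr i = s₁.arr i := fun i hi => by
    rw [hs₂, findEdges, den_seq, ← hs₁, den_fill_of_ne hi]
  have hv₁ : s₁.var = s.var := by rw [hs₁]; rfl
  have hbP : b ∈ cls n (s.arr 2) (w + 1) ∧ (natGraph G).Adj a b := by
    rw [hb, hs₂, findEdges, den_seq, ← hs₁, den_fill_of_lt (by omega), hv₁]
    refine hpick s₁.arr (fun a => and (eq (get 2 (var a)) (.add (var 12) (const 1)))
          (ex 15 (and (eq (var 15) (get 10 (var 10))) (adjG 15 a))))
        (fun b => b ∈ cls n (s.arr 2) (w + 1) ∧ (natGraph G).Adj a b) ?_ ?_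
    · intro x i v hx hv0 hv1 hv10 hv11 hv12 hvx
      have hadj : ∀ j, (adjG 15 x).Holds N s₁.arr (Function.update v 15 j) ↔
          (natGraph G).Adj j i := by
        intro j
        rw [holds_adjG (by rw [ha₁ 0 (by decide), hs.arr0]) (by simp [hv0]) hN (by omega),
          Function.update_of_ne (by omega : x ≠ 15), Function.update_self, hvx]
      simp only [holds_and, holds_eq, holds_ex, val_get, val_var, val_add, val_const, hadj, hvx,
        Function.update_self, ne_eq, Nat.reduceEqDiff, not_false_eq_true, Function.update_of_ne,
        hv12, hv10, mem_cls, ha₁ 2 (by decide), ← ha]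
      constructor
      · rintro ⟨h1, j, -, rfl, h3⟩
        exact ⟨⟨(natGraph_lt h3).2, h1⟩, h3⟩
      · rintro ⟨⟨h0, h1⟩, h2⟩
        have := (natGraph_lt h2).1
        exact ⟨h1, a, by omega, rfl, h2⟩
    · obtain ⟨b, hb, hab⟩ := haP.2
      exact ⟨b, (mem_cls.1 hb).1.trans_le hN, hb, hab⟩
  have ha' : s₂.arr 10 p = a := by rw [ha₂ 10 (by decide), ha]
  refine ⟨a, haP.1, b, hbP.1, hbP.2, ?_⟩
  rw [den_seq, ← hs₂, writePaths, den_seq, den_seq]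
  generalize hs₃ : (Cmd.fill 3 10 (.add (var 10) (var 10))).den N s₂ = s₃
  generalize hs₄ : (Cmd.fill 4 10 (const 2)).den N s₃ = s₄
  have h3 : s₄.arr 3 p = p + p := by
    rw [← hs₄, den_fill_of_ne (by decide), ← hs₃, den_fill_of_lt (by omega)]
    simp
  have h4 : s₄.arr 4 p = 2 := by
    rw [← hs₄, den_fill_of_lt (by omega)]
    simp
  have h10 : s₄.arr 10 = s₂.arr 10 := by
    rw [← hs₄, den_fill_of_ne (by decide), ← hs₃, den_fill_of_ne (by decide)]
  have h11 : s₄.arr 11 = s₂.arr 11 := by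
    rw [← hs₄, den_fill_of_ne (by decide), ← hs₃, den_fill_of_ne (by decide)]
  rw [den_fill_of_ne (show 3 ≠ 5 by decide), den_fill_of_ne (show 4 ≠ 5 by decide), h3, h4]
  have hsum : ∀ (g : ℕ → ℕ) (t : ℕ),
      (∑ i ∈ Finset.range N, if p + p + t = i + i + t then g i else 0) =
      g p := by
    intro g t
    rw [Finset.sum_eq_single_of_mem p (Finset.mem_range.2 (by omega))]
    · simp
    · intro i _ hi
      rw [if_neg (by omega)]
  have h50 : ∀ t : ℕ, p + p + t < N → ((Cmd.fill 5 10 (.add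
      (.sum 11 (.ite (eq (var 10) (.add (var 11) (var 11))) (get 10 (var 11)) (const 0)))
      (.sum 11 (.ite (eq (var 10) (.add (.add (var 11) (var 11)) (const 1))) (get 11 (var 11))
        (const 0))))).den N s₄).arr 5 (p + p + t) =
      (∑ i ∈ Finset.range N, if p + p + t = i + i then s₂.arr 10 i else 0) +
      ∑ i ∈ Finset.range N, if p + p + t = i + i + 1 then s₂.arr 11 i else 0 := by
    intro t ht
    rw [den_fill_of_lt ht]
    simp [h10, h11]
  rw [show List.range 2 = [0, 1] from rfl, List.map_cons, List.map_cons, List.map_nil,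
    h50 0 (by omega), h50 1 (by omega)]
  have hz0 : (∑ i ∈ Finset.range N, if p + p + 0 = i + i + 1 then s₂.arr 11 i else 0) = 0 :=
    Finset.sum_eq_zero fun i _ => if_neg (by omega)
  have hz1 : (∑ i ∈ Finset.range N, if p + p + 1 = i + i then s₂.arr 10 i else 0) = 0 :=
    Finset.sum_eq_zero fun i _ => if_neg (by omega)
  have hs0 := hsum (s₂.arr 10) 0
  simp only [Nat.add_zero] at hs0 hz0 ⊢
  rw [hs0, hz0, hz1, hsum, ha', ← hb, Nat.add_zero, Nat.zero_add]

end Algorithm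

end RAM

/-! ### The numerical parameters for an expander -/

theorem natGraph_degIn {h : ℕ} (H : SimpleGraph (Fin h)) :
    h + ∑ u ∈ Finset.range h, degIn (natGraph H) h u ≤ 2 * graphSize H := by
  classical
  have h1 : ∑ u ∈ Finset.range h, degIn (natGraph H) h u = ∑ v : Fin h, H.degree v := by
    rw [Finset.sum_range]
    refine Finset.sum_congr rfl fun v _ => ?_
    rw [degIn, SimpleGraph.degree]
    symm
    refine Finset.card_bij (fun w _ => (w : ℕ)) ?_ ?_ ?_
    · intro w hw
      rw [SimpleGraph.mem_neighborFinset] at hw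
      exact Finset.mem_filter.2 ⟨Finset.mem_range.2 w.2, natGraph_adj.2 ⟨v.2, w.2, hw⟩⟩
    · intro w _ w' _ hww
      exact Fin.ext hww
    · intro w hw
      obtain ⟨-, hw⟩ := Finset.mem_filter.1 hw
      obtain ⟨_, hwh, hadj⟩ := natGraph_adj.1 hw
      exact ⟨⟨w, hwh⟩, (SimpleGraph.mem_neighborFinset _ _ _).2 hadj, rfl⟩
  have h2 : H.edgeSet.ncard = H.edgeFinset.card := by
    rw [← SimpleGraph.coe_edgeFinset, Set.ncard_coe_finset]
  rw [h1, SimpleGraph.sum_degrees_eq_twice_card_edges, graphSize, h2, Nat.card_fin]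
  omega

/-- In an expander of bounded degree, the vertices outside `D` with a neighbour in `D` are numerous:
at least `α / d` times the size of the smaller side of the cut. -/
theorem IsExpander.card_le {n d : ℕ} {α : ℝ} {G : SimpleGraph (Fin n)} (hG : IsExpander G α)
    (hd : MaxDegreeLE G d) {D B : Finset ℕ} (hD : D ⊆ Finset.range n)
    (hB : ∀ v < n, v ∉ D → (∃ w ∈ D, (natGraph G).Adj v w) → v ∈ B) (h0 : D.Nonempty)
    (hDn : D.card < n) :
    α * (min D.card (n - D.card) : ℕ) ≤ (d : ℝ) * B.card := by
  classical
  set A : Finset (Fin n) := Finset.univ.filter fun v => (v : ℕ) ∈ D with hA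
  set A' : Finset (Fin n) := Finset.univ.filter fun v => (v : ℕ) ∉ D with hA'
  have hcA : A.card = D.card := by
    refine Finset.card_bij (fun v _ => (v : ℕ)) ?_ (fun _ _ _ _ h => Fin.ext h) ?_
    · intro v hv; exact (Finset.mem_filter.1 hv).2
    · intro v hv
      exact ⟨⟨v, Finset.mem_range.1 (hD hv)⟩, Finset.mem_filter.2 ⟨Finset.mem_univ _, hv⟩, rfl⟩
  have hcA' : A'.card = n - D.card := by
    have := Finset.card_filter_add_card_filter_not (s := (Finset.univ : Finset (Fin n)))
      (fun v => (v : ℕ) ∈ D)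
    rw [Finset.card_univ, Fintype.card_fin] at this
    change A.card + A'.card = n at this
    omega
  have h1 := hG A A' (Finset.card_pos.1 (by rw [hcA]; exact h0.card_pos))
    (Finset.card_pos.1 (by omega))
    (by
      rw [Finset.disjoint_left]
      intro v hv hv'
      exact (Finset.mem_filter.1 hv').2 (Finset.mem_filter.1 hv).2)
    (fun v => by simp only [hA, hA', Finset.mem_filter, Finset.mem_univ, true_and]; tauto)
  rw [hcA, hcA'] at h1
  refine h1.trans ?_
  -- every edge of the cut leads to a vertex of `B`, and each of these has at most `d` edges
  set B' : Finset (Fin n) := Finset.univ.filter fun v => (v : ℕ) ∈ B with hB'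
  have hcB' : B'.card ≤ B.card := by
    refine Finset.card_le_card_of_injOn (fun v => (v : ℕ)) ?_ (fun _ _ _ _ h => Fin.ext h)
    intro v hv
    exact (Finset.mem_filter.1 hv).2
  have hsub : G.interedges A A' ⊆ B'.biUnion fun v =>
      (G.neighborFinset v).image fun w => (w, v) := by
    intro x hx
    obtain ⟨hx1, hx2, hx3⟩ := (SimpleGraph.mem_interedges_iff G).1 hx
    refine Finset.mem_biUnion.2 ⟨x.2, Finset.mem_filter.2 ⟨Finset.mem_univ _, ?_⟩,
      Finset.mem_image.2 ⟨x.1, (SimpleGraph.mem_neighborFinset _ _ _).2 hx3.symm, rfl⟩⟩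
    exact hB _ x.2.2 (Finset.mem_filter.1 hx2).2
      ⟨x.1, (Finset.mem_filter.1 hx1).2, natGraph_adj.2 ⟨x.2.2, x.1.2, hx3.symm⟩⟩
  have hcard : (G.interedges A A').card ≤ d * B.card := by
    refine (Finset.card_le_card hsub).trans ?_
    rw [mul_comm]
    refine (Finset.card_biUnion_le_card_mul _ _ d fun v _ => ?_).trans (Nat.mul_le_mul_right _ hcB')
    refine Finset.card_image_le.trans ?_
    have := hd v
    rwa [← SimpleGraph.coe_neighborFinset, Set.ncard_coe_finset] at this
  exact_mod_cast hcard

/-- Growth by the factor `1 + 1 / q` per round reaches `n` after at most `(q + 1) * log n`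
rounds. -/
theorem two_mul_le_floor {q n j : ℕ} (hq : 1 ≤ q) (hn : 1 ≤ n)
    (h : (q + 1) ^ j ≤ q ^ j * n) : 2 * j ≤ ⌊2 * ((q : ℝ) + 1) * Real.log n⌋₊ := by
  have hq0 : (0 : ℝ) < q := by exact_mod_cast hq
  have hn0 : (0 : ℝ) < n := by exact_mod_cast hn
  have h1 : (((q : ℝ) + 1) / q) ^ j ≤ n := by
    rw [div_pow, div_le_iff₀ (by positivity), mul_comm]
    exact_mod_cast h
  have h2 := Real.log_le_log (by positivity) h1
  rw [Real.log_pow] at h2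
  have h3 := Real.one_sub_inv_le_log_of_pos (show 0 < ((q : ℝ) + 1) / q by positivity)
  have h4 : 1 - (((q : ℝ) + 1) / q)⁻¹ = 1 / (q + 1) := by
    field_simp
    ring
  rw [h4] at h3
  have h5 : (j : ℝ) * (1 / (q + 1)) ≤ Real.log n :=
    (mul_le_mul_of_nonneg_left h3 (Nat.cast_nonneg j)).trans h2
  rw [mul_one_div, div_le_iff₀ (by positivity)] at h5
  refine Nat.le_floor ?_
  push_cast
  linarith

/-- With `c = 2 * 240 ^ 2`, the growth parameter `q = ⌊√(n / m)⌋` meets all requirements. -/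
theorem IsExpander.params {n h d : ℕ} {α : ℝ} {G : SimpleGraph (Fin n)} {H : SimpleGraph (Fin h)}
    (hn : 2 ≤ n) (hh : 1 ≤ h) (hα : 0 < α) (hα1 : α < 1) (hG : IsExpander G α)
    (hd : MaxDegreeLE G d)
    (hsize : (graphSize H : ℝ) ≤ n / (115200 * Real.logb 2 n ^ 2) * (α ^ 3 / d ^ 5))
    {m q : ℕ} (hm : m = h + ∑ u ∈ Finset.range h, degIn (natGraph H) h u)
    (hq1 : m * q ^ 2 ≤ n) (hq2 : n < m * (q + 1) ^ 2) :
    ∃ l M, Params (natGraph G) (natGraph H) n h q l M := by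
  have hm1 : 1 ≤ m := by omega
  have hm1' : (1 : ℝ) ≤ m := by exact_mod_cast hm1
  have hmsize : (m : ℝ) ≤ 2 * graphSize H := by
    rw [hm]; exact_mod_cast natGraph_degIn H
  have hn2 : (2 : ℝ) ≤ n := by exact_mod_cast hn
  have hn0 : (0 : ℝ) < n := by linarith
  set lg := Real.logb 2 n with hlg
  have hlg1 : 1 ≤ lg := by
    rw [hlg, Real.le_logb_iff_rpow_le (by norm_num) hn0]
    simpa using hn2
  have hd0 : d ≠ 0 := by
    rintro rfl
    simp only [CharP.cast_eq_zero, ne_eq, OfNat.ofNat_ne_zero, not_false_eq_true, zero_pow,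
      div_zero, mul_zero] at hsize
    linarith
  have hd1 : (1 : ℝ) ≤ d := by exact_mod_cast Nat.one_le_iff_ne_zero.2 hd0
  set b : ℝ := d / α with hb
  have hb1 : 1 ≤ b := by
    rw [hb, le_div_iff₀ hα]
    linarith
  have hb0 : 0 < b := by linarith
  -- the bound on `m`
  have hmb : m * (57600 * lg ^ 2 * b ^ 3) ≤ n := by
    have h1 : α ^ 3 / (d : ℝ) ^ 5 ≤ 1 / b ^ 3 := by
      rw [hb, div_pow, one_div_div]
      refine div_le_div_of_nonneg_left (by positivity) (by positivity) ?_
      exact pow_le_pow_right₀ hd1 (by norm_num)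
    have h2 : (graphSize H : ℝ) ≤ n / (115200 * lg ^ 2) * (1 / b ^ 3) :=
      hsize.trans (mul_le_mul_of_nonneg_left h1 (by positivity))
    rw [div_mul_div_comm, mul_one, le_div_iff₀ (by positivity)] at h2
    have h3 : (0 : ℝ) ≤ 57600 * lg ^ 2 * b ^ 3 := by positivity
    nlinarith [mul_le_mul_of_nonneg_right hmsize h3]
  have hq1' : (m : ℝ) * q ^ 2 ≤ n := by exact_mod_cast hq1
  have hq2' : (n : ℝ) < m * (q + 1) ^ 2 := by exact_mod_cast hq2
  have hq4 : 4 * b ≤ q := by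
    have h1 : 57600 * lg ^ 2 * b ^ 3 < ((q : ℝ) + 1) ^ 2 := by
      have := hmb.trans_lt hq2'
      exact lt_of_mul_lt_mul_left this (by linarith)
    have h2 : (240 * b) ^ 2 ≤ 57600 * lg ^ 2 * b ^ 3 := by
      have h3 : 1 ≤ lg ^ 2 := one_le_pow₀ hlg1
      have h4 : b ^ 2 ≤ b ^ 3 := pow_le_pow_right₀ hb1 (by norm_num)
      have h5 : b ^ 2 ≤ lg ^ 2 * b ^ 3 :=
        h4.trans (le_mul_of_one_le_left (by positivity) h3)
      linarith
    have h6 : 240 * b < q + 1 := lt_of_pow_lt_pow_left₀ 2 (by positivity) (h2.trans_lt h1)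
    linarith
  have hq1r : (1 : ℝ) ≤ q := by linarith
  have hqn : 1 ≤ q := by exact_mod_cast hq1r
  -- the bound on the total size of the branch sets
  have hmq : 240 * (m * q * lg * b) ≤ n := by
    refine le_of_sq_le_sq ?_ hn0.le
    have h1 : (m : ℝ) * (m * q ^ 2) ≤ m * n := mul_le_mul_of_nonneg_left hq1' (by linarith)
    have h2 : b ^ 2 ≤ b ^ 3 := pow_le_pow_right₀ hb1 (by norm_num)
    calc (240 * (m * q * lg * b)) ^ 2 = 57600 * lg ^ 2 * (m * (m * q ^ 2)) * b ^ 2 := by ring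
      _ ≤ 57600 * lg ^ 2 * (m * n) * b ^ 3 := by gcongr
      _ = (m * (57600 * lg ^ 2 * b ^ 3)) * n := by ring
      _ ≤ n * n := by gcongr
      _ = (n : ℝ) ^ 2 := by ring
  set l := ⌊2 * ((q : ℝ) + 1) * Real.log n⌋₊ with hl
  have hlog : Real.log n ≤ lg := by
    rw [hlg, Real.logb, le_div_iff₀ (Real.log_pos (by norm_num))]
    have h1 : Real.log 2 ≤ 1 := by
      have := Real.log_two_lt_d9
      linarith
    have h2 : 0 ≤ Real.log n := Real.log_nonneg (by linarith)
    nlinarith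
  have hl5 : (1 : ℝ) + l ≤ 5 * (q * lg) := by
    have h1 : (l : ℝ) ≤ 2 * (q + 1) * Real.log n :=
      Nat.floor_le (mul_nonneg (by positivity) (Real.log_nonneg (by linarith)))
    have h2 : 2 * ((q : ℝ) + 1) * Real.log n ≤ 2 * (q + 1) * lg := by gcongr
    nlinarith
  have hM : (48 : ℝ) * (m * (1 + l)) * b ≤ n := by
    have h1 : (m : ℝ) * (1 + l) ≤ m * (5 * (q * lg)) := by gcongr
    have h2 : 48 * (m * (1 + l)) * b ≤ 48 * (m * (5 * (q * lg))) * b := by gcongr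
    linarith
  have hM' : 12 * (m * (1 + l)) ≤ n := by
    have h1 : (12 : ℝ) * (m * (1 + l)) ≤ n := by
      have h2 : (m : ℝ) * (1 + l) ≤ m * (1 + l) * b := le_mul_of_one_le_right (by positivity) hb1
      have h3 : (0 : ℝ) ≤ m * (1 + l) := by positivity
      linarith
    exact_mod_cast h1
  have hlM : 1 * (1 + l) ≤ m * (1 + l) := Nat.mul_le_mul_right _ hm1
  refine ⟨l, m * (1 + l), ⟨by omega, ?_, hM', ?_, by omega, fun j hj => ?_⟩⟩
  · rw [Finset.sum_add_distrib, ← Finset.sum_mul]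
    simp only [Finset.sum_const, Finset.card_range, smul_eq_mul, mul_one]
    rw [hm]
    generalize ∑ u ∈ Finset.range h, degIn (natGraph H) h u = S
    have : (h + S) * (1 + l) = h + S * l + (h * l + S) := by ring
    omega
  · intro D W R hcover hDn hD hthin hW
    rcases D.eq_empty_or_nonempty with rfl | hne
    · simp
    have hDpos := hne.card_pos
    have h1 := hG.card_le hd (B := bdry (natGraph G) R D ∪ W) hDn
      (fun v hv hvD hw => by
        rcases (hcover v).1 hv with h | h | h
        · exact absurd h hvD
        · exact Finset.mem_union_right _ h
        · exact Finset.mem_union_left _ (mem_bdry.2 ⟨h, hvD, hw⟩)) hne (by omega)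
    have h2 : ((bdry (natGraph G) R D ∪ W).card : ℝ) ≤
        (bdry (natGraph G) R D).card + m * (1 + l) := by
      have := (Finset.card_union_le (bdry (natGraph G) R D) W).trans
        (Nat.add_le_add_left hW _)
      exact_mod_cast this
    have h3 : (D.card : ℝ) ≤ 2 * (min D.card (n - D.card) : ℕ) := by
      have : D.card ≤ 2 * min D.card (n - D.card) := by omega
      exact_mod_cast this
    have hthin' : ((bdry (natGraph G) R D).card : ℝ) * q ≤ D.card := by exact_mod_cast hthin
    have h4 : (D.card : ℝ) ≤ 2 * b * ((bdry (natGraph G) R D).card + m * (1 + l)) := by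
      have h5 : α * D.card ≤ 2 * (d * ((bdry (natGraph G) R D).card + m * (1 + l))) := by
        have h6 := mul_le_mul_of_nonneg_left h3 hα.le
        have h7 := mul_le_mul_of_nonneg_left h2 (Nat.cast_nonneg (α := ℝ) d)
        linarith
      rw [hb, mul_div_assoc', div_mul_eq_mul_div, le_div_iff₀ hα]
      linarith
    have h5 : (4 * b) * (bdry (natGraph G) R D).card ≤ D.card := by
      have := mul_le_mul_of_nonneg_right hq4 (Nat.cast_nonneg (α := ℝ) (bdry (natGraph G) R D).card)
      linarith
    have h6 : (12 : ℝ) * D.card ≤ n := by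
      have h7 : 2 * b * ((bdry (natGraph G) R D).card + (m : ℝ) * (1 + l)) =
          4 * b * (bdry (natGraph G) R D).card / 2 + 48 * (m * (1 + l)) * b / 24 := by ring
      linarith
    exact_mod_cast h6
  · exact two_mul_le_floor hqn (by omega) hj

/-! ### The model -/

theorem connected_of_linked {n : ℕ} {G : SimpleGraph (Fin n)} {f : ℕ → ℕ} {k : ℕ}
    (hl : Linked (natGraph G) (cls n f k)) (hne : (cls n f k).Nonempty) :
    (G.induce {v : Fin n | f v = k}).Connected := by
  have key : ∀ a b : ℕ, Relation.ReflTransGen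
      (fun x y => (natGraph G).Adj x y ∧ x ∈ cls n f k ∧ y ∈ cls n f k) a b →
      ∀ (ha : a < n) (hb : b < n) (hak : f a = k) (hbk : f b = k),
        (G.induce {v : Fin n | f v = k}).Reachable ⟨⟨a, ha⟩, hak⟩ ⟨⟨b, hb⟩, hbk⟩ := by
    intro a b hab
    induction hab with
    | refl => intro ha hb hak hbk; exact .refl _
    | @tail b c _ hbc ih =>
      intro ha hc hak hck
      obtain ⟨hadj, hb, -⟩ := hbc
      obtain ⟨hbn, hbk⟩ := mem_cls.1 hb
      refine (ih ha hbn hak hbk).trans (SimpleGraph.Adj.reachable ?_)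
      obtain ⟨_, _, h⟩ := natGraph_adj.1 hadj
      exact h
  obtain ⟨v, hv⟩ := hne
  obtain ⟨hvn, hvk⟩ := mem_cls.1 hv
  rw [SimpleGraph.connected_iff]
  refine ⟨?_, ⟨⟨⟨v, hvn⟩, hvk⟩⟩⟩
  rintro ⟨⟨a, ha⟩, hak⟩ ⟨⟨b, hb⟩, hbk⟩
  exact key a b (hl a (mem_cls.2 ⟨ha, hak⟩) b (mem_cls.2 ⟨hb, hbk⟩)) ha hb hak hbk

/-- Connected label classes, together with an edge between the classes of any two adjacent vertices,
form a model whose paths are single edges. -/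
theorem exists_model {n h : ℕ} {G : SimpleGraph (Fin n)} {H : SimpleGraph (Fin h)} {s : RAM.State}
    (hl : ∀ u < h, Linked (natGraph G) (cls n (s.arr 2) (u + 1)))
    (hne : ∀ u < h, (cls n (s.arr 2) (u + 1)).Nonempty)
    (hout : ∀ u w : Fin h, H.Adj u w → ∃ a ∈ cls n (s.arr 2) (u + 1),
      ∃ b ∈ cls n (s.arr 2) (w + 1), (natGraph G).Adj a b ∧
        (List.range (s.arr 4 (u * h + w))).map (fun k => s.arr 5 (s.arr 3 (u * h + w) + k)) =
          [a, b]) :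
    ∃ M : MinorModel H G, s.Represents M := by
  have hout' : ∀ u w : Fin h, ∃ ab : Fin n × Fin n, H.Adj u w → s.arr 2 ab.1 = u + 1 ∧
      s.arr 2 ab.2 = w + 1 ∧ G.Adj ab.1 ab.2 ∧
        (List.range (s.arr 4 (u * h + w))).map (fun k => s.arr 5 (s.arr 3 (u * h + w) + k)) =
          [(ab.1 : ℕ), (ab.2 : ℕ)] := by
    intro u w
    obtain ⟨v, hv⟩ := hne u u.2
    by_cases huw : H.Adj u w
    · obtain ⟨a, ha, b, hb, hab, hlist⟩ := hout u w huw
      obtain ⟨ha', hb', hab'⟩ := natGraph_adj.1 hab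
      exact ⟨(⟨a, ha'⟩, ⟨b, hb'⟩), fun _ => ⟨(mem_cls.1 ha).2, (mem_cls.1 hb).2, hab', hlist⟩⟩
    · exact ⟨(⟨v, (mem_cls.1 hv).1⟩, ⟨v, (mem_cls.1 hv).1⟩), fun h => absurd h huw⟩
  choose E hE using hout'
  have hs2 : ∀ e : Sym2 (Fin h), e = s(e.inf, e.sup) := by
    intro e
    induction e with
    | h u w =>
      rcases le_total u w with h | h
      · simp [h]
      · simp [h, Sym2.eq_swap]
  have hadj : ∀ e : H.edgeSet, H.Adj (e : Sym2 (Fin h)).inf (e : Sym2 (Fin h)).sup := by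
    intro e
    have := e.2
    rw [hs2 e.1] at this
    exact this
  refine ⟨{
    branch := fun u => {v : Fin n | s.arr 2 v = u + 1}
    src := fun e => (E e.1.inf e.1.sup).1
    tgt := fun e => (E e.1.inf e.1.sup).2
    path := fun e => (hE _ _ (hadj e)).2.2.1.toWalk
    isPath := fun e => by
      simpa using (hE _ _ (hadj e)).2.2.1.ne
    connected := fun u => connected_of_linked (hl u u.2) (hne u u.2)
    connects := fun e => ⟨e.1.inf, e.1.sup, hs2 e.1, (hE _ _ (hadj e)).1, (hE _ _ (hadj e)).2.1⟩
    disjoint := fun u w huw => by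
      rw [Set.disjoint_left]
      intro v hv hv'
      simp only [Set.mem_ofPred_eq] at hv hv'
      exact huw (Fin.ext (by omega))
    path_path := fun e e' _ x hx hx' => by
      simp only [SimpleGraph.Walk.support_cons, SimpleGraph.Walk.support_nil, List.mem_cons,
        List.not_mem_nil, or_false] at hx hx'
      exact ⟨hx, hx'⟩
    path_branch := fun e u x hx _ => by
      simpa only [SimpleGraph.Walk.support_cons, SimpleGraph.Walk.support_nil, List.mem_cons,
        List.not_mem_nil, or_false] using hx }, fun u v => Iff.rfl, fun u w huw hlt => ?_⟩
  have h1 : (s(u, w) : Sym2 (Fin h)).inf = u := by simp [hlt.le]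
  have h2 : (s(u, w) : Sym2 (Fin h)).sup = w := by simp [hlt.le]
  rw [(hE u w huw).2.2.2]
  change [((E (s(u, w) : Sym2 (Fin h)).inf (s(u, w) : Sym2 (Fin h)).sup).1 : ℕ),
    ((E (s(u, w) : Sym2 (Fin h)).inf (s(u, w) : Sym2 (Fin h)).sup).2 : ℕ)] = _
  rw [h1, h2]

/-! ### The algorithm as a whole -/

namespace RAM

namespace Algorithm

open Cmd

variable {n h : ℕ}

theorem den_setBound {N : ℕ} (s : State) :
    setBound.den N s = { s with var := Function.update s.var 2 (N * (N * 2)) } := by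
  simp [setBound, Cmd.den]

/-- The initial part of the program leaves the input in place and provides the loop invariant, and
so the main loop ends with a complete model, which is then written down. -/
theorem den_main {d : ℕ} {α : ℝ} {G : SimpleGraph (Fin n)} {H : SimpleGraph (Fin h)}
    (hn : 2 ≤ n) (hα : 0 < α) (hα1 : α < 1) (hG : IsExpander G α) (hd : MaxDegreeLE G d)
    (hsize : (graphSize H : ℝ) ≤ n / (115200 * Real.logb 2 n ^ 2) * (α ^ 3 / d ^ 5))
    (hhn : h ≤ n) :
    ∃ M : MinorModel H G,
      (main.den (n * (n * 2)) (setBound.den n (inputState G H))).Represents M := by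
  set N := n * (n * 2) with hN
  rcases Nat.eq_zero_or_pos h with rfl | hh
  · exact exists_model (fun u hu => absurd hu (by omega)) (fun u hu => absurd hu (by omega))
      (fun u => u.elim0)
  have hnN : n < N := by nlinarith
  set s := setBound.den n (inputState G H) with hs
  have hvar : ∀ x, x ≠ 2 → s.var x = if x = 0 then n else if x = 1 then h else 0 := by
    intro x hx
    rw [hs, den_setBound]
    simp [inputState, hx]
  have harr : s.arr = (inputState G H).arr := by rw [hs, den_setBound]
  have h0 : s.var 0 = n := by rw [hvar 0 (by decide)]; simp
  have h1 : s.var 1 = h := by rw [hvar 1 (by decide)]; simp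
  have h3 : s.var 3 = 0 := by rw [hvar 3 (by decide)]; simp
  have ha0 : s.arr 0 = adjArray G := by rw [harr]; simp [inputState]
  have ha1 : s.arr 1 = adjArray H := by rw [harr]; simp [inputState]
  have ha2 : s.arr 2 = fun _ => 0 := by rw [harr]; simp [inputState]
  obtain ⟨ha, hv, m, hm, hq⟩ := den_setParameters h0 h1 ha1 (hhn.trans hnN.le) hnN
  obtain ⟨hq1, hq2⟩ := hq (by omega)
  rw [main, den_seq, den_seq]
  generalize setParameters.den N s = s₁ at ha hv hq1 hq2
  obtain ⟨l, M, hP⟩ := hG.params hn hh hα hα1 hd hsize hm hq1 hq2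
  have hinv : LoopInv G H (s₁.var 6) l N s₁ := by
    refine ⟨⟨by rw [hv 0 (by decide), h0], by rw [hv 1 (by decide), h1], rfl,
      by rw [ha, ha0], by rw [ha, ha1]⟩, ?_, ?_, ?_⟩
    · rw [ha, ha2]; exact PartialModel.init _ _ _ _ _ _
    · rw [hv 3 (by decide), h3]; omega
    · intro c hc
      rw [hv 3 (by decide), h3] at hc
      omega
  have hbound : (n + 1) * ((h + 1) * (n + 1)) ≤ N * N := by
    calc (n + 1) * ((h + 1) * (n + 1)) ≤ (2 * n) * ((2 * n) * (2 * n)) := by gcongr <;> omega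
      _ = n * (n * 2) * (4 * n) := by ring
      _ ≤ N * N := Nat.mul_le_mul_left _ (by rw [hN]; nlinarith)
  obtain ⟨hinv', hne⟩ := den_loop hnN.le (hhn.trans hnN.le) hP hbound hinv
  generalize (Cmd.rep (.rep step)).den N s₁ = s₂ at hinv' hne
  have hout2 : ((Cmd.seq findEdges writePaths).den N s₂).arr 2 = s₂.arr 2 := by
    rw [den_seq, writePaths, den_seq, den_seq, den_fill_of_ne (by decide),
      den_fill_of_ne (by decide),
      den_fill_of_ne (by decide), findEdges, den_seq, den_fill_of_ne (by decide),
      den_fill_of_ne (by decide)]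
  have hhN : 2 * (h * h) ≤ N := by
    calc 2 * (h * h) ≤ 2 * (n * n) := by gcongr
      _ = N := by rw [hN]; ring
  refine exists_model ?_ ?_ ?_
  · rw [hout2]; exact hinv'.model.linked
  · rw [hout2]; exact hne
  · intro u w huw
    rw [hout2]
    exact den_output hinv'.ctx hnN.le hhN u.2 w.2 (hinv'.model.adj u u.2 w w.2
      (natGraph_adj.2 ⟨u.2, w.2, huw⟩) (hne u u.2) (hne w w.2))

/-- The compiled program halts on every input, in time polynomial in `n`, with the effect of the
commands. -/
theorem run_program (ω : ℕ → Bool) (G : SimpleGraph (Fin n)) (H : SimpleGraph (Fin h)) :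
    ∃ t s, Run ω program (inputState G H) t s ∧
      t ≤ (setBound.cost + main.cost.comp (Polynomial.X * (Polynomial.X * 2))).eval n ∧
      s.arr = (main.den (n * (n * 2)) (setBound.den n (inputState G H))).arr := by
  obtain ⟨t₁, s₁, hr₁, ht₁, hs₁⟩ := run_compile ω setBound 20 (by decide) setBound_ok
    (inputState G H)
  obtain ⟨t₂, s₂, hr₂, ht₂, hs₂⟩ := run_compile ω main 20 (by decide) main_ok s₁
  have h0 : (inputState G H).var 0 = n := by simp [inputState]
  rw [h0] at ht₁ hs₁
  have h2 : s₁.var 2 = n * (n * 2) := by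
    rw [hs₁.2 2 (by decide), den_setBound]
    simp
  rw [h2] at ht₂ hs₂
  refine ⟨_, s₂, .seq hr₁ hr₂, ?_, (hs₂.trans (hs₁.den main_ok)).1⟩
  simp only [Polynomial.eval_add, Polynomial.eval_comp, Polynomial.eval_mul, Polynomial.eval_X,
    Polynomial.eval_ofNat]
  omega

end Algorithm

instance : IsProbabilityMeasure coinLaw := by
  unfold coinLaw
  infer_instance

end RAM

/-! ### Isomorphic graphs -/

section Iso

variable {V V' U U' : Type*} {G : SimpleGraph V} {G' : SimpleGraph V'} {H : SimpleGraph U}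
  {H' : SimpleGraph U'}

theorem graphSize_congr (ψ : H ≃g H') : graphSize H = graphSize H' := by
  rw [graphSize, graphSize, Nat.card_congr ψ.toEquiv, ← Nat.card_coe_set_eq, ← Nat.card_coe_set_eq,
    Nat.card_congr ψ.mapEdgeSet]

theorem MaxDegreeLE.of_iso {d : ℕ} (φ : G ≃g G') (h : MaxDegreeLE G d) : MaxDegreeLE G' d := by
  intro v
  have := h (φ.symm v)
  rw [← Nat.card_coe_set_eq] at this ⊢
  rwa [← Nat.card_congr (φ.symm.mapNeighborSet v)] at this

theorem IsExpander.of_iso {α : ℝ} (φ : G ≃g G') (h : IsExpander G α) : IsExpander G' α := by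
  classical
  intro A B hA hB hAB hall
  have := h (A.map φ.symm.toEquiv.toEmbedding) (B.map φ.symm.toEquiv.toEmbedding) (hA.map)
    (hB.map) ((Finset.disjoint_map _).2 hAB) (fun v => by
      have := hall (φ v)
      simp only [Finset.mem_map_equiv]
      exact this)
  rw [Finset.card_map, Finset.card_map] at this
  refine this.trans (Nat.cast_le.2 ?_)
  refine Finset.card_le_card_of_injOn (fun x => (φ x.1, φ x.2)) ?_ ?_
  · intro x hx
    obtain ⟨h1, h2, h3⟩ := (SimpleGraph.mem_interedges_iff _).1 hx
    rw [Finset.mem_map_equiv] at h1 h2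
    exact (SimpleGraph.mem_interedges_iff _).2 ⟨h1, h2, φ.map_adj_iff.2 h3⟩
  · rintro ⟨a, b⟩ _ ⟨a', b'⟩ _ hab
    simpa using hab

theorem IsMinorOf.of_iso (φ : G' ≃g G) (ψ : H ≃g H') (h : IsMinorOf H' G') : IsMinorOf H G := by
  obtain ⟨M⟩ := h
  have hsupp : ∀ (e : H'.edgeSet) (x : V), x ∈ ((M.path e).map φ.toHom).support →
      φ.symm x ∈ (M.path e).support := by
    intro e x hx
    rw [SimpleGraph.Walk.support_map, List.mem_map] at hx
    obtain ⟨y, hy, rfl⟩ := hx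
    simpa using hy
  have hend : ∀ x y, φ.symm x = y → x = φ y := by
    rintro x y rfl
    simp
  exact ⟨{
    branch := fun u => φ.symm ⁻¹' M.branch (ψ u)
    src := fun e => φ (M.src (ψ.mapEdgeSet e))
    tgt := fun e => φ (M.tgt (ψ.mapEdgeSet e))
    path := fun e => (M.path (ψ.mapEdgeSet e)).map φ.toHom
    isPath := fun e => (M.isPath _).map φ.injective
    connected := fun u => by
      have hc := M.connected (ψ u)
      refine (SimpleGraph.Iso.connected_iff ?_).1 hc
      exact { toEquiv := φ.toEquiv.subtypeEquiv fun v => by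
                change v ∈ M.branch (ψ u) ↔ φ.symm (φ v) ∈ M.branch (ψ u)
                rw [φ.symm_apply_apply]
              map_rel_iff' := φ.map_adj_iff }
    connects := fun e => by
      obtain ⟨u, w, he, hu, hw⟩ := M.connects (ψ.mapEdgeSet e)
      refine ⟨ψ.symm u, ψ.symm w, ?_, ?_, ?_⟩
      · have h1 : Sym2.map ψ (e : Sym2 U) = s(u, w) := he
        have h2 := congrArg (Sym2.map ψ.symm) h1
        rw [Sym2.map_map, Sym2.map_mk] at h2
        have h3 : (ψ.symm ∘ ψ : U → U) = id := by
          funext x; simp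
        rw [h3, Sym2.map_id] at h2
        exact h2
      · simpa using hu
      · simpa using hw
    disjoint := fun u w huw => (M.disjoint _ _ (ψ.injective.ne huw)).preimage _
    path_path := fun e e' hee x hx hx' => by
      obtain ⟨h1, h2⟩ := M.path_path _ _ (ψ.mapEdgeSet.injective.ne hee) _ (hsupp _ _ hx)
        (hsupp _ _ hx')
      exact ⟨h1.imp (hend _ _) (hend _ _), h2.imp (hend _ _) (hend _ _)⟩
    path_branch := fun e u x hx hxu =>
      (M.path_branch _ _ _ (hsupp _ _ hx) hxu).imp (hend _ _) (hend _ _) }⟩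

end Iso

/-- The number of vertices of `H` is at most that of `G`, because the size bound is at most `n`. -/
theorem card_le_of_size_le {n h d : ℕ} {α : ℝ} {H : SimpleGraph (Fin h)} (hn : 2 ≤ n) (hα : 0 < α)
    (hα1 : α < 1)
    (hsize : (graphSize H : ℝ) ≤ n / (115200 * Real.logb 2 n ^ 2) * (α ^ 3 / d ^ 5)) : h ≤ n := by
  have hn2 : (2 : ℝ) ≤ n := by exact_mod_cast hn
  have hlg1 : 1 ≤ Real.logb 2 n := by
    rw [Real.le_logb_iff_rpow_le (by norm_num) (by linarith)]
    simpa using hn2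
  have h1 : (n : ℝ) / (115200 * Real.logb 2 n ^ 2) ≤ n := by
    refine div_le_self (by linarith) ?_
    have := one_le_pow₀ (n := 2) hlg1
    linarith
  have h2 : α ^ 3 / (d : ℝ) ^ 5 ≤ 1 := by
    rcases Nat.eq_zero_or_pos d with rfl | hd
    · simp
    · have hd1 : (1 : ℝ) ≤ d := by exact_mod_cast hd
      rw [div_le_one (by positivity)]
      exact (pow_le_one₀ hα.le hα1.le).trans (one_le_pow₀ hd1)
  have h3 : (graphSize H : ℝ) ≤ n := hsize.trans
    ((mul_le_mul h1 h2 (by positivity) (by linarith)).trans (by rw [mul_one]))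
  have h4 : h ≤ graphSize H := by
    rw [graphSize, Nat.card_fin]
    omega
  have h5 : graphSize H ≤ n := by exact_mod_cast h3
  omega

/-- The real polynomial that takes the values of a polynomial with natural coefficients in the first
variable. -/
theorem exists_mvPolynomial (p : Polynomial ℕ) : ∃ T : MvPolynomial (Fin 2) ℝ,
    ∀ (n : ℕ) (x : ℝ), MvPolynomial.eval ![(n : ℝ), x] T = (p.eval n : ℕ) := by
  refine ⟨p.eval₂ (Nat.castRingHom _) (MvPolynomial.X 0), fun n x => ?_⟩
  rw [Polynomial.hom_eval₂, MvPolynomial.eval_X, Subsingleton.elim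
    ((MvPolynomial.eval ![(n : ℝ), x]).comp (Nat.castRingHom _)) (Nat.castRingHom ℝ)]
  exact Polynomial.eval₂_at_natCast (Nat.castRingHom ℝ) n

theorem exists_run {n h d : ℕ} {α : ℝ} {G : SimpleGraph (Fin n)} {H : SimpleGraph (Fin h)}
    (hn : 2 ≤ n) (hα : 0 < α) (hα1 : α < 1) (hG : IsExpander G α) (hd : MaxDegreeLE G d)
    (hsize : (graphSize H : ℝ) ≤ n / (115200 * Real.logb 2 n ^ 2) * (α ^ 3 / d ^ 5))
    (ω : ℕ → Bool) :
    ∃ (t : ℕ) (s : RAM.State), RAM.Run ω RAM.Algorithm.program (RAM.inputState G H) t s ∧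
      ∃ M : MinorModel H G, s.Represents M := by
  obtain ⟨t, s, hr, -, hs⟩ := RAM.Algorithm.run_program ω G H
  obtain ⟨M, hM⟩ := RAM.Algorithm.den_main hn hα hα1 hG hd hsize
    (card_le_of_size_le hn hα hα1 hsize)
  refine ⟨t, s, hr, M, ?_⟩
  simpa only [RAM.State.Represents, hs] using hM

theorem theorem2 :
    ∃ c : ℝ, 0 < c ∧
      -- the algorithm
      (∀ k : ℕ, ∃ (A : RAM.Program) (T : MvPolynomial (Fin 2) ℝ),
        ∀ (n h d : ℕ) (α : ℝ) (G : SimpleGraph (Fin n)) (H : SimpleGraph (Fin h)),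
          2 ≤ n → 0 < α → α < 1 → IsExpander G α → MaxDegreeLE G d →
          (graphSize H : ℝ) ≤ n / (c * Real.logb 2 n ^ 2) * (α ^ 3 / d ^ 5) →
          (∀ ω : ℕ → Bool, ∃ (t : ℕ) (s : RAM.State),
            RAM.Run ω A (RAM.inputState G H) t s ∧
              (t : ℝ) ≤ MvPolynomial.eval ![(n : ℝ), (d : ℝ) / α] T) ∧
          1 - 1 / (n : ℝ) ^ k ≤
            RAM.coinLaw.real {ω | ∃ (t : ℕ) (s : RAM.State),
              RAM.Run ω A (RAM.inputState G H) t s ∧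
                ∃ M : MinorModel H G, s.Represents M}) ∧
      -- the existence of minors
      (∀ (V U : Type*) [Fintype V] [Fintype U] (d : ℕ) (α : ℝ)
        (G : SimpleGraph V) (H : SimpleGraph U),
          2 ≤ Fintype.card V → 0 < α → α < 1 → IsExpander G α → MaxDegreeLE G d →
          (graphSize H : ℝ) ≤
            Fintype.card V / (c * Real.logb 2 (Fintype.card V) ^ 2) * (α ^ 3 / d ^ 5) →
          IsMinorOf H G) := by
  obtain ⟨T, hT⟩ := exists_mvPolynomial (RAM.Algorithm.setBound.cost +
    RAM.Algorithm.main.cost.comp (Polynomial.X * (Polynomial.X * 2)))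
  refine ⟨115200, by norm_num, fun k => ⟨RAM.Algorithm.program, T, ?_⟩, ?_⟩
  · intro n h d α G H hn hα hα1 hG hd hsize
    refine ⟨fun ω => ?_, ?_⟩
    · obtain ⟨t, s, hr, ht, -⟩ := RAM.Algorithm.run_program ω G H
      refine ⟨t, s, hr, ?_⟩
      rw [hT]
      exact_mod_cast ht
    · -- the program tosses no coins and never fails
      have huniv : {ω | ∃ (t : ℕ) (s : RAM.State),
          RAM.Run ω RAM.Algorithm.program (RAM.inputState G H) t s ∧
            ∃ M : MinorModel H G, s.Represents M} = Set.univ :=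
        Set.eq_univ_of_forall fun ω => exists_run hn hα hα1 hG hd hsize ω
      rw [huniv, probReal_univ]
      have : (0 : ℝ) ≤ 1 / (n : ℝ) ^ k := by positivity
      linarith
  · intro V U _ _ d α G H hn hα hα1 hG hd hsize
    let φ : G ≃g G.overFin rfl := G.overFinIso rfl
    let ψ : H ≃g H.overFin rfl := H.overFinIso rfl
    rw [graphSize_congr ψ] at hsize
    obtain ⟨-, -, -, M, -⟩ := exists_run hn hα hα1 (hG.of_iso φ) (hd.of_iso φ) hsize
      (fun _ => false)
    exact IsMinorOf.of_iso φ.symm ψ ⟨M⟩
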